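/- Fix $0<q<1$ and write $(a;p)_k=\prod_{r=0}^{k-1}(1-ap^r)$, $(a_1,\dots,a_s;p)_k=\prod_u(a_u;p)_k$, and $\left[{n\atop k}\right]_p=(p^n;p^{-1})_k/(p;p)_k$. **Algebras.** Let $\mathcal A=\mathcal A_q(SU(2))$ be the complex unital algebra with generators $\alpha,\beta,\gamma,\delta$ and relations $\alpha\beta=q\beta\alpha$, $\alpha\gamma=q\gamma\alpha$, $\beta\delta=q\delta\beta$, $\gamma\delta=q\delta\gamma$, $\beta\gamma=\gamma\beta$, $\alpha\delta-q\beta\gamma=\delta\alpha-q^{-1}\beta\gamma=1$, with comultiplication $\Delta\begin{pmatrix}\alpha&\beta\\\gamma&\delta\end{pmatrix}=\begin{pmatrix}\alpha&\beta\\\gamma&\delta\end{pmatrix}\otimes\begin{pmatrix}\alpha&\beta\\\gamma&\delta\end{pmatrix}$ (matrix product). Let $\mathcal U=\mathcal U_q(\mathfrak{su}(2))$ be generated by $A,B,C,D$ with $AD=DA=1$, $AB=qBA$, $AC=q^{-1}CA$, $BC-CB=(A^2-D^2)/(q-q^{-1})$, with $\Delta(A)=A\otimes A$, $\Delta(D)=D\otimes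 D$, $\Delta(B)=A\otimes B+B\otimes D$, $\Delta(C)=A\otimes C+C\otimes D$ and counit $\varepsilon(A)=\varepsilon(D)=1$, $\varepsilon(B)=\varepsilon(C)=0$. The pairing $\langle\cdot,\cdot\rangle:\mathcal U\times\mathcal A\to\mathbb C$ is the one for which $X\mapsto\langle X,\begin{pmatrix}\alpha&\beta\\\gamma&\delta\end{pmatrix}\rangle$ is the representation of $\mathcal U$ with $A\mapsto\mathrm{diag}(q^{1/2},q^{-1/2})$, $D\mapsto\mathrm{diag}(q^{-1/2},q^{1/2})$, $B\mapsto\begin{pmatrix}0&1\\0&0\end{pmatrix}$, $C\mapsto\begin{pmatrix}0&0\\1&0\end{pmatrix}$, and $\langle X,\xi\eta\rangle=\langle\Delta X,\xi\otimes\eta\rangle$, $\langle X,1\rangle=\varepsilon(X)$. For $X\in\mathcal U$, $\xi\in\mathcal A$ put $X.\xi=(\mathrm{id}\otimes\langle X,\cdot\rangle)\Delta(\xi)$. **Representations.** For $l\in\frac12\mathbb Z_{\ge0}$ let $t^l$ be the $(2l+1)$-dimensional representation of $\mathcal U$ with orthonormal basis $e_n^l$, $n=-l,-l+1,\dots,l$,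 and $$t^l(A)e^l_n=q^{-n}e^l_n,\qquad t^l(D)e^l_n=q^{n}e^l_n,$$ $$t^l(B)e^l_n=\frac{\sqrt{(q^{-l+n-1}-q^{l-n+1})(q^{-l-n}-q^{l+n})}}{q^{-1}-q}\,e^l_{n-1},\qquad t^l(C)e^l_n=\frac{\sqrt{(q^{-l+n}-q^{l-n})(q^{-l-n-1}-q^{l+n+1})}}{q^{-1}-q}\,e^l_{n+1}.$$ For $\sigma\in\mathbb R$ and $j\in\{-l,-l+1,\dots,l\}$ put $v^{l,j}(\sigma)=\sum_n v^{l,j}_n(\sigma)e^l_n$ with $$v_n^{l,j}(\sigma)=C^{l,j}(\sigma)\,i^{\,n-l}q^{\sigma(l-n)}q^{\frac12(l-n)(l-n-1)}\left(\frac{(q^{4l};q^{-2})_{l-n}}{(q^2;q^2)_{l-n}}\right)^{1/2}\sum_{k=0}^{l-n}\frac{(q^{-2(l-n)},q^{2j-2l},-q^{-2j-2l-2\sigma};q^2)_k}{(q^{-4l},q^2;q^2)_k}q^{2k}$$ (here $i=\sqrt{-1}$) and $$C^{l,j}(\sigma)=q^{l+j}\left[{2l\atop l-j}\right]_{q^2}^{1/2}\left(\frac{1+q^{-4j-2\sigma}}{1+q^{-2\sigma}}\right)^{1/2}\bigl((-q^{2-2\sigma};q^2)_{l-j}(-q^{2+2\sigma};q^2)_{l+j}\bigr)^{-1/2}.$$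 **Generalised matrix elements.** For $\sigma,\tau\in\mathbb R$ let $a^l_{i,j}(\tau,\sigma)$ be the element of $\mathcal A$ with $\langle X,a^l_{i,j}(\tau,\sigma)\rangle=\langle t^l(X)v^{l,j}(\sigma),v^{l,i}(\tau)\rangle$ for all $X\in\mathcal U$, and let $b^l_{i,j}(\tau,\sigma)=A.a^l_{i,j}(\tau,\sigma)$. Let $$\rho_{\tau,\sigma}=\tfrac12\bigl(\alpha^2+\delta^2+q\gamma^2+q^{-1}\beta^2+i(q^{-\sigma}-q^\sigma)(q\delta\gamma+\beta\alpha)-i(q^{-\tau}-q^\tau)(\delta\beta+q\gamma\alpha)+(q^{-\sigma}-q^\sigma)(q^{-\tau}-q^\tau)\beta\gamma\bigr)\in\mathcal A$$ (again with $i=\sqrt{-1}$). **Askey–Wilson polynomials.** Put $$p_n(\cos\theta;a,b,c,d\mid p)=a^{-n}(ab,ac,ad;p)_n\sum_{k=0}^n\frac{(p^{-n},abcdp^{n-1},ae^{i\theta},ae^{-i\theta};p)_k}{(ab,ac,ad,p;p)_k}p^k,$$ $$p_n^{(\alpha,\beta)}(x;s,t\mid p)=p_n(x;p^{1/2}t/s,\;p^{1/2+\alpha}s/t,\;-p^{1/2}/(st),\;-st\,p^{1/2+\beta}\mid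 p).$$ **Theorem.** Let $\sigma,\tau\in\mathbb R$, let $i,j\in\frac12\mathbb Z$ with $i-j\in\mathbb Z$, let $m=\max(|i|,|j|)$ and let $l$ satisfy $l-m\in\mathbb Z_{\ge0}$. Then there is exactly one element $a^l_{i,j}(\tau,\sigma)\in\mathcal A$ as above, and, with $$d^l_{i,j}(\tau,\sigma)=\frac{C^{l,j}(\sigma)C^{l,i}(\tau)}{C^{i,j}(\sigma)C^{i,i}(\tau)}\,\frac{q^{i-l}}{(q^{4l};q^{-2})_{l-i}},$$ the following hold. (i) If $m=i$: $\;b^l_{i,j}(\tau,\sigma)=d^l_{i,j}(\tau,\sigma)\,b^i_{i,j}(\tau,\sigma)\,p^{(i-j,i+j)}_{l-i}(\rho_{\tau,\sigma};q^\tau,q^\sigma\mid q^2)$. (ii) If $m=j$: $\;b^l_{i,j}(\tau,\sigma)=d^l_{j,i}(\sigma,\tau)\,b^j_{i,j}(\tau,\sigma)\,p^{(j-i,i+j)}_{l-j}(\rho_{\tau,\sigma};q^\sigma,q^\tau\mid q^2)$. (iii) If $m=-i$: $\;b^l_{i,j}(\tau,\sigma)=d^l_{-i,-j}(-\tau,-\sigma)\,b^{-i}_{i,j}(\tau,\sigma)\,p^{(j-i,-i-j)}_{l+i}(\rho_{\tau,\sigma};q^{-\tau},q^{-\sigma}\mid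 q^2)$. (iv) If $m=-j$: $\;b^l_{i,j}(\tau,\sigma)=d^l_{-j,-i}(-\sigma,-\tau)\,b^{-j}_{i,j}(\tau,\sigma)\,p^{(i-j,-i-j)}_{l+j}(\rho_{\tau,\sigma};q^{-\sigma},q^{-\tau}\mid q^2)$. -/

import Mathlib

open scoped TensorProduct
open WithConv

noncomputable section

set_option linter.unusedSimpArgs false
set_option linter.unusedTactic false
set_option linter.unreachableTactic false

namespace QSU2

/-! ### The quantised universal enveloping algebra

Throughout, `q` is a real number with `0 < q < 1`. -/

/-- The parameter `q` as a complex number. -/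
def qc (q : Set.Ioo (0 : ℝ) 1) : ℂ := ((q : ℝ) : ℂ)

theorem q_ne (q : Set.Ioo (0 : ℝ) 1) : qc q ≠ 0 := by
  exact Complex.ofReal_ne_zero.mpr q.2.1.ne'

/-- The generators `A, B, C, D` of `U_q(su(2))`. -/
inductive UGen
  | A | B | C | D

/-- The generator `g` in the free algebra. -/
abbrev uι (g : UGen) : FreeAlgebra ℂ UGen := FreeAlgebra.ι ℂ g

/-- The defining relations of `U_q(su(2))`. -/
inductive URel (q : Set.Ioo (0 : ℝ) 1) : FreeAlgebra ℂ UGen → FreeAlgebra ℂ UGen → Prop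
  | AD : URel q (uι .A * uι .D) 1
  | DA : URel q (uι .D * uι .A) 1
  | AB : URel q (uι .A * uι .B) (qc q • (uι .B * uι .A))
  | AC : URel q (uι .A * uι .C) ((qc q)⁻¹ • (uι .C * uι .A))
  | BC : URel q (uι .B * uι .C - uι .C * uι .B)
      ((qc q - (qc q)⁻¹)⁻¹ • (uι .A * uι .A - uι .D * uι .D))

/-- The quantised universal enveloping algebra `U_q(su(2))`. -/
abbrev Uq (q : Set.Ioo (0 : ℝ) 1) : Type := RingQuot (URel q)

/-- The generators in `U_q(su(2))`. -/
def ug (q : Set.Ioo (0 : ℝ) 1) (g : UGen) : Uq q := RingQuot.mkAlgHom ℂ (URel q) (uι g)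


section Relations
variable (q : Set.Ioo (0 : ℝ) 1)

theorem u_AD : ug q .A * ug q .D = 1 := by
  simpa [ug] using RingQuot.mkAlgHom_rel ℂ (URel.AD (q := q))

theorem u_DA : ug q .D * ug q .A = 1 := by
  simpa [ug] using RingQuot.mkAlgHom_rel ℂ (URel.DA (q := q))

theorem u_AB : ug q .A * ug q .B = qc q • (ug q .B * ug q .A) := by
  simpa [ug] using RingQuot.mkAlgHom_rel ℂ (URel.AB (q := q))

theorem u_AC : ug q .A * ug q .C = (qc q)⁻¹ • (ug q .C * ug q .A) := by
  simpa [ug] using RingQuot.mkAlgHom_rel ℂ (URel.AC (q := q))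

theorem u_BC : ug q .B * ug q .C - ug q .C * ug q .B =
    (qc q - (qc q)⁻¹)⁻¹ • (ug q .A * ug q .A - ug q .D * ug q .D) := by
  simpa [ug] using RingQuot.mkAlgHom_rel ℂ (URel.BC (q := q))

theorem u_BD : ug q .B * ug q .D = qc q • (ug q .D * ug q .B) := by
  calc ug q .B * ug q .D = ug q .D * (ug q .A * ug q .B) * ug q .D := by
        rw [← mul_assoc, u_DA, one_mul]
    _ = qc q • (ug q .D * ug q .B * (ug q .A * ug q .D)) := by
        rw [u_AB]; simp only [mul_smul_comm, smul_mul_assoc, mul_assoc]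
    _ = _ := by rw [u_AD, mul_one]

theorem u_CD : ug q .C * ug q .D = (qc q)⁻¹ • (ug q .D * ug q .C) := by
  calc ug q .C * ug q .D = ug q .D * (ug q .A * ug q .C) * ug q .D := by
        rw [← mul_assoc, u_DA, one_mul]
    _ = (qc q)⁻¹ • (ug q .D * ug q .C * (ug q .A * ug q .D)) := by
        rw [u_AC]; simp only [mul_smul_comm, smul_mul_assoc, mul_assoc]
    _ = _ := by rw [u_AD, mul_one]

end Relations

/-- Universal property of `U_q(su(2))`. -/
def uLift (q : Set.Ioo (0 : ℝ) 1) {R : Type*} [Ring R] [Algebra ℂ R] (f : UGen → R)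
    (hAD : f .A * f .D = 1) (hDA : f .D * f .A = 1)
    (hAB : f .A * f .B = qc q • (f .B * f .A))
    (hAC : f .A * f .C = (qc q)⁻¹ • (f .C * f .A))
    (hBC : f .B * f .C - f .C * f .B =
      (qc q - (qc q)⁻¹)⁻¹ • (f .A * f .A - f .D * f .D)) :
    Uq q →ₐ[ℂ] R :=
  RingQuot.liftAlgHom ℂ ⟨FreeAlgebra.lift ℂ f, by
    intro x y h
    cases h <;> simpa using by assumption⟩

@[simp] theorem uLift_ug (q : Set.Ioo (0 : ℝ) 1) {R : Type*} [Ring R] [Algebra ℂ R] (f : UGen → R)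
    (h₁ h₂ h₃ h₄ h₅) (g : UGen) : uLift q f h₁ h₂ h₃ h₄ h₅ (ug q g) = f g := by
  simp [uLift, ug]

theorem uHom_ext {q : Set.Ioo (0 : ℝ) 1} {R : Type*} [Semiring R] [Algebra ℂ R]
    {f g : Uq q →ₐ[ℂ] R} (h : ∀ a, f (ug q a) = g (ug q a)) : f = g := by
  apply RingQuot.ringQuot_ext'
  apply FreeAlgebra.hom_ext
  funext a
  exact h a

/-- Comultiplication on the generators: `ΔA = A ⊗ A`, `ΔB = A ⊗ B + B ⊗ D`,
`ΔC = A ⊗ C + C ⊗ D`, `ΔD = D ⊗ D`. -/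
def uComulGen (q : Set.Ioo (0 : ℝ) 1) : UGen → Uq q ⊗[ℂ] Uq q
  | .A => ug q .A ⊗ₜ ug q .A
  | .B => ug q .A ⊗ₜ ug q .B + ug q .B ⊗ₜ ug q .D
  | .C => ug q .A ⊗ₜ ug q .C + ug q .C ⊗ₜ ug q .D
  | .D => ug q .D ⊗ₜ ug q .D

/-- The comultiplication of `U_q(su(2))`. -/
def uComul (q : Set.Ioo (0 : ℝ) 1) : Uq q →ₐ[ℂ] Uq q ⊗[ℂ] Uq q :=
  uLift q (uComulGen q)
    (by simp [uComulGen, u_AD, Algebra.TensorProduct.one_def])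
    (by simp [uComulGen, u_DA, Algebra.TensorProduct.one_def])
    (by simp [uComulGen, mul_add, add_mul, u_AB, u_AD, u_DA, ← TensorProduct.smul_tmul'])
    (by simp [uComulGen, mul_add, add_mul, u_AC, u_AD, u_DA, ← TensorProduct.smul_tmul'])
    (by
      have hq := q_ne q
      have hB : ug q .B * ug q .C = ug q .C * ug q .B +
          (qc q - (qc q)⁻¹)⁻¹ • (ug q .A * ug q .A - ug q .D * ug q .D) := by
        rw [← u_BC]; abel
      simp only [uComulGen, mul_add, add_mul, Algebra.TensorProduct.tmul_mul_tmul, hB, u_AB, u_AC,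
        u_BD, u_CD, TensorProduct.tmul_add, TensorProduct.add_tmul, TensorProduct.tmul_smul,
        TensorProduct.smul_tmul', TensorProduct.tmul_sub, TensorProduct.sub_tmul, smul_smul,
        mul_inv_cancel₀ hq, inv_mul_cancel₀ hq, one_smul, smul_sub]
      abel)

/-- The counit of `U_q(su(2))`. -/
def uCounit (q : Set.Ioo (0 : ℝ) 1) : Uq q →ₐ[ℂ] ℂ :=
  uLift q (fun g => match g with | .A => 1 | .B => 0 | .C => 0 | .D => 1)
    (by simp) (by simp) (by simp) (by simp) (by simp)

/-- The bialgebra structure of `U_q(su(2))`. -/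
instance (q : Set.Ioo (0 : ℝ) 1) : Bialgebra ℂ (Uq q) :=
  Bialgebra.ofAlgHom (uComul q) (uCounit q)
    (by
      apply uHom_ext
      intro a
      cases a <;> simp [uComul, uComulGen, TensorProduct.add_tmul, TensorProduct.tmul_add,
        add_assoc])
    (by
      apply uHom_ext
      intro a
      cases a <;> simp [uComul, uComulGen, uCounit])
    (by
      apply uHom_ext
      intro a
      cases a <;> simp [uComul, uComulGen, uCounit])


/-! ### The quantised function algebra -/

/-- The generators `α, β, γ, δ` of `A_q(SU(2))`. -/
inductive AGen
  | α | β | γ | δ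

/-- The generator `g` in the free algebra. -/
abbrev aι (g : AGen) : FreeAlgebra ℂ AGen := FreeAlgebra.ι ℂ g

/-- The defining relations of `A_q(SU(2))`. -/
inductive ARel (q : Set.Ioo (0 : ℝ) 1) : FreeAlgebra ℂ AGen → FreeAlgebra ℂ AGen → Prop
  | αβ : ARel q (aι .α * aι .β) (qc q • (aι .β * aι .α))
  | αγ : ARel q (aι .α * aι .γ) (qc q • (aι .γ * aι .α))
  | βδ : ARel q (aι .β * aι .δ) (qc q • (aι .δ * aι .β))
  | γδ : ARel q (aι .γ * aι .δ) (qc q • (aι .δ * aι .γ))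
  | βγ : ARel q (aι .β * aι .γ) (aι .γ * aι .β)
  | αδ : ARel q (aι .α * aι .δ - qc q • (aι .β * aι .γ)) 1
  | δα : ARel q (aι .δ * aι .α - (qc q)⁻¹ • (aι .β * aι .γ)) 1

/-- The quantised algebra of polynomials `A_q(SU(2))`. -/
abbrev Aq (q : Set.Ioo (0 : ℝ) 1) : Type := RingQuot (ARel q)

/-- The generators in `A_q(SU(2))`. -/
def ag (q : Set.Ioo (0 : ℝ) 1) (g : AGen) : Aq q := RingQuot.mkAlgHom ℂ (ARel q) (aι g)

section Relations
variable (q : Set.Ioo (0 : ℝ) 1)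

theorem a_αβ : ag q .α * ag q .β = qc q • (ag q .β * ag q .α) := by
  simpa [ag] using RingQuot.mkAlgHom_rel ℂ (ARel.αβ (q := q))

theorem a_αγ : ag q .α * ag q .γ = qc q • (ag q .γ * ag q .α) := by
  simpa [ag] using RingQuot.mkAlgHom_rel ℂ (ARel.αγ (q := q))

theorem a_βδ : ag q .β * ag q .δ = qc q • (ag q .δ * ag q .β) := by
  simpa [ag] using RingQuot.mkAlgHom_rel ℂ (ARel.βδ (q := q))

theorem a_γδ : ag q .γ * ag q .δ = qc q • (ag q .δ * ag q .γ) := by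
  simpa [ag] using RingQuot.mkAlgHom_rel ℂ (ARel.γδ (q := q))

theorem a_βγ : ag q .β * ag q .γ = ag q .γ * ag q .β := by
  simpa [ag] using RingQuot.mkAlgHom_rel ℂ (ARel.βγ (q := q))

theorem a_αδ : ag q .α * ag q .δ = 1 + qc q • (ag q .γ * ag q .β) := by
  have h : ag q .α * ag q .δ - qc q • (ag q .β * ag q .γ) = 1 := by
    simpa [ag] using RingQuot.mkAlgHom_rel ℂ (ARel.αδ (q := q))
  rw [← a_βγ, ← h]; abel

theorem a_δα : ag q .δ * ag q .α = 1 + (qc q)⁻¹ • (ag q .γ * ag q .β) := by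
  have h : ag q .δ * ag q .α - (qc q)⁻¹ • (ag q .β * ag q .γ) = 1 := by
    simpa [ag] using RingQuot.mkAlgHom_rel ℂ (ARel.δα (q := q))
  rw [← a_βγ, ← h]; abel

end Relations

/-- Universal property of `A_q(SU(2))`. -/
def aLift (q : Set.Ioo (0 : ℝ) 1) {R : Type*} [Ring R] [Algebra ℂ R] (f : AGen → R)
    (h₁ : f .α * f .β = qc q • (f .β * f .α))
    (h₂ : f .α * f .γ = qc q • (f .γ * f .α))
    (h₃ : f .β * f .δ = qc q • (f .δ * f .β))
    (h₄ : f .γ * f .δ = qc q • (f .δ * f .γ))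
    (h₅ : f .β * f .γ = f .γ * f .β)
    (h₆ : f .α * f .δ - qc q • (f .β * f .γ) = 1)
    (h₇ : f .δ * f .α - (qc q)⁻¹ • (f .β * f .γ) = 1) :
    Aq q →ₐ[ℂ] R :=
  RingQuot.liftAlgHom ℂ ⟨FreeAlgebra.lift ℂ f, by
    intro x y h
    cases h <;> simpa using by assumption⟩

@[simp] theorem aLift_ag (q : Set.Ioo (0 : ℝ) 1) {R : Type*} [Ring R] [Algebra ℂ R] (f : AGen → R)
    (h₁ h₂ h₃ h₄ h₅ h₆ h₇) (g : AGen) : aLift q f h₁ h₂ h₃ h₄ h₅ h₆ h₇ (ag q g) = f g := by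
  simp [aLift, ag]

/-- Comultiplication on the generators: `Δα = α ⊗ α + β ⊗ γ`, `Δβ = α ⊗ β + β ⊗ δ`,
`Δγ = γ ⊗ α + δ ⊗ γ`, `Δδ = γ ⊗ β + δ ⊗ δ`. -/
def aComulGen (q : Set.Ioo (0 : ℝ) 1) : AGen → Aq q ⊗[ℂ] Aq q
  | .α => ag q .α ⊗ₜ ag q .α + ag q .β ⊗ₜ ag q .γ
  | .β => ag q .α ⊗ₜ ag q .β + ag q .β ⊗ₜ ag q .δ
  | .γ => ag q .γ ⊗ₜ ag q .α + ag q .δ ⊗ₜ ag q .γ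
  | .δ => ag q .γ ⊗ₜ ag q .β + ag q .δ ⊗ₜ ag q .δ

/-- The comultiplication of `A_q(SU(2))`. -/
def aComul (q : Set.Ioo (0 : ℝ) 1) : Aq q →ₐ[ℂ] Aq q ⊗[ℂ] Aq q := by
  refine aLift q (aComulGen q) ?_ ?_ ?_ ?_ ?_ ?_ ?_ <;>
  · simp only [aComulGen, mul_add, add_mul, Algebra.TensorProduct.tmul_mul_tmul, a_αβ, a_αγ,
      a_βδ, a_γδ, a_βγ, a_αδ, a_δα, TensorProduct.tmul_add, TensorProduct.add_tmul,
      TensorProduct.tmul_smul, ← TensorProduct.smul_tmul', smul_add, smul_smul,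
      Algebra.TensorProduct.one_def]
    have hq := q_ne q
    match_scalars <;> field_simp <;> ring

/-! ### The duality -/

/-- The real power `q ^ x` as a complex number. -/
def qpow (q : Set.Ioo (0 : ℝ) 1) (x : ℝ) : ℂ := (((q : ℝ) ^ x : ℝ) : ℂ)

theorem qpow_add (q : Set.Ioo (0 : ℝ) 1) (x y : ℝ) : qpow q (x + y) = qpow q x * qpow q y := by
  simp [qpow, Real.rpow_add q.2.1]

theorem qpow_zero (q : Set.Ioo (0 : ℝ) 1) : qpow q 0 = 1 := by simp [qpow]

theorem qpow_one (q : Set.Ioo (0 : ℝ) 1) : qpow q 1 = qc q := by simp [qpow, qc]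

theorem qpow_neg_one (q : Set.Ioo (0 : ℝ) 1) : qpow q (-1) = (qc q)⁻¹ := by
  simp [qpow, qc, Real.rpow_neg_one]

theorem qc_sub_inv_ne (q : Set.Ioo (0 : ℝ) 1) : qc q - (qc q)⁻¹ ≠ 0 := by
  have h0 := q.2.1
  have h1 := q.2.2
  have : (q : ℝ) - (q : ℝ)⁻¹ ≠ 0 := by
    have : 1 < (q : ℝ)⁻¹ := (one_lt_inv₀ h0).2 h1
    linarith
  unfold qc
  exact_mod_cast this

/-- The matrices `⟨X, (α β; γ δ)⟩` for the generators `X` of `U_q(su(2))`. -/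
def fundGen (q : Set.Ioo (0 : ℝ) 1) : UGen → Matrix (Fin 2) (Fin 2) ℂ
  | .A => !![qpow q (1 / 2), 0; 0, qpow q (-(1 / 2))]
  | .B => !![0, 1; 0, 0]
  | .C => !![0, 0; 1, 0]
  | .D => !![qpow q (-(1 / 2)), 0; 0, qpow q (1 / 2)]

theorem qpow_half_mul (q : Set.Ioo (0 : ℝ) 1) : qpow q (1 / 2) * qpow q (1 / 2) = qc q := by
  rw [← qpow_add, ← qpow_one]; norm_num

theorem qpow_half_mul_neg (q : Set.Ioo (0 : ℝ) 1) :
    qpow q (1 / 2) * qpow q (-(1 / 2)) = 1 := by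
  rw [← qpow_add, ← qpow_zero q]; norm_num

theorem qpow_neg_half_mul (q : Set.Ioo (0 : ℝ) 1) :
    qpow q (-(1 / 2)) * qpow q (-(1 / 2)) = (qc q)⁻¹ := by
  rw [← qpow_add, ← qpow_neg_one]; norm_num

/-- The two-dimensional representation `X ↦ ⟨X, (α β; γ δ)⟩` of `U_q(su(2))`. -/
def fund (q : Set.Ioo (0 : ℝ) 1) : Uq q →ₐ[ℂ] Matrix (Fin 2) (Fin 2) ℂ := by
  have h1 := qpow_half_mul q
  have h2 := qpow_half_mul_neg q
  have h3 := qpow_neg_half_mul q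
  have h4 := qc_sub_inv_ne q
  have h5 : qc q * qpow q (-(1 / 2)) = qpow q (1 / 2) := by rw [← h1, mul_assoc, h2, mul_one]
  have h6 : (qc q)⁻¹ * qpow q (1 / 2) = qpow q (-(1 / 2)) := by
    rw [← h3, mul_assoc, mul_comm _ (qpow q (1 / 2)), h2, mul_one]
  have h7 : (qc q - (qc q)⁻¹)⁻¹ * ((qc q)⁻¹ - qc q) = -1 := by
    rw [← neg_sub (qc q) (qc q)⁻¹, mul_neg, inv_mul_cancel₀ h4]
  refine uLift q (fundGen q) ?_ ?_ ?_ ?_ ?_ <;> simp only [fundGen] <;>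
    generalize qpow q (1 / 2) = s at * <;> generalize qpow q (-(1 / 2)) = s' at * <;>
    ext i j <;> fin_cases i <;> fin_cases j <;>
    simp [h1, h2, h3, h4, h5, h6, h7, mul_comm s' s]

/-- Induction on `U_q(su(2))`. -/
theorem uInduction {q : Set.Ioo (0 : ℝ) 1} {p : Uq q → Prop}
    (hc : ∀ r : ℂ, p (algebraMap ℂ (Uq q) r)) (hg : ∀ g, p (ug q g))
    (hm : ∀ x y, p x → p y → p (x * y)) (ha : ∀ x y, p x → p y → p (x + y)) (X : Uq q) : p X := by
  obtain ⟨x, rfl⟩ := RingQuot.mkAlgHom_surjective ℂ (URel q) X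
  induction x using FreeAlgebra.induction with
  | grade0 r => simpa using hc r
  | grade1 g => exact hg g
  | mul a b ha' hb' => simpa using hm _ _ ha' hb'
  | add a b ha' hb' => simpa using ha _ _ ha' hb'

/-- The functional `X ↦ ⟨X, g⟩` on `U_q(su(2))` for a matrix entry `g` of `(α β; γ δ)`. -/
def entry (q : Set.Ioo (0 : ℝ) 1) (i j : Fin 2) : WithConv (Uq q →ₗ[ℂ] ℂ) :=
  toConv (Matrix.entryLinearMap ℂ ℂ i j ∘ₗ (fund q).toLinearMap)

/-- The tensor square of the two-dimensional representation. -/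
def fundSq (q : Set.Ioo (0 : ℝ) 1) :
    Uq q →ₐ[ℂ] Matrix (Fin 2) (Fin 2) ℂ ⊗[ℂ] Matrix (Fin 2) (Fin 2) ℂ :=
  (Algebra.TensorProduct.map (fund q) (fund q)).comp (uComul q)

/-- Pairs of matrix entries on the tensor square. -/
def entry₂ (i j k l : Fin 2) : Matrix (Fin 2) (Fin 2) ℂ ⊗[ℂ] Matrix (Fin 2) (Fin 2) ℂ →ₗ[ℂ] ℂ :=
  LinearMap.mul' ℂ ℂ ∘ₗ
    TensorProduct.map (Matrix.entryLinearMap ℂ ℂ i j) (Matrix.entryLinearMap ℂ ℂ k l)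

theorem entry_mul (q : Set.Ioo (0 : ℝ) 1) (i j k l : Fin 2) (X : Uq q) :
    (entry q i j * entry q k l) X = entry₂ i j k l (fundSq q X) := by
  change _ = entry₂ i j k l ((Algebra.TensorProduct.map (fund q) (fund q)) (uComul q X))
  change LinearMap.mul' ℂ ℂ (TensorProduct.map (entry q i j).ofConv (entry q k l).ofConv
    (uComul q X)) = _
  generalize uComul q X = z
  induction z with
  | zero => simp
  | tmul a b => simp [entry, entry₂]
  | add a b ha hb => simp only [map_add, ha, hb]

theorem entry₂_mul (i j k l : Fin 2)
    (x y : Matrix (Fin 2) (Fin 2) ℂ ⊗[ℂ] Matrix (Fin 2) (Fin 2) ℂ) :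
    entry₂ i j k l (x * y) = ∑ a : Fin 2, ∑ b : Fin 2, entry₂ i a k b x * entry₂ a j b l y := by
  induction x with
  | zero => simp
  | add x x' hx hx' => simp only [add_mul, map_add, hx, hx', Finset.sum_add_distrib]
  | tmul m n =>
    induction y with
    | zero => simp
    | add y y' hy hy' => simp only [mul_add, map_add, hy, hy', Finset.sum_add_distrib]
    | tmul m' n' =>
      simp [entry₂, Matrix.mul_apply, Fin.sum_univ_two]
      ring

theorem fundSq_ug (q : Set.Ioo (0 : ℝ) 1) (g : UGen) :
    fundSq q (ug q g) = match g with
      | .A => fundGen q .A ⊗ₜ fundGen q .A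
      | .B => fundGen q .A ⊗ₜ fundGen q .B + fundGen q .B ⊗ₜ fundGen q .D
      | .C => fundGen q .A ⊗ₜ fundGen q .C + fundGen q .C ⊗ₜ fundGen q .D
      | .D => fundGen q .D ⊗ₜ fundGen q .D := by
  cases g <;> simp [fundSq, uComul, uComulGen, fund]

theorem counit_eq (q : Set.Ioo (0 : ℝ) 1) (X : Uq q) :
    Coalgebra.counit (R := ℂ) X = uCounit q X := rfl

/-- Invariance of the `q`-antisymmetric vector. -/
theorem fundSq_col (q : Set.Ioo (0 : ℝ) 1) (X : Uq q) (i k : Fin 2) :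
    entry₂ i 0 k 1 (fundSq q X) - qc q * entry₂ i 1 k 0 (fundSq q X) =
      uCounit q X * (!![0, 1; -qc q, 0] : Matrix (Fin 2) (Fin 2) ℂ) i k := by
  induction X using uInduction generalizing i k with
  | hc r =>
    rw [AlgHom.commutes, AlgHom.commutes, Algebra.algebraMap_eq_smul_one, map_smul, map_smul,
      Algebra.TensorProduct.one_def]
    fin_cases i <;> fin_cases k <;> simp [entry₂, mul_comm r]
  | hg g =>
    have h1 := qpow_half_mul q
    have h2 := qpow_half_mul_neg q
    have h3 := qpow_neg_half_mul q
    have h5 : qc q * qpow q (-(1 / 2)) = qpow q (1 / 2) := by rw [← h1, mul_assoc, h2, mul_one]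
    rw [fundSq_ug]
    cases g <;> simp only [fundGen, uCounit, uLift_ug] <;>
      generalize qpow q (1 / 2) = s at * <;> generalize qpow q (-(1 / 2)) = s' at * <;>
      fin_cases i <;> fin_cases k <;>
      simp [entry₂, h2, h5, mul_comm s' s]
  | hm x y hx hy =>
    have h00 := hy 0 0
    have h01 := hy 0 1
    have h10 := hy 1 0
    have h11 := hy 1 1
    have hx' := hx i k
    simp only [map_mul, entry₂_mul, Fin.sum_univ_two]
    simp at h00 h01 h10 h11
    linear_combination (entry₂ i 0 k 0 (fundSq q x)) * h00 + (entry₂ i 0 k 1 (fundSq q x)) * h01 +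
      (entry₂ i 1 k 0 (fundSq q x)) * h10 + (entry₂ i 1 k 1 (fundSq q x)) * h11 +
      uCounit q y * hx'
  | ha x y hx hy =>
    have hx' := hx i k
    have hy' := hy i k
    simp only [map_add]
    linear_combination hx' + hy'

/-- Invariance of the `q`-antisymmetric covector. -/
theorem fundSq_row (q : Set.Ioo (0 : ℝ) 1) (X : Uq q) (j l : Fin 2) :
    entry₂ 0 j 1 l (fundSq q X) - qc q * entry₂ 1 j 0 l (fundSq q X) =
      uCounit q X * (!![0, 1; -qc q, 0] : Matrix (Fin 2) (Fin 2) ℂ) j l := by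
  induction X using uInduction generalizing j l with
  | hc r =>
    rw [AlgHom.commutes, AlgHom.commutes, Algebra.algebraMap_eq_smul_one, map_smul, map_smul,
      Algebra.TensorProduct.one_def]
    fin_cases j <;> fin_cases l <;> simp [entry₂, mul_comm r]
  | hg g =>
    have h1 := qpow_half_mul q
    have h2 := qpow_half_mul_neg q
    have h3 := qpow_neg_half_mul q
    have h5 : qc q * qpow q (-(1 / 2)) = qpow q (1 / 2) := by rw [← h1, mul_assoc, h2, mul_one]
    rw [fundSq_ug]
    cases g <;> simp only [fundGen, uCounit, uLift_ug] <;>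
      generalize qpow q (1 / 2) = s at * <;> generalize qpow q (-(1 / 2)) = s' at * <;>
      fin_cases j <;> fin_cases l <;>
      simp [entry₂, h2, h5, mul_comm s' s]
  | hm x y hx hy =>
    have h00 := hx 0 0
    have h01 := hx 0 1
    have h10 := hx 1 0
    have h11 := hx 1 1
    have hy' := hy j l
    simp only [map_mul, entry₂_mul, Fin.sum_univ_two]
    simp at h00 h01 h10 h11
    linear_combination (entry₂ 0 j 0 l (fundSq q y)) * h00 + (entry₂ 0 j 1 l (fundSq q y)) * h01 +
      (entry₂ 1 j 0 l (fundSq q y)) * h10 + (entry₂ 1 j 1 l (fundSq q y)) * h11 +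
      uCounit q x * hy'
  | ha x y hx hy =>
    have hx' := hx j l
    have hy' := hy j l
    simp only [map_add]
    linear_combination hx' + hy'

/-- The functional on `U_q(su(2))` given by pairing with a generator of `A_q(SU(2))`. -/
def entryGen (q : Set.Ioo (0 : ℝ) 1) : AGen → WithConv (Uq q →ₗ[ℂ] ℂ)
  | .α => entry q 0 0
  | .β => entry q 0 1
  | .γ => entry q 1 0
  | .δ => entry q 1 1

/-- The pairing `⟨X, ξ⟩` of `X ∈ U_q(su(2))` and `ξ ∈ A_q(SU(2))`, as the algebra homomorphism
`ξ ↦ ⟨·, ξ⟩` into the convolution algebra dual to the coalgebra `U_q(su(2))`, so that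
`⟨X, ξη⟩ = ⟨Δ(X), ξ ⊗ η⟩` and `⟨X, 1⟩ = ε(X)`. -/
def pairing (q : Set.Ioo (0 : ℝ) 1) : Aq q →ₐ[ℂ] WithConv (Uq q →ₗ[ℂ] ℂ) := by
  refine aLift q (entryGen q) ?_ ?_ ?_ ?_ ?_ ?_ ?_ <;>
  · have hq := q_ne q
    ext X
    have c00 := fundSq_col q X 0 0
    have c01 := fundSq_col q X 0 1
    have c10 := fundSq_col q X 1 0
    have c11 := fundSq_col q X 1 1
    have r00 := fundSq_row q X 0 0
    have r01 := fundSq_row q X 0 1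
    have r10 := fundSq_row q X 1 0
    have r11 := fundSq_row q X 1 1
    simp only [← entry_mul] at c00 c01 c10 c11 r00 r01 r10 r11
    simp [-LinearMap.convMul_apply] at c00 c01 c10 c11 r00 r01 r10 r11
    simp only [entryGen, WithConv.ofConv_sub, WithConv.ofConv_smul, LinearMap.sub_apply,
      LinearMap.smul_apply, smul_eq_mul, LinearMap.convOne_apply, counit_eq, Algebra.algebraMap_self,
      RingHom.id_apply]
    first
    | linear_combination c00
    | linear_combination r00
    | linear_combination r11
    | linear_combination c11
    | linear_combination c01
    | (apply mul_left_cancel₀ hq; linear_combination r01 - c01)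
    | (apply mul_left_cancel₀ hq; rw [mul_sub, mul_inv_cancel_left₀ hq]; linear_combination -r10)

/-- The pairing `⟨X, ξ⟩` for fixed `X`, as a linear functional of `ξ`. -/
def pairL (q : Set.Ioo (0 : ℝ) 1) (X : Uq q) : Aq q →ₗ[ℂ] ℂ where
  toFun ξ := pairing q ξ X
  map_add' ξ η := by simp
  map_smul' c ξ := by simp

/-- The left action `X.ξ = (id ⊗ ⟨X, ·⟩)(Δ ξ)` of `U_q(su(2))` on `A_q(SU(2))`. -/
def leftAct (q : Set.Ioo (0 : ℝ) 1) (X : Uq q) (ξ : Aq q) : Aq q :=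
  TensorProduct.rid ℂ (Aq q) (LinearMap.lTensor (Aq q) (pairL q X) (aComul q ξ))

/-! ### The irreducible representations

Half-integers are represented by their doubles: `L = 2l`, `I = 2i`, `J = 2j`. The orthonormal basis
`e^l_n`, `n = -l, …, l`, of the representation space of `t^l` is indexed by `k = l - n`,
`k = 0, …, 2l`. -/

/-- With `k = l - n` this is
`√((q^{-l+n} - q^{l-n}) (q^{-l-n-1} - q^{l+n+1})) / (q⁻¹ - q)`. -/
def ladder (q : Set.Ioo (0 : ℝ) 1) (L k : ℕ) : ℝ :=
  √(((q : ℝ) ^ (-(k : ℤ)) - (q : ℝ) ^ (k : ℤ)) *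
    ((q : ℝ) ^ (-((L : ℤ) + 1 - k)) - (q : ℝ) ^ ((L : ℤ) + 1 - k))) / ((q : ℝ)⁻¹ - q)

/-- The matrices of the generators: `A e_n = q^{-n} e_n`, `D e_n = q^n e_n`,
`B e_n ∈ ℂ e_{n-1}`, `C e_n ∈ ℂ e_{n+1}`. -/
def repGen (q : Set.Ioo (0 : ℝ) 1) (L : ℕ) : UGen → Matrix (Fin (L + 1)) (Fin (L + 1)) ℂ
  | .A => Matrix.diagonal fun k => qpow q (-((L : ℝ) / 2 - (k : ℕ)))
  | .B => Matrix.of fun a b => if (a : ℕ) = b + 1 then (ladder q L (b + 1) : ℂ) else 0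
  | .C => Matrix.of fun a b => if (b : ℕ) = a + 1 then (ladder q L b : ℂ) else 0
  | .D => Matrix.diagonal fun k => qpow q ((L : ℝ) / 2 - (k : ℕ))

theorem rep_BC (q : Set.Ioo (0 : ℝ) 1) (L : ℕ) :
    repGen q L .B * repGen q L .C = Matrix.diagonal fun k : Fin (L + 1) => (ladder q L (k : ℕ) : ℂ) ^ 2 := by
  ext a b
  rw [Matrix.mul_apply, Matrix.diagonal_apply]
  simp only [repGen, Matrix.of_apply]
  rcases Nat.eq_zero_or_pos (a : ℕ) with h | h
  · have : ladder q L a = 0 := by simp [ladder, h]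
    rw [Finset.sum_eq_zero]
    · simp [this]
    · intro c _
      rw [if_neg (by omega), zero_mul]
  · have hc : (a : ℕ) - 1 < L + 1 := by omega
    rw [Finset.sum_eq_single ⟨(a : ℕ) - 1, hc⟩]
    · by_cases hab : a = b
      · subst hab
        have h1 : (a : ℕ) - 1 + 1 = a := by omega
        simp [h1, sq]
      · have : ¬ (b : ℕ) = (a : ℕ) - 1 + 1 := by
          intro hb; apply hab; apply Fin.ext; omega
        simp [hab, this]
    · intro c _ hne
      rw [if_neg, zero_mul]
      intro hac; apply hne; apply Fin.ext; simp; omega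
    · simp

theorem rep_CB (q : Set.Ioo (0 : ℝ) 1) (L : ℕ) :
    repGen q L .C * repGen q L .B =
      Matrix.diagonal fun k : Fin (L + 1) => (ladder q L ((k : ℕ) + 1) : ℂ) ^ 2 := by
  ext a b
  rw [Matrix.mul_apply, Matrix.diagonal_apply]
  simp only [repGen, Matrix.of_apply]
  by_cases h : (a : ℕ) + 1 < L + 1
  · rw [Finset.sum_eq_single ⟨(a : ℕ) + 1, h⟩]
    · by_cases hab : a = b
      · subst hab
        simp [sq]
      · have : ¬ (a : ℕ) = b := by
          intro hb; apply hab; apply Fin.ext; omega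
        simp [hab, this]
    · intro c _ hne
      rw [if_neg, zero_mul]
      intro hac; apply hne; apply Fin.ext; simpa using hac
    · simp
  · have h1 : (a : ℕ) = L := by omega
    have : ladder q L ((a : ℕ) + 1) = 0 := by simp [ladder, h1]
    rw [Finset.sum_eq_zero]
    · simp [this]
    · intro c _
      rw [if_neg (by omega), zero_mul]

theorem ladder_sq (q : Set.Ioo (0 : ℝ) 1) (L k : ℕ) (hk : k ≤ L + 1) :
    (ladder q L k) ^ 2 = (((q : ℝ) ^ (-(k : ℤ)) - (q : ℝ) ^ (k : ℤ)) *
      ((q : ℝ) ^ (-((L : ℤ) + 1 - k)) - (q : ℝ) ^ ((L : ℤ) + 1 - k))) / ((q : ℝ)⁻¹ - q) ^ 2 := by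
  have h0 := q.2.1
  have h1 := q.2.2
  rw [ladder, div_pow, Real.sq_sqrt]
  have key : ∀ z : ℤ, 0 ≤ z → 0 ≤ (q : ℝ) ^ (-z) - (q : ℝ) ^ z := by
    intro z hz
    have : (q : ℝ) ^ z ≤ (q : ℝ) ^ (-z) := zpow_le_zpow_right_of_le_one₀ h0 h1.le (by omega)
    linarith
  exact mul_nonneg (key _ (by omega)) (key _ (by omega))

theorem ladder_rel (q : Set.Ioo (0 : ℝ) 1) (L k : ℕ) (hk : k ≤ L) :
    (ladder q L k) ^ 2 - (ladder q L (k + 1)) ^ 2 = ((q : ℝ) - (q : ℝ)⁻¹)⁻¹ *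
      ((q : ℝ) ^ (2 * (k : ℤ) - L) - (q : ℝ) ^ ((L : ℤ) - 2 * k)) := by
  have h0 : (q : ℝ) ≠ 0 := q.2.1.ne'
  have h1 : 1 < (q : ℝ)⁻¹ := (one_lt_inv₀ q.2.1).2 q.2.2
  have h2 := q.2.2
  have h3 : (q : ℝ)⁻¹ - q ≠ 0 := by linarith
  have h4 : (q : ℝ) - (q : ℝ)⁻¹ ≠ 0 := by linarith
  have h5 : 1 - (q : ℝ) ^ 2 ≠ 0 := by
    have := q.2.1
    nlinarith
  have h6 : (q : ℝ) ^ 2 - 1 ≠ 0 := by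
    intro h; apply h5; linarith
  rw [ladder_sq q L k (by omega), ladder_sq q L (k + 1) (by omega)]
  have e1 : (q : ℝ) ^ (-((L : ℤ) + 1 - (k : ℕ))) = (q : ℝ) ^ k / ((q : ℝ) ^ L * q) := by
    rw [show -((L : ℤ) + 1 - (k : ℕ)) = (k : ℤ) - ((L : ℤ) + 1) by ring, zpow_sub₀ h0,
      zpow_add₀ h0]; simp
  have e2 : (q : ℝ) ^ ((L : ℤ) + 1 - (k : ℕ)) = (q : ℝ) ^ L * q / (q : ℝ) ^ k := by
    rw [zpow_sub₀ h0, zpow_add₀ h0]; simp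
  have e3 : (q : ℝ) ^ (-((L : ℤ) + 1 - ((k + 1 : ℕ) : ℤ))) = (q : ℝ) ^ k / (q : ℝ) ^ L := by
    rw [show -((L : ℤ) + 1 - ((k + 1 : ℕ) : ℤ)) = (k : ℤ) - (L : ℤ) by push_cast; ring,
      zpow_sub₀ h0]; simp
  have e4 : (q : ℝ) ^ ((L : ℤ) + 1 - ((k + 1 : ℕ) : ℤ)) = (q : ℝ) ^ L / (q : ℝ) ^ k := by
    rw [show ((L : ℤ) + 1 - ((k + 1 : ℕ) : ℤ)) = (L : ℤ) - (k : ℤ) by push_cast; ring,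
      zpow_sub₀ h0]; simp
  have e5 : (q : ℝ) ^ (2 * (k : ℤ) - L) = ((q : ℝ) ^ k) ^ 2 / (q : ℝ) ^ L := by
    rw [zpow_sub₀ h0, mul_comm, zpow_mul]; simp
  have e6 : (q : ℝ) ^ ((L : ℤ) - 2 * k) = (q : ℝ) ^ L / ((q : ℝ) ^ k) ^ 2 := by
    rw [zpow_sub₀ h0, mul_comm, zpow_mul]; simp
  rw [e1, e2, e3, e4, e5, e6]
  simp only [zpow_neg, zpow_natCast, pow_succ (q : ℝ) k]
  have hx : (q : ℝ) ^ k ≠ 0 := pow_ne_zero _ h0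
  have hL : (q : ℝ) ^ L ≠ 0 := pow_ne_zero _ h0
  generalize (q : ℝ) ^ k = x at *
  generalize (q : ℝ) ^ L = y at *
  have h7 : (q : ℝ)⁻¹ - q = (1 - (q : ℝ) ^ 2) / q := by field_simp
  have h8 : (q : ℝ) - (q : ℝ)⁻¹ = -((1 - (q : ℝ) ^ 2) / q) := by field_simp; ring
  rw [h7, h8]
  field_simp
  ring

theorem qpow_int (q : Set.Ioo (0 : ℝ) 1) (z : ℤ) : qpow q z = (((q : ℝ) ^ z : ℝ) : ℂ) := by
  rw [qpow, Real.rpow_intCast]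

/-- The irreducible representation `t^l` of `U_q(su(2))` of dimension `L + 1 = 2l + 1`. -/
def rep (q : Set.Ioo (0 : ℝ) 1) (L : ℕ) : Uq q →ₐ[ℂ] Matrix (Fin (L + 1)) (Fin (L + 1)) ℂ := by
  refine uLift q (repGen q L) ?_ ?_ ?_ ?_ ?_
  · simp only [repGen, Matrix.diagonal_mul_diagonal, ← qpow_add]
    simp [qpow_zero]
  · simp only [repGen, Matrix.diagonal_mul_diagonal, ← qpow_add]
    simp [qpow_zero]
  · ext a b
    simp only [repGen, Matrix.diagonal_mul, Matrix.smul_apply, Matrix.mul_diagonal,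
      Matrix.of_apply, smul_eq_mul]
    split_ifs with h
    · rw [mul_left_comm, ← qpow_one q, ← qpow_add, mul_comm, h]
      congr 2; push_cast; ring
    · simp
  · ext a b
    simp only [repGen, Matrix.diagonal_mul, Matrix.smul_apply, Matrix.mul_diagonal,
      Matrix.of_apply, smul_eq_mul]
    split_ifs with h
    · rw [mul_left_comm, ← qpow_neg_one q, ← qpow_add, mul_comm, h]
      congr 2; push_cast; ring
    · simp
  · rw [rep_BC, rep_CB]
    simp only [repGen, Matrix.diagonal_mul_diagonal, Matrix.diagonal_sub, ← Matrix.diagonal_smul,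
      ← qpow_add]
    congr 1
    ext k
    have h1 : -((L : ℝ) / 2 - (k : ℕ)) + -((L : ℝ) / 2 - (k : ℕ)) =
      ((2 * ((k : ℕ) : ℤ) - L : ℤ) : ℝ) := by push_cast; ring
    have h2 : ((L : ℝ) / 2 - (k : ℕ)) + ((L : ℝ) / 2 - (k : ℕ)) =
      (((L : ℤ) - 2 * ((k : ℕ) : ℤ) : ℤ) : ℝ) := by push_cast; ring
    have h3 := ladder_rel q L k (by omega)
    simp only [Pi.smul_apply, smul_eq_mul, h1, h2, qpow_int, qc]
    exact_mod_cast congrArg (fun x : ℝ => (x : ℂ)) h3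

/-! ### Special functions -/

/-- The `q`-shifted factorial `(a; Q)_k`. -/
def qPoch (a Q : ℝ) (k : ℕ) : ℝ := ∏ r ∈ Finset.range k, (1 - a * Q ^ r)

/-- The `Q`-binomial coefficient `(Q^n; Q⁻¹)_k / (Q; Q)_k`. -/
def qBinom (n k : ℕ) (Q : ℝ) : ℝ := qPoch (Q ^ n) Q⁻¹ k / qPoch Q Q k

/-- The dual `q`-Krawtchouk polynomial `R_n(Q^{-x} - Q^{x-N} / c; c, N; Q)`, that is
`₃φ₂(Q^{-n}, Q^{-x}, -Q^{x-N} / c; Q^{-N}, 0; Q, Q)`, as a function of `x`. -/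
def dualQKrawtchouk (n x : ℕ) (c : ℝ) (N : ℕ) (Q : ℝ) : ℝ :=
  ∑ k ∈ Finset.range (n + 1),
    qPoch (Q ^ (-(n : ℤ))) Q k * qPoch (Q ^ (-(x : ℤ))) Q k *
      qPoch (-(Q ^ ((x : ℤ) - N)) / c) Q k /
      (qPoch (Q ^ (-(N : ℤ))) Q k * qPoch 0 Q k * qPoch Q Q k) * Q ^ k

/-- The Askey-Wilson polynomial `p_n(x; a, b, c, d | Q)`; with `x = cos θ`,
`(a e^{iθ}, a e^{-iθ}; Q)_k = ∏_{r < k} (1 - 2 a Q^r x + a² Q^{2r})`. -/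
def askeyWilson (n : ℕ) (a b c d Q : ℝ) : Polynomial ℝ :=
  Polynomial.C (a⁻¹ ^ n * (qPoch (a * b) Q n * qPoch (a * c) Q n * qPoch (a * d) Q n)) *
  ∑ k ∈ Finset.range (n + 1),
    Polynomial.C (qPoch (Q ^ (-(n : ℤ))) Q k * qPoch (a * b * c * d * Q ^ ((n : ℤ) - 1)) Q k /
      (qPoch (a * b) Q k * qPoch (a * c) Q k * qPoch (a * d) Q k * qPoch Q Q k) * Q ^ k) *
    ∏ r ∈ Finset.range k, (1 - Polynomial.C (2 * a * Q ^ r) * Polynomial.X +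
      Polynomial.C (a ^ 2 * Q ^ (2 * r)))

/-- `p_n^{(α,β)}(x; s, t | Q) =
p_n(x; Q^{1/2} t / s, Q^{1/2+α} s / t, -Q^{1/2} / (s t), -s t Q^{1/2+β} | Q)`. -/
def askeyWilsonJ (n : ℕ) (α β s t Q : ℝ) : Polynomial ℝ :=
  askeyWilson n (Q ^ (1 / 2 : ℝ) * t / s) (Q ^ (1 / 2 + α) * s / t) (-Q ^ (1 / 2 : ℝ) / (s * t))
    (-(s * t * Q ^ (1 / 2 + β))) Q

/-! ### Generalised matrix elements -/

/-- The constant `C^{l,j}(σ)`, where `L = 2l`, `J = 2j`. -/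
def normC (q : Set.Ioo (0 : ℝ) 1) (L : ℕ) (J : ℤ) (σ : ℝ) : ℝ :=
  (q : ℝ) ^ (((L : ℝ) + J) / 2) * √(qBinom L (((L : ℤ) - J) / 2).toNat ((q : ℝ) ^ 2)) *
    √((1 + (q : ℝ) ^ (-2 * (J : ℝ) - 2 * σ)) / (1 + (q : ℝ) ^ (-2 * σ))) *
    (√(qPoch (-(q : ℝ) ^ (2 - 2 * σ)) ((q : ℝ) ^ 2) (((L : ℤ) - J) / 2).toNat *
      qPoch (-(q : ℝ) ^ (2 + 2 * σ)) ((q : ℝ) ^ 2) (((L : ℤ) + J) / 2).toNat))⁻¹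

/-- The vector `v^{l,j}(σ)`, where `L = 2l`, `J = 2j`; the component at `k` is `v^{l,j}_n(σ)` with
`n = l - k`. -/
def vec (q : Set.Ioo (0 : ℝ) 1) (L : ℕ) (J : ℤ) (σ : ℝ) (k : Fin (L + 1)) : ℂ :=
  Complex.I ^ (-((k : ℕ) : ℤ)) *
    ((normC q L J σ * (q : ℝ) ^ (σ * (k : ℕ)) * (q : ℝ) ^ (((k : ℕ) : ℝ) * ((k : ℕ) - 1) / 2) *
      √(qPoch ((q : ℝ) ^ (2 * L)) ((q : ℝ) ^ 2)⁻¹ k / qPoch ((q : ℝ) ^ 2) ((q : ℝ) ^ 2) k) *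
      dualQKrawtchouk k (((L : ℤ) - J) / 2).toNat ((q : ℝ) ^ (2 * σ)) L ((q : ℝ) ^ 2) : ℝ) : ℂ)

/-- The element `a ∈ A_q(SU(2))` represents the functional
`X ↦ ⟨t^l(X) v^{l,j}(σ), v^{l,i}(τ)⟩` on `U_q(su(2))`, where `L = 2l`, `I = 2i`, `J = 2j`. -/
def IsGenMatElt (q : Set.Ioo (0 : ℝ) 1) (L : ℕ) (I J : ℤ) (τ σ : ℝ) (a : Aq q) : Prop :=
  ∀ X : Uq q, pairing q a X =
    star (vec q L I τ) ⬝ᵥ Matrix.mulVec (rep q L X) (vec q L J σ)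

/-- The generalised matrix element `a^l_{i,j}(τ, σ)`: the element of `A_q(SU(2))` which represents
`X ↦ ⟨t^l(X) v^{l,j}(σ), v^{l,i}(τ)⟩`. -/
def genMatElt (q : Set.Ioo (0 : ℝ) 1) (L : ℕ) (I J : ℤ) (τ σ : ℝ) : Aq q :=
  Classical.epsilon (IsGenMatElt q L I J τ σ)

/-- The deformed generalised matrix element `b^l_{i,j}(τ, σ) = A.a^l_{i,j}(τ, σ)`. -/
def defMatElt (q : Set.Ioo (0 : ℝ) 1) (L : ℕ) (I J : ℤ) (τ σ : ℝ) : Aq q :=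
  leftAct q (ug q .A) (genMatElt q L I J τ σ)

/-- The element `ρ_{τ,σ}` of `A_q(SU(2))`. -/
def rho (q : Set.Ioo (0 : ℝ) 1) (τ σ : ℝ) : Aq q :=
  (1 / 2 : ℂ) •
    (ag q .α ^ 2 + ag q .δ ^ 2 + qc q • ag q .γ ^ 2 + (qc q)⁻¹ • ag q .β ^ 2 +
      (Complex.I * (qpow q (-σ) - qpow q σ)) • (qc q • (ag q .δ * ag q .γ) + ag q .β * ag q .α) -
      (Complex.I * (qpow q (-τ) - qpow q τ)) • (ag q .δ * ag q .β + qc q • (ag q .γ * ag q .α)) +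
      ((qpow q (-σ) - qpow q σ) * (qpow q (-τ) - qpow q τ)) • (ag q .β * ag q .γ))

/-- The value at `ξ ∈ A_q(SU(2))` of a real polynomial. -/
def evalAt {q : Set.Ioo (0 : ℝ) 1} (p : Polynomial ℝ) (ξ : Aq q) : Aq q :=
  Polynomial.aeval ξ (p.map Complex.ofRealHom)

/-- The constant `d^l_{i,j}(τ, σ)`, where `L = 2l`, `I = 2i ≥ 0`, `J = 2j`. -/
def constD (q : Set.Ioo (0 : ℝ) 1) (L : ℕ) (I J : ℤ) (τ σ : ℝ) : ℝ :=
  (normC q L J σ * normC q L I τ) / (normC q I.toNat J σ * normC q I.toNat I τ) *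
    ((q : ℝ) ^ (((I : ℝ) - L) / 2) /
      qPoch ((q : ℝ) ^ (2 * L)) ((q : ℝ) ^ 2)⁻¹ (((L : ℤ) - I) / 2).toNat)

end QSU2

end

open QSU2

/-! The identity in `A` is reduced to an identity between functions on the torus, that is, between
the values at the powers `A^p`, and is then proved there by a uniqueness argument for a second-order
`q`-difference equation.

The elements `a` exist and are unique because the pairing separates points of `A`
(`pairing_injective`) and every matrix coefficient of `t^l` comes from `A`
(`exists_pairing_eq_rep`). The vectors `v^{l,j}(σ)` are built from dual `q`-Krawtchouk polynomials.
Their three-term recurrence says that they satisfy generalised eigenvalue equations for the twisted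
primitive elements `twPrim`, for which `Δ Y = A ⊗ Y + Y ⊗ D`. Hence `b^l_{i,j}(τ,σ)` is covariant on
both sides, with eigenvalues that depend on `i`, `j`, `τ`, `σ` but not on `l`
(`covariant_defMatElt`). The element `ρ_{τ,σ}` is covariant with eigenvalues zero, so multiplying
`b` on the right by a polynomial in `ρ_{τ,σ}` preserves its covariance type (`covariant_rho`,
`Covariant.mul`). A covariant element that vanishes on all `A^p` is zero (`Covariant.eq_zero`), so
it suffices to compare torus values (`defMatElt_eq_of_torusVal`).

On the torus `ρ_{τ,σ}` takes the value `(q^p + q^{-p})/2`. Since the Casimir element acts on `t^l`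
by a scalar, the torus values of `b^l` satisfy a second-order `q`-difference equation
(`torusVal_casimir`). For the extremal element with `i = l` there is also a first-order equation
(`torusVal_extremal`). Conjugating the Casimir equation by the extremal solution turns it into the
Askey-Wilson equation, so the extremal values times the Askey-Wilson polynomial solve the same
equation as `b^l` (`casimirEq_of_extremal_of_aw`).

After multiplication by a power of `q`, both solutions are polynomials in `z = q^p` of degree at
most `2l`. The exponents of the equation at `z = 0` are `0` and `2l + 1`, so such a solution is
fixed by its constant term (`casimirEq_unique`). Comparing constant terms produces exactly the
factor `d`. This proves the case `m = i` (`torusVal_top`). The other cases follow since torus values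
are unchanged by exchanging `(i, τ)` with `(j, σ)` and by reversing all signs. -/

noncomputable section
set_option linter.unusedSimpArgs false
set_option linter.unusedTactic false
set_option linter.unreachableTactic false

namespace QSU2

/-! ### Multiplication by generators in the dual -/

section Coaction
variable (q : Set.Ioo (0 : ℝ) 1)

/-- The values of `(id ⊗ fund) ∘ Δ` on the generators. -/
def fundCoactGen : UGen → Matrix (Fin 2) (Fin 2) (Uq q)
  | .A => !![qpow q (1 / 2) • ug q .A, 0; 0, qpow q (-(1 / 2)) • ug q .A]
  | .B => !![qpow q (-(1 / 2)) • ug q .B, ug q .A; 0, qpow q (1 / 2) • ug q .B]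
  | .C => !![qpow q (-(1 / 2)) • ug q .C, 0; ug q .A, qpow q (1 / 2) • ug q .C]
  | .D => !![qpow q (-(1 / 2)) • ug q .D, 0; 0, qpow q (1 / 2) • ug q .D]

theorem qpow_neg_half_mul_half :
    qpow q (-(1 / 2)) * qpow q (1 / 2) = 1 := by
  rw [mul_comm, qpow_half_mul_neg]

theorem qpow_ne_zero (x : ℝ) : qpow q x ≠ 0 := by
  simpa [qpow] using (Real.rpow_pos_of_pos q.2.1 x).ne'

theorem qpow_neg_half : qpow q (-(1 / 2)) = (qpow q (1 / 2))⁻¹ :=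
  eq_inv_of_mul_eq_one_left (qpow_neg_half_mul_half q)

theorem qc_eq_sq : qc q = qpow q (1 / 2) ^ 2 := by
  rw [sq, qpow_half_mul]

theorem qpow_half_four_sub_one_ne : qpow q (1 / 2) ^ 4 - 1 ≠ 0 := by
  have h := qc_sub_inv_ne q
  have hq := q_ne q
  intro h'
  apply h
  field_simp
  rw [qc_eq_sq]
  linear_combination h'

theorem u_BC' : ug q .B * ug q .C = ug q .C * ug q .B +
    (qc q - (qc q)⁻¹)⁻¹ • (ug q .A * ug q .A - ug q .D * ug q .D) := by
  rw [← u_BC]; abel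

/-- The algebra homomorphism `(id ⊗ fund) ∘ Δ` from `U` to the `2 × 2` matrices over `U`. -/
def fundCoact : Uq q →ₐ[ℂ] Matrix (Fin 2) (Fin 2) (Uq q) := by
  have hq := qpow_ne_zero q (1 / 2)
  have h4 := qpow_half_four_sub_one_ne q
  have h1 := qc_eq_sq q
  have h2 := qpow_neg_half q
  refine uLift q (fundCoactGen q) ?_ ?_ ?_ ?_ ?_ <;> simp only [fundCoactGen, h2] <;>
    generalize qpow q (1 / 2) = s at * <;>
    ext i j <;> fin_cases i <;> fin_cases j <;>
    simp [u_AD, u_DA, u_AB, u_AC, u_BC', smul_smul, h1, hq]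
  all_goals match_scalars <;> field_simp <;> ring

@[simp] theorem fundCoact_ug (g : UGen) : fundCoact q (ug q g) = fundCoactGen q g := by
  simp [fundCoact]

/-- The entries of the matrix `(α β; γ δ)`. -/
def agMat : Fin 2 → Fin 2 → Aq q :=
  fun i j => !![ag q .α, ag q .β; ag q .γ, ag q .δ] i j

theorem pairing_agMat (i j : Fin 2) : pairing q (agMat q i j) = entry q i j := by
  fin_cases i <;> fin_cases j <;> simp [agMat, pairing, entryGen]

/-- `id ⊗ φ` for the functional `φ` given by an entry of the fundamental representation. -/
def idEntry (i j : Fin 2) : Uq q ⊗[ℂ] Uq q →ₗ[ℂ] Uq q :=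
  (TensorProduct.rid ℂ (Uq q)).toLinearMap ∘ₗ LinearMap.lTensor (Uq q) (entry q i j).ofConv

theorem idEntry_tmul (i j : Fin 2) (x y : Uq q) :
    idEntry q i j (x ⊗ₜ y) = fund q y i j • x := by
  simp [idEntry, entry]

theorem idEntry_mul (i j : Fin 2) (x y : Uq q ⊗[ℂ] Uq q) :
    idEntry q i j (x * y) = ∑ a, idEntry q i a x * idEntry q a j y := by
  induction x with
  | zero => simp
  | add x x' hx hx' => simp only [add_mul, map_add, hx, hx', Finset.sum_add_distrib]
  | tmul m n =>
    induction y with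
    | zero => simp
    | add y y' hy hy' => simp only [mul_add, map_add, hy, hy', Finset.sum_add_distrib]
    | tmul m' n' =>
      simp only [Algebra.TensorProduct.tmul_mul_tmul, idEntry_tmul, map_mul, Matrix.mul_apply,
        Finset.sum_smul, smul_mul_smul_comm]

theorem idEntry_comul (i j : Fin 2) (X : Uq q) :
    idEntry q i j (uComul q X) = fundCoact q X i j := by
  induction X using uInduction generalizing i j with
  | hc r =>
    rw [AlgHom.commutes, AlgHom.commutes, Algebra.algebraMap_eq_smul_one, map_smul,
      Algebra.TensorProduct.one_def, idEntry_tmul, map_one, Matrix.algebraMap_matrix_apply]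
    rcases eq_or_ne i j with rfl | h
    · simp [Algebra.algebraMap_eq_smul_one, Matrix.one_apply]
    · simp [h, Algebra.algebraMap_eq_smul_one, Matrix.one_apply]
  | hg g =>
    cases g <;> fin_cases i <;> fin_cases j <;>
    simp [uComul, uComulGen, idEntry_tmul, fundCoactGen, fund, fundGen]
  | hm x y hx hy => simp only [map_mul, idEntry_mul, Matrix.mul_apply, hx, hy]
  | ha x y hx hy => simp only [map_add, Matrix.add_apply, hx, hy]

/-- Right multiplication by a generator in `A` becomes an algebra map out of `U` into matrices. A
pairing with a word in the generators can thus be computed one letter at a time. -/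
theorem pairing_mul_agMat (ξ : Aq q) (i j : Fin 2) (X : Uq q) :
    pairing q (ξ * agMat q i j) X = pairing q ξ (fundCoact q X i j) := by
  rw [map_mul, pairing_agMat, ← idEntry_comul]
  change LinearMap.mul' ℂ ℂ (TensorProduct.map (pairing q ξ).ofConv (entry q i j).ofConv
    (uComul q X)) = (pairing q ξ).ofConv _
  generalize uComul q X = z
  induction z with
  | zero => simp
  | tmul a b => simp [entry, idEntry_tmul, mul_comm]
  | add a b ha hb => simp only [map_add, ha, hb]

theorem pairing_one (X : Uq q) : pairing q 1 X = uCounit q X := by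
  rw [map_one]; rfl

/-- Induction on `A_q(SU(2))` by right multiplication with generators. -/
theorem aInduction {p : Aq q → Prop} (h1 : p 1) (hm : ∀ ξ i j, p ξ → p (ξ * agMat q i j))
    (ha : ∀ ξ η, p ξ → p η → p (ξ + η)) (hs : ∀ (c : ℂ) ξ, p ξ → p (c • ξ)) (ξ : Aq q) : p ξ := by
  -- Free-algebra induction splits a word into two arbitrary factors. Carrying a left factor `η`
  -- along ensures that only right multiplications by single generators occur.
  suffices h : ∀ η, p η → p (η * ξ) by simpa using h 1 h1
  obtain ⟨x, rfl⟩ := RingQuot.mkAlgHom_surjective ℂ (ARel q) ξ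
  induction x using FreeAlgebra.induction with
  | grade0 r =>
    intro η hη
    rw [AlgHom.commutes, Algebra.algebraMap_eq_smul_one, mul_smul_comm, mul_one]
    exact hs r η hη
  | grade1 g =>
    intro η hη
    have hg : ∃ i j, agMat q i j = RingQuot.mkAlgHom ℂ (ARel q) (FreeAlgebra.ι ℂ g) := by
      cases g
      exacts [⟨0, 0, rfl⟩, ⟨0, 1, rfl⟩, ⟨1, 0, rfl⟩, ⟨1, 1, rfl⟩]
    obtain ⟨i, j, h⟩ := hg
    rw [← h]
    exact hm η i j hη
  | mul a b ha' hb' =>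
    intro η hη
    rw [map_mul, ← mul_assoc]
    exact hb' _ (ha' _ hη)
  | add a b ha' hb' =>
    intro η hη
    rw [map_add, mul_add]
    exact ha _ _ (ha' _ hη) (hb' _ hη)

/-- `⟨X, ·⟩ ⊗ ⟨Y, ·⟩`. -/
def pairPair (X Y : Uq q) : Aq q ⊗[ℂ] Aq q →ₗ[ℂ] ℂ :=
  LinearMap.mul' ℂ ℂ ∘ₗ TensorProduct.map (pairL q X) (pairL q Y)

theorem pairPair_tmul (X Y : Uq q) (ξ η : Aq q) :
    pairPair q X Y (ξ ⊗ₜ η) = pairing q ξ X * pairing q η Y := by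
  simp [pairPair, pairL]

theorem pairPair_mul_agMat (X Y : Uq q) (z : Aq q ⊗[ℂ] Aq q) (i j k l : Fin 2) :
    pairPair q X Y (z * (agMat q i j ⊗ₜ agMat q k l)) =
      pairPair q (fundCoact q X i j) (fundCoact q Y k l) z := by
  induction z with
  | zero => simp
  | add x x' hx hx' => simp only [add_mul, map_add, hx, hx']
  | tmul m n =>
    rw [Algebra.TensorProduct.tmul_mul_tmul, pairPair_tmul, pairing_mul_agMat, pairing_mul_agMat,
      pairPair_tmul]

theorem aComul_agMat (i j : Fin 2) :
    aComul q (agMat q i j) = ∑ a, agMat q i a ⊗ₜ[ℂ] agMat q a j := by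
  fin_cases i <;> fin_cases j <;> simp [agMat, aComul, aComulGen, Fin.sum_univ_two]

/-- Duality of the multiplication of `U` and the comultiplication of `A`. -/
theorem pairing_apply_mul (ξ : Aq q) (X Y : Uq q) :
    pairing q ξ (X * Y) = pairPair q X Y (aComul q ξ) := by
  induction ξ using aInduction generalizing X Y with
  | h1 => simp [pairing_one, Algebra.TensorProduct.one_def, pairPair_tmul]
  | hm ξ i j h =>
    rw [pairing_mul_agMat, map_mul, map_mul, Matrix.mul_apply, aComul_agMat, Finset.mul_sum,
      map_sum, map_sum]
    simp only [pairPair_mul_agMat, h]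
  | ha ξ η h h' => simp only [map_add, ← h, ← h']; rfl
  | hs c ξ h => simp only [map_smul, ← h]; rfl

theorem pairing_leftAct (ξ : Aq q) (X Y : Uq q) :
    pairing q (leftAct q Y ξ) X = pairing q ξ (X * Y) := by
  rw [pairing_apply_mul, leftAct]
  generalize aComul q ξ = z
  induction z with
  | zero => simp
  | add x x' hx hx' => simp only [map_add, ← hx, ← hx']; rfl
  | tmul m n => simp [pairPair_tmul, pairL, mul_comm]

/-- The translate on the other side from `leftAct`. It is used only to move the row index of a
matrix coefficient, so existence is enough. -/
theorem exists_pairing_mul_left (ξ : Aq q) (Y : Uq q) :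
    ∃ η, ∀ X, pairing q η X = pairing q ξ (Y * X) := by
  simp only [pairing_apply_mul]
  generalize aComul q ξ = z
  induction z with
  | zero => exact ⟨0, by simp⟩
  | add x x' hx hx' =>
    obtain ⟨η, h⟩ := hx
    obtain ⟨η', h'⟩ := hx'
    exact ⟨η + η', fun X => by simp only [map_add, ← h, ← h']; rfl⟩
  | tmul m n => exact ⟨pairing q m Y • n, fun X => by rw [map_smul, pairPair_tmul]; rfl⟩

end Coaction

/-! ### Spanning sets -/

section SkewCommutation
variable {R : Type*} [Ring R] [Algebra ℂ R] {x y : R} {c : ℂ}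

theorem mul_pow_of_mul_eq_smul (h : x * y = c • (y * x)) (n : ℕ) :
    x * y ^ n = c ^ n • (y ^ n * x) := by
  induction n with
  | zero => simp
  | succ n ih =>
    rw [pow_succ, ← mul_assoc, ih, smul_mul_assoc, mul_assoc, h, mul_smul_comm, smul_smul,
      pow_succ, mul_assoc]

theorem pow_mul_of_mul_eq_smul (h : x * y = c • (y * x)) (n : ℕ) :
    x ^ n * y = c ^ n • (y * x ^ n) := by
  induction n with
  | zero => simp
  | succ n ih =>
    rw [pow_succ', mul_assoc, ih, mul_smul_comm, ← mul_assoc, h, smul_mul_assoc, smul_smul,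
      pow_succ, mul_assoc]

theorem pow_mul_pow_of_mul_eq_smul (h : x * y = c • (y * x)) (m n : ℕ) :
    x ^ m * y ^ n = (c ^ m) ^ n • (y ^ n * x ^ m) :=
  mul_pow_of_mul_eq_smul (pow_mul_of_mul_eq_smul h m) n

theorem swap_of_mul_eq_smul (hc : c ≠ 0) (h : x * y = c • (y * x)) : y * x = c⁻¹ • (x * y) := by
  rw [h, smul_smul, inv_mul_cancel₀ hc, one_smul]

end SkewCommutation

/-! ### Ordered monomials in `U` and in `A`. -/

section Span
variable (q : Set.Ioo (0 : ℝ) 1)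

theorem u_BA : ug q .B * ug q .A = (qc q)⁻¹ • (ug q .A * ug q .B) :=
  swap_of_mul_eq_smul (q_ne q) (u_AB q)

theorem u_CA : ug q .C * ug q .A = qc q • (ug q .A * ug q .C) := by
  simpa using swap_of_mul_eq_smul (inv_ne_zero (q_ne q)) (u_AC q)

/-- Iterating the relation for `BC - CB` leaves a commutator that has lower degree in `C`, with
torus factors moved to the left. The coefficients never matter. -/
theorem exists_u_B_mul_C_pow (m : ℕ) : ∃ a b : ℂ, ug q .B * ug q .C ^ (m + 1) =
    ug q .C ^ (m + 1) * ug q .B + a • (ug q .A ^ 2 * ug q .C ^ m) +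
      b • (ug q .D ^ 2 * ug q .C ^ m) := by
  induction m with
  | zero =>
    refine ⟨(qc q - (qc q)⁻¹)⁻¹, -(qc q - (qc q)⁻¹)⁻¹, ?_⟩
    simp only [zero_add, pow_one, pow_zero, mul_one, u_BC', sq]
    module
  | succ m ih =>
    obtain ⟨a, b, h⟩ := ih
    have hA := pow_mul_pow_of_mul_eq_smul (u_CA q) (m + 1) 2
    have hD := pow_mul_pow_of_mul_eq_smul (u_CD q) (m + 1) 2
    refine ⟨a + (qc q - (qc q)⁻¹)⁻¹ * (qc q ^ (m + 1)) ^ 2,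
      b - (qc q - (qc q)⁻¹)⁻¹ * (((qc q)⁻¹) ^ (m + 1)) ^ 2, ?_⟩
    rw [pow_succ (ug q .C) (m + 1), ← mul_assoc, h, add_mul, add_mul, mul_assoc, u_BC', mul_add,
      mul_smul_comm, mul_sub, ← sq, ← sq, hA, hD]
    simp only [smul_mul_assoc, mul_assoc, ← pow_succ]
    rw [← mul_assoc (ug q .C ^ (m + 1)) (ug q .C), ← pow_succ]
    module

/-- The ordered monomials `A^p D^r C^m B^n` in `U`. -/
def uMon (t : ℕ × ℕ × ℕ × ℕ) : Uq q :=
  ug q .A ^ t.1 * ug q .D ^ t.2.1 * ug q .C ^ t.2.2.1 * ug q .B ^ t.2.2.2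

theorem commute_u_DA : Commute (ug q .D) (ug q .A) := by
  rw [commute_iff_eq, u_DA, u_AD]

/-- `A`, `D` and `C` only reorder a monomial up to a scalar. `B` must cross `C^m`, where
`exists_u_B_mul_C_pow` supplies the extra monomials. -/
theorem u_mul_uMon_mem (g : UGen) (t : ℕ × ℕ × ℕ × ℕ) :
    ug q g * uMon q t ∈ Submodule.span ℂ (Set.range (uMon q)) := by
  have hS : ∀ (t : ℕ × ℕ × ℕ × ℕ) (c : ℂ), c • uMon q t ∈ Submodule.span ℂ (Set.range (uMon q)) :=
    fun t c => Submodule.smul_mem _ _ (Submodule.subset_span ⟨t, rfl⟩)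
  obtain ⟨p, r, m, n⟩ := t
  cases g with
  | A =>
    convert hS (p + 1, r, m, n) 1 using 1
    simp only [uMon, pow_succ', mul_assoc, one_smul]
  | D =>
    convert hS (p, r + 1, m, n) 1 using 1
    simp only [uMon, pow_succ', one_smul, ← mul_assoc, ((commute_u_DA q).pow_right p).eq]
  | C =>
    convert hS (p, r, m + 1, n) (qc q ^ p * (qc q)⁻¹ ^ r) using 1
    simp only [uMon, pow_succ', ← mul_assoc, mul_pow_of_mul_eq_smul (u_CA q) p, smul_mul_assoc]
    rw [mul_assoc (ug q .A ^ p), mul_pow_of_mul_eq_smul (u_CD q) r]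
    simp only [mul_smul_comm, smul_mul_assoc, smul_smul, mul_assoc]
  | B =>
    have key : ug q .B * uMon q (p, r, m, n) = ((qc q)⁻¹ ^ p * qc q ^ r) •
        (ug q .A ^ p * ug q .D ^ r * (ug q .B * ug q .C ^ m) * ug q .B ^ n) := by
      simp only [uMon, ← mul_assoc, mul_pow_of_mul_eq_smul (u_BA q) p, smul_mul_assoc]
      rw [mul_assoc (ug q .A ^ p), mul_pow_of_mul_eq_smul (u_BD q) r]
      simp only [mul_smul_comm, smul_mul_assoc, smul_smul, mul_assoc]
    rw [key]
    apply Submodule.smul_mem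
    cases m with
    | zero =>
      convert hS (p, r, 0, n + 1) 1 using 1
      simp only [uMon, pow_succ', mul_assoc, one_smul, pow_zero, one_mul, mul_one]
    | succ m =>
      obtain ⟨a, b, h⟩ := exists_u_B_mul_C_pow q m
      rw [h]
      convert add_mem (add_mem (hS (p, r, m + 1, n + 1) 1) (hS (p + 2, r, m, n) a))
        (hS (p, r + 2, m, n) b) using 1
      simp only [uMon, mul_add, add_mul, mul_smul_comm, smul_mul_assoc, one_smul, pow_add,
        mul_assoc, pow_one]
      rw [((commute_u_DA q).pow_pow r 2).left_comm, ← pow_succ, ← pow_succ']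

theorem uMon_span : Submodule.span ℂ (Set.range (uMon q)) = ⊤ := by
  rw [eq_top_iff]
  rintro X -
  suffices h : ∀ X : Uq q, ∀ Y ∈ Submodule.span ℂ (Set.range (uMon q)),
      X * Y ∈ Submodule.span ℂ (Set.range (uMon q)) by
    have h1 : (1 : Uq q) ∈ Submodule.span ℂ (Set.range (uMon q)) :=
      Submodule.subset_span ⟨(0, 0, 0, 0), by simp [uMon]⟩
    simpa using h X 1 h1
  clear X
  intro X
  induction X using uInduction with
  | hc r =>
    intro Y hY
    rw [← Algebra.smul_def]
    exact Submodule.smul_mem _ _ hY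
  | hg g =>
    intro Y hY
    induction hY using Submodule.span_induction with
    | mem x h => obtain ⟨t, rfl⟩ := h; exact u_mul_uMon_mem q g t
    | zero => simp
    | add x y _ _ hx hy => rw [mul_add]; exact add_mem hx hy
    | smul c x _ hx => rw [mul_smul_comm]; exact Submodule.smul_mem _ _ hx
  | hm x y hx hy => intro Y hY; rw [mul_assoc]; exact hx _ (hy Y hY)
  | ha x y hx hy => intro Y hY; rw [add_mul]; exact add_mem (hx Y hY) (hy Y hY)

/-- `α^n` for `n ≥ 0` and `δ^{-n}` for `n ≤ 0`. -/
def aTorus : ℤ → Aq q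
  | .ofNat n => ag q .α ^ n
  | .negSucc n => ag q .δ ^ (n + 1)

/-- The monomials `α^n β^b γ^c` and `δ^n β^b γ^c` in `A`. -/
def aMon (t : ℤ × ℕ × ℕ) : Aq q := aTorus q t.1 * ag q .β ^ t.2.1 * ag q .γ ^ t.2.2

theorem commute_a_βγ : Commute (ag q .β) (ag q .γ) := a_βγ q

theorem a_βα : ag q .β * ag q .α = (qc q)⁻¹ • (ag q .α * ag q .β) :=
  swap_of_mul_eq_smul (q_ne q) (a_αβ q)

theorem a_γα : ag q .γ * ag q .α = (qc q)⁻¹ • (ag q .α * ag q .γ) :=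
  swap_of_mul_eq_smul (q_ne q) (a_αγ q)

/-- Against a power of `δ` the factor `α` cancels one `δ` up to a `βγ` term, so the torus exponent
always rises by one. -/
theorem exists_aTorus_mul_α (n : ℤ) : ∃ a : ℂ, aTorus q n * ag q .α = aTorus q (n + 1) +
    a • (aTorus q (n + 1) * ag q .β * ag q .γ) := by
  cases n with
  | ofNat n => exact ⟨0, by rw [zero_smul, add_zero]; exact (pow_succ (ag q .α) n).symm⟩
  | negSucc n =>
    refine ⟨(qc q)⁻¹, ?_⟩
    have h : aTorus q (Int.negSucc n + 1) = ag q .δ ^ n := by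
      cases n with
      | zero => change ag q .α ^ 0 = ag q .δ ^ 0; simp
      | succ n => rfl
    rw [h]
    simp only [aTorus, pow_succ, mul_assoc, a_δα, a_βγ, mul_add, mul_one, mul_smul_comm]

theorem exists_aTorus_mul_δ (n : ℤ) : ∃ a : ℂ, aTorus q n * ag q .δ = aTorus q (n - 1) +
    a • (aTorus q (n - 1) * ag q .β * ag q .γ) := by
  rcases n with (_ | n) | n
  · refine ⟨0, ?_⟩
    rw [zero_smul, add_zero]
    change ag q .α ^ 0 * ag q .δ = ag q .δ ^ 1
    simp
  · refine ⟨qc q, ?_⟩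
    have h : aTorus q (Int.ofNat (n + 1) - 1) = ag q .α ^ n := by
      rw [show Int.ofNat (n + 1) - 1 = Int.ofNat n by simp]
      rfl
    rw [h]
    simp only [aTorus, pow_succ, mul_assoc, a_αδ, a_βγ, mul_add, mul_one, mul_smul_comm]
  · exact ⟨0, by rw [zero_smul, add_zero]; exact (pow_succ (ag q .δ) (n + 1)).symm⟩

theorem aMon_mul_mem (t : ℤ × ℕ × ℕ) (i j : Fin 2) :
    aMon q t * agMat q i j ∈ Submodule.span ℂ (Set.range (aMon q)) := by
  have hS : ∀ (t : ℤ × ℕ × ℕ) (c : ℂ), c • aMon q t ∈ Submodule.span ℂ (Set.range (aMon q)) :=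
    fun t c => Submodule.smul_mem _ _ (Submodule.subset_span ⟨t, rfl⟩)
  obtain ⟨n, b, c⟩ := t
  have key : ∀ (n m : ℤ) (x : Aq q) (u v a : ℂ)
      (_ : ag q .γ * x = u • (x * ag q .γ)) (_ : ag q .β * x = v • (x * ag q .β))
      (_ : aTorus q n * x = aTorus q m + a • (aTorus q m * ag q .β * ag q .γ)),
      aMon q (n, b, c) * x ∈ Submodule.span ℂ (Set.range (aMon q)) := by
    intro n m x u v a h1 h2 h3
    convert Submodule.smul_mem _ (u ^ c * v ^ b)
      (add_mem (hS (m, b, c) 1) (hS (m, b + 1, c + 1) a)) using 1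
    simp only [aMon, mul_assoc, pow_mul_of_mul_eq_smul h1 c, mul_smul_comm]
    rw [← mul_assoc (ag q .β ^ b), pow_mul_of_mul_eq_smul h2 b]
    simp only [smul_mul_assoc, mul_smul_comm, smul_smul, ← mul_assoc, h3, add_mul, one_smul]
    congr 3
    simp only [mul_assoc, pow_succ', ((commute_a_βγ q).pow_left b).symm.left_comm]
  fin_cases i <;> fin_cases j
  · obtain ⟨a, h⟩ := exists_aTorus_mul_α q n
    exact key _ _ _ _ _ _ (a_γα q) (a_βα q) h
  · convert hS (n, b + 1, c) 1 using 1
    simp [aMon, agMat, mul_assoc, pow_succ, ((commute_a_βγ q).pow_right c).eq]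
  · convert hS (n, b, c + 1) 1 using 1
    simp [aMon, agMat, mul_assoc, pow_succ]
  · obtain ⟨a, h⟩ := exists_aTorus_mul_δ q n
    exact key _ _ _ _ _ _ (a_γδ q) (a_βδ q) h

theorem aMon_span : Submodule.span ℂ (Set.range (aMon q)) = ⊤ := by
  rw [eq_top_iff]
  rintro ξ -
  induction ξ using aInduction with
  | h1 => exact Submodule.subset_span ⟨(0, 0, 0), by
      simp only [aMon, pow_zero, mul_one]; exact pow_zero (ag q .α)⟩
  | hm ξ i j h =>
    induction h using Submodule.span_induction with
    | mem x h => obtain ⟨t, rfl⟩ := h; exact aMon_mul_mem q t i j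
    | zero => simp
    | add x y _ _ hx hy => rw [add_mul]; exact add_mem hx hy
    | smul c x _ hx => rw [smul_mul_assoc]; exact Submodule.smul_mem _ _ hx
  | ha ξ η h h' => exact add_mem h h'
  | hs c ξ h => exact Submodule.smul_mem _ _ h

end Span

/-! ### Nondegeneracy of the pairing -/

section ExpSum
variable (q : Set.Ioo (0 : ℝ) 1)

theorem qpow_half_pow_injective : Function.Injective fun n : ℤ => qpow q (1 / 2) ^ n := by
  intro m n h
  have h0 : (0 : ℝ) < (q : ℝ) ^ (1 / 2 : ℝ) := Real.rpow_pos_of_pos q.2.1 _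
  have h1 : (q : ℝ) ^ (1 / 2 : ℝ) < 1 := Real.rpow_lt_one q.2.1.le q.2.2 (by norm_num)
  have h' : ((q : ℝ) ^ (1 / 2 : ℝ)) ^ m = ((q : ℝ) ^ (1 / 2 : ℝ)) ^ n := by
    simp only [qpow] at h
    exact_mod_cast h
  exact zpow_right_injective₀ h0 h1.ne h'

/-- Exponential sums with distinct bases are determined by their tails. -/
theorem expSum_eq_zero (y : ℤ →₀ ℂ) (P₀ : ℕ)
    (h : ∀ p : ℕ, P₀ ≤ p → y.sum (fun n c => c * (qpow q (1 / 2) ^ n) ^ p) = 0) : y = 0 := by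
  -- Dedekind's independence of characters, for the characters `p ↦ (q^{n/2})^p` of `ℕ`. Only a tail
  -- in `p` is known to vanish; the shift by `P₀` is absorbed into the coefficients as the nonzero
  -- factor `(q^{n/2})^{P₀}`.
  have hli := (linearIndependent_monoidHom (Multiplicative ℕ) ℂ).comp
    (fun n : ℤ => powersHom ℂ (qpow q (1 / 2) ^ n)) (by
      intro m n hmn
      exact qpow_half_pow_injective q ((powersHom ℂ).injective hmn))
  rw [linearIndependent_iff'] at hli
  ext n
  by_contra hn
  have := hli y.support (fun n => y n * (qpow q (1 / 2) ^ n) ^ P₀) (by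
    funext p
    simp only [Finset.sum_apply, Pi.smul_apply, Pi.zero_apply, Function.comp, smul_eq_mul,
      powersHom_apply]
    rw [← h (P₀ + p.toAdd) (Nat.le_add_right _ _), Finsupp.sum]
    exact Finset.sum_congr rfl fun n _ => by rw [pow_add, mul_assoc]) n (by simpa using hn)
  rcases mul_eq_zero.1 this with h1 | h1
  · exact hn h1
  · exact pow_ne_zero _ (zpow_ne_zero _ (qpow_ne_zero q _)) h1

end ExpSum

/-! ### Triangularity of the pairing on monomials. -/

section Nondegenerate
variable (q : Set.Ioo (0 : ℝ) 1)

theorem fundCoact_A_pow (p : ℕ) : fundCoact q (ug q .A ^ p) =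
    !![qpow q (1 / 2) ^ p • ug q .A ^ p, 0; 0, (qpow q (1 / 2))⁻¹ ^ p • ug q .A ^ p] := by
  rw [map_pow, fundCoact_ug, fundCoactGen, qpow_neg_half]
  induction p with
  | zero => ext i j; fin_cases i <;> fin_cases j <;> simp
  | succ p ih =>
    rw [pow_succ, ih, Matrix.mul_fin_two]
    simp only [mul_zero, zero_mul, add_zero, zero_add, smul_mul_smul_comm, pow_succ]

/-- The corner coefficient is a `q`-integer up to a power of `q`. Only its nonvanishing is needed,
and this follows because the recursion adds positive reals. -/
theorem exists_fundCoact_B_pow (r : ℕ) : ∃ k : ℝ, 0 < k ∧ fundCoact q (ug q .B ^ (r + 1)) =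
    !![(qpow q (1 / 2))⁻¹ ^ (r + 1) • ug q .B ^ (r + 1), (k : ℂ) • (ug q .A * ug q .B ^ r);
      0, qpow q (1 / 2) ^ (r + 1) • ug q .B ^ (r + 1)] := by
  have hs : (0 : ℝ) < (q : ℝ) ^ (1 / 2 : ℝ) := Real.rpow_pos_of_pos q.2.1 _
  have hq := q.2.1
  rw [map_pow, fundCoact_ug, fundCoactGen, qpow_neg_half]
  induction r with
  | zero => exact ⟨1, one_pos, by ext i j; fin_cases i <;> fin_cases j <;> simp⟩
  | succ r ih =>
    obtain ⟨k, hk, ih⟩ := ih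
    refine ⟨((q : ℝ) ^ (1 / 2 : ℝ))⁻¹ ^ (r + 1) * (q : ℝ)⁻¹ ^ (r + 1) + k * (q : ℝ) ^ (1 / 2 : ℝ),
      by positivity, ?_⟩
    rw [pow_succ, ih, Matrix.mul_fin_two]
    simp only [mul_zero, zero_mul, add_zero, zero_add, smul_mul_smul_comm, ← pow_succ,
      smul_mul_assoc, pow_mul_of_mul_eq_smul (u_BA q) (r + 1), smul_smul, mul_smul_comm, mul_assoc,
      ← add_smul]
    simp [qc, qpow]
    refine ⟨⟨?_, ?_⟩, ?_⟩ <;> congr 1 <;> ring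

theorem exists_fundCoact_C_pow (r : ℕ) : ∃ k : ℝ, 0 < k ∧ fundCoact q (ug q .C ^ (r + 1)) =
    !![(qpow q (1 / 2))⁻¹ ^ (r + 1) • ug q .C ^ (r + 1), 0; (k : ℂ) • (ug q .C ^ r * ug q .A),
      qpow q (1 / 2) ^ (r + 1) • ug q .C ^ (r + 1)] := by
  have hs : (0 : ℝ) < (q : ℝ) ^ (1 / 2 : ℝ) := Real.rpow_pos_of_pos q.2.1 _
  have hq := q.2.1
  rw [map_pow, fundCoact_ug, fundCoactGen, qpow_neg_half]
  induction r with
  | zero => exact ⟨1, one_pos, by ext i j; fin_cases i <;> fin_cases j <;> simp⟩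
  | succ r ih =>
    obtain ⟨k, hk, ih⟩ := ih
    refine ⟨k * ((q : ℝ) ^ (1 / 2 : ℝ))⁻¹ * (q : ℝ)⁻¹ + ((q : ℝ) ^ (1 / 2 : ℝ)) ^ (r + 1),
      by positivity, ?_⟩
    rw [pow_succ, ih, Matrix.mul_fin_two]
    simp only [mul_zero, zero_mul, add_zero, zero_add, smul_mul_smul_comm, ← pow_succ,
      smul_mul_assoc, u_AC, smul_smul, mul_smul_comm, mul_assoc]
    simp only [← mul_assoc, ← pow_succ, ← add_smul]
    simp [qc, qpow]
    refine ⟨?_, ?_, ?_⟩ <;> congr 1 <;> ring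

/-- The monomials `C^s A^p B^r` in `U`. -/
def uMonCAB (s p r : ℕ) : Uq q := ug q .C ^ s * ug q .A ^ p * ug q .B ^ r

theorem fundCoact_C_pow_zero_one (s : ℕ) : fundCoact q (ug q .C ^ s) 0 1 = 0 := by
  cases s with
  | zero => simp
  | succ s =>
    obtain ⟨k, -, h⟩ := exists_fundCoact_C_pow q s
    simp [h]

theorem fundCoact_C_pow_zero_zero (s : ℕ) :
    fundCoact q (ug q .C ^ s) 0 0 = (qpow q (1 / 2))⁻¹ ^ s • ug q .C ^ s := by
  cases s with
  | zero => simp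
  | succ s =>
    obtain ⟨k, -, h⟩ := exists_fundCoact_C_pow q s
    simp [h]

theorem fundCoact_B_pow_one_zero (s : ℕ) : fundCoact q (ug q .B ^ s) 1 0 = 0 := by
  cases s with
  | zero => simp
  | succ s =>
    obtain ⟨k, -, h⟩ := exists_fundCoact_B_pow q s
    simp [h]

theorem fundCoact_B_pow_zero_zero (s : ℕ) :
    fundCoact q (ug q .B ^ s) 0 0 = (qpow q (1 / 2))⁻¹ ^ s • ug q .B ^ s := by
  cases s with
  | zero => simp
  | succ s =>
    obtain ⟨k, -, h⟩ := exists_fundCoact_B_pow q s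
    simp [h]

theorem fundCoact_uMonCAB_zero (s p r : ℕ) (j : Fin 2) : fundCoact q (uMonCAB q s p r) 0 j =
    ((qpow q (1 / 2))⁻¹ ^ s * qpow q (1 / 2) ^ p) •
      (ug q .C ^ s * ug q .A ^ p * fundCoact q (ug q .B ^ r) 0 j) := by
  rw [uMonCAB, map_mul, map_mul, Matrix.mul_apply, Fin.sum_univ_two, Matrix.mul_apply,
    Matrix.mul_apply, Fin.sum_univ_two, Fin.sum_univ_two, fundCoact_C_pow_zero_one,
    fundCoact_C_pow_zero_zero, fundCoact_A_pow]
  simp [smul_smul, mul_comm]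

theorem fundCoact_uMonCAB_one_zero (s p r : ℕ) : fundCoact q (uMonCAB q s p r) 1 0 =
    (qpow q (1 / 2) ^ p * (qpow q (1 / 2))⁻¹ ^ r) •
      (fundCoact q (ug q .C ^ s) 1 0 * ug q .A ^ p * ug q .B ^ r) := by
  rw [uMonCAB, map_mul, map_mul, Matrix.mul_apply, Fin.sum_univ_two, Matrix.mul_apply,
    Matrix.mul_apply, Fin.sum_univ_two, Fin.sum_univ_two, fundCoact_B_pow_one_zero,
    fundCoact_B_pow_zero_zero, fundCoact_A_pow]
  simp [smul_smul, mul_comm]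

theorem pairing_mul_β_zero (ξ : Aq q) (s p : ℕ) :
    pairing q (ξ * ag q .β) (uMonCAB q s p 0) = 0 := by
  have h := pairing_mul_agMat q ξ 0 1 (uMonCAB q s p 0)
  rw [fundCoact_uMonCAB_zero] at h
  simpa [agMat] using h

theorem pairing_mul_γ_zero (ξ : Aq q) (p r : ℕ) :
    pairing q (ξ * ag q .γ) (uMonCAB q 0 p r) = 0 := by
  have h := pairing_mul_agMat q ξ 1 0 (uMonCAB q 0 p r)
  rw [fundCoact_uMonCAB_one_zero] at h
  simpa [agMat] using h

theorem pairing_smul_apply (c : ℂ) (ξ : Aq q) (X : Uq q) :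
    pairing q ξ (c • X) = c * pairing q ξ X := (pairing q ξ).ofConv.map_smul c X

/-- Stripping `β` from the right of `ξ` consumes one `B` and releases one `A`. -/
theorem exists_pairing_mul_β (s p r : ℕ) : ∃ k : ℂ, k ≠ 0 ∧ ∀ ξ,
    pairing q (ξ * ag q .β) (uMonCAB q s p (r + 1)) = k * pairing q ξ (uMonCAB q s (p + 1) r) := by
  obtain ⟨k, hk, h⟩ := exists_fundCoact_B_pow q r
  refine ⟨(qpow q (1 / 2))⁻¹ ^ s * qpow q (1 / 2) ^ p * k, ?_, fun ξ => ?_⟩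
  · have := qpow_ne_zero q (1 / 2)
    have : (k : ℂ) ≠ 0 := by exact_mod_cast hk.ne'
    positivity
  · have h' := pairing_mul_agMat q ξ 0 1 (uMonCAB q s p (r + 1))
    rw [fundCoact_uMonCAB_zero, h] at h'
    change pairing q (ξ * agMat q 0 1) _ = _
    rw [h', ← pairing_smul_apply]
    simp [uMonCAB, pow_succ, smul_smul, mul_assoc]

theorem exists_pairing_mul_γ (s p r : ℕ) : ∃ k : ℂ, k ≠ 0 ∧ ∀ ξ,
    pairing q (ξ * ag q .γ) (uMonCAB q (s + 1) p r) = k * pairing q ξ (uMonCAB q s (p + 1) r) := by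
  obtain ⟨k, hk, h⟩ := exists_fundCoact_C_pow q s
  refine ⟨qpow q (1 / 2) ^ p * (qpow q (1 / 2))⁻¹ ^ r * k, ?_, fun ξ => ?_⟩
  · have := qpow_ne_zero q (1 / 2)
    have : (k : ℂ) ≠ 0 := by exact_mod_cast hk.ne'
    positivity
  · have h' := pairing_mul_agMat q ξ 1 0 (uMonCAB q (s + 1) p r)
    rw [fundCoact_uMonCAB_one_zero, h] at h'
    change pairing q (ξ * agMat q 1 0) _ = _
    rw [h', ← pairing_smul_apply]
    simp [uMonCAB, pow_succ', smul_smul, mul_assoc]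

theorem pairing_mul_β_pow_zero (ξ : Aq q) (s p r b : ℕ) (h : r < b) :
    pairing q (ξ * ag q .β ^ b) (uMonCAB q s p r) = 0 := by
  induction b generalizing p r with
  | zero => omega
  | succ b ih =>
    rw [pow_succ, ← mul_assoc]
    cases r with
    | zero => exact pairing_mul_β_zero q _ _ _
    | succ r =>
      obtain ⟨k, -, hk⟩ := exists_pairing_mul_β q s p r
      rw [hk, ih _ _ (by omega), mul_zero]

theorem exists_pairing_mul_β_pow (s p b : ℕ) : ∃ k : ℂ, k ≠ 0 ∧ ∀ ξ,
    pairing q (ξ * ag q .β ^ b) (uMonCAB q s p b) = k * pairing q ξ (uMonCAB q s (p + b) 0) := by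
  induction b generalizing p with
  | zero => exact ⟨1, one_ne_zero, by simp⟩
  | succ b ih =>
    obtain ⟨k, hk0, hk⟩ := exists_pairing_mul_β q s p b
    obtain ⟨k', hk0', hk'⟩ := ih (p + 1)
    refine ⟨k * k', mul_ne_zero hk0 hk0', fun ξ => ?_⟩
    rw [pow_succ, ← mul_assoc, hk, hk', mul_assoc, add_right_comm, add_assoc]

theorem pairing_mul_γ_pow_zero (ξ : Aq q) (s p r c : ℕ) (h : s < c) :
    pairing q (ξ * ag q .γ ^ c) (uMonCAB q s p r) = 0 := by
  induction c generalizing p s with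
  | zero => omega
  | succ b ih =>
    rw [pow_succ, ← mul_assoc]
    cases s with
    | zero => exact pairing_mul_γ_zero q _ _ _
    | succ s =>
      obtain ⟨k, -, hk⟩ := exists_pairing_mul_γ q s p r
      rw [hk, ih _ _ (by omega), mul_zero]

theorem exists_pairing_mul_γ_pow (p r c : ℕ) : ∃ k : ℂ, k ≠ 0 ∧ ∀ ξ,
    pairing q (ξ * ag q .γ ^ c) (uMonCAB q c p r) = k * pairing q ξ (uMonCAB q 0 (p + c) r) := by
  induction c generalizing p with
  | zero => exact ⟨1, one_ne_zero, by simp⟩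
  | succ b ih =>
    obtain ⟨k, hk0, hk⟩ := exists_pairing_mul_γ q b p r
    obtain ⟨k', hk0', hk'⟩ := ih (p + 1)
    refine ⟨k * k', mul_ne_zero hk0 hk0', fun ξ => ?_⟩
    rw [pow_succ, ← mul_assoc, hk, hk', mul_assoc, add_right_comm, add_assoc]

/-- Each `β` consumes a `B` and each `γ` a `C`, so the pairing vanishes when there are too few of
either. -/
theorem pairing_aMon_eq_zero (t : ℤ × ℕ × ℕ) (s p r : ℕ) (h : r < t.2.1 ∨ s < t.2.2) :
    pairing q (aMon q t) (uMonCAB q s p r) = 0 := by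
  rcases h with h | h
  · rw [aMon, mul_assoc, (commute_a_βγ q).pow_pow, ← mul_assoc]
    exact pairing_mul_β_pow_zero q _ _ _ _ _ h
  · exact pairing_mul_γ_pow_zero q _ _ _ _ _ h

theorem pairing_mul_A_pow (ξ : Aq q) (i : Fin 2) (p : ℕ) :
    pairing q (ξ * agMat q i i) (ug q .A ^ p) =
      (![qpow q (1 / 2), (qpow q (1 / 2))⁻¹] i) ^ p * pairing q ξ (ug q .A ^ p) := by
  rw [pairing_mul_agMat, fundCoact_A_pow, ← pairing_smul_apply]
  fin_cases i <;> simp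

theorem pairing_one_A_pow (p : ℕ) : pairing q 1 (ug q .A ^ p) = 1 := by
  rw [pairing_one, map_pow, uCounit, uLift_ug, one_pow]

theorem pairing_aTorus (n : ℤ) (p : ℕ) :
    pairing q (aTorus q n) (ug q .A ^ p) = (qpow q (1 / 2) ^ n) ^ p := by
  have h0 : ∀ n, pairing q (ag q .α ^ n) (ug q .A ^ p) = (qpow q (1 / 2) ^ n) ^ p := by
    intro n
    induction n with
    | zero => simp only [pow_zero, one_pow]; exact pairing_one_A_pow q p
    | succ n ih =>
      have := pairing_mul_A_pow q (ag q .α ^ n) 0 p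
      rw [pow_succ]
      refine this.trans ?_
      rw [ih, pow_succ, mul_pow, mul_comm]
      rfl
  have h1 : ∀ n, pairing q (ag q .δ ^ n) (ug q .A ^ p) = ((qpow q (1 / 2))⁻¹ ^ n) ^ p := by
    intro n
    induction n with
    | zero => simp only [pow_zero, one_pow]; exact pairing_one_A_pow q p
    | succ n ih =>
      have := pairing_mul_A_pow q (ag q .δ ^ n) 1 p
      rw [pow_succ]
      refine this.trans ?_
      rw [ih, pow_succ, mul_pow, mul_comm]
      rfl
  cases n with
  | ofNat n => simpa [aTorus] using h0 n
  | negSucc n => rw [aTorus, h1, zpow_negSucc, inv_pow]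

/-- On the diagonal of the triangular pairing only the torus part survives. The constant does not
depend on `n`, so varying `p` can separate the exponents `n`. -/
theorem exists_pairing_aMon (p b c : ℕ) : ∃ k : ℂ, k ≠ 0 ∧ ∀ n,
    pairing q (aMon q (n, b, c)) (uMonCAB q c p b) =
      k * (qpow q (1 / 2) ^ n) ^ (p + (b + c)) := by
  obtain ⟨k, hk0, hk⟩ := exists_pairing_mul_γ_pow q p b c
  obtain ⟨k', hk0', hk'⟩ := exists_pairing_mul_β_pow q 0 (p + c) b
  refine ⟨k * k', mul_ne_zero hk0 hk0', fun n => ?_⟩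
  rw [aMon, hk, hk', mul_assoc, add_assoc, add_comm c b]
  simp only [uMonCAB, pow_zero, one_mul, mul_one, pairing_aTorus]

/-- In a combination of monomials that pairs to zero, choose `(b, c)` in the support with `b + c`
minimal. Pairing with `C^c A^p B^b` kills every term with a different pair of exponents, and what
remains is an exponential sum in `p`, whose coefficients vanish by `expSum_eq_zero`. -/
theorem pairing_injective : Function.Injective (pairing q) := by
  rw [injective_iff_map_eq_zero]
  intro ξ hξ
  obtain ⟨x, rfl⟩ := (Finsupp.range_linearCombination (R := ℂ) (v := aMon q) ▸ aMon_span q ▸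
    Submodule.mem_top : ξ ∈ LinearMap.range (Finsupp.linearCombination ℂ (aMon q)))
  suffices hx : x = 0 by rw [hx, map_zero]
  by_contra hx
  obtain ⟨⟨n₀, b, c⟩, ht₀, hmin⟩ := x.support.exists_min_image (fun t => t.2.1 + t.2.2)
    (Finsupp.support_nonempty_iff.2 hx)
  have hinj : Function.Injective fun n : ℤ => (n, b, c) := fun m n h => by simpa using h
  have hy := expSum_eq_zero q (x.comapDomain (fun n : ℤ => (n, b, c)) hinj.injOn) (b + c) (by
    intro P hP
    obtain ⟨p, rfl⟩ := Nat.exists_eq_add_of_le' hP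
    obtain ⟨k, hk0, hk⟩ := exists_pairing_aMon q p b c
    apply mul_left_cancel₀ hk0
    rw [mul_zero]
    have h0 : pairing q (Finsupp.linearCombination ℂ (aMon q) x) (uMonCAB q c p b) = 0 := by
      rw [hξ]; rfl
    change pairL q (uMonCAB q c p b) _ = 0 at h0
    rw [Finsupp.linearCombination_apply, Finsupp.sum, map_sum] at h0
    rw [← h0, Finsupp.sum, Finset.mul_sum]
    refine Finset.sum_of_injOn (fun n => (n, b, c)) hinj.injOn (fun n hn => by simpa using hn) ?_ ?_
    · rintro ⟨m, b', c'⟩ hm hm'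
      rw [map_smul]
      have h1 := hmin _ hm
      -- By minimality of `b + c`, a different pair of exponents must exceed `(b, c)` in some
      -- coordinate.
      have h2 : b < b' ∨ c < c' := by
        by_contra h3
        simp only at h1
        obtain ⟨rfl, rfl⟩ : b' = b ∧ c' = c := by omega
        exact hm' ⟨m, by simpa using hm, rfl⟩
      change _ • pairing q _ _ = 0
      rw [pairing_aMon_eq_zero q _ _ _ _ h2, smul_zero]
    · intro n hn
      rw [map_smul]
      change _ = _ • pairing q _ _
      rw [hk, Finsupp.comapDomain_apply, smul_eq_mul]
      ring)
  have : x (n₀, b, c) = 0 := by simpa using DFunLike.congr_fun hy n₀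
  exact (Finsupp.mem_support_iff.1 ht₀) this

end Nondegenerate

/-! ### Existence of the matrix elements -/

section Existence
variable (q : Set.Ioo (0 : ℝ) 1)

/-- In the monomials `A^p D^r C^m B^n` the torus part and then `C` can be evaluated from the left
and `B` from the right, so the hypotheses determine every value from the value at `1`. -/
theorem linearMap_ext_of_lowest {x : ℂ} (hx : x ≠ 0) {f g : Uq q →ₗ[ℂ] ℂ}
    (fA : ∀ X, f (ug q .A * X) = x * f X) (fC : ∀ X, f (ug q .C * X) = 0)
    (fB : ∀ X, f (X * ug q .B) = 0)
    (gA : ∀ X, g (ug q .A * X) = x * g X) (gC : ∀ X, g (ug q .C * X) = 0)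
    (gB : ∀ X, g (X * ug q .B) = 0) (h1 : f 1 = g 1) : f = g := by
  have key : ∀ f : Uq q →ₗ[ℂ] ℂ, (∀ X, f (ug q .A * X) = x * f X) →
      (∀ X, f (ug q .C * X) = 0) → (∀ X, f (X * ug q .B) = 0) →
      ∀ p r m n, f (uMon q (p, r, m, n)) = x ^ p * x⁻¹ ^ r * if m = 0 ∧ n = 0 then f 1 else 0 := by
    intro f fA fC fB p r m n
    have fD : ∀ X, f (ug q .D * X) = x⁻¹ * f X := by
      intro X
      apply mul_left_cancel₀ hx
      rw [← fA, ← mul_assoc, u_AD, one_mul, mul_inv_cancel_left₀ hx]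
    have fA' : ∀ p X, f (ug q .A ^ p * X) = x ^ p * f X := by
      intro p X
      induction p with
      | zero => simp
      | succ p ih => rw [pow_succ', mul_assoc, fA, ih, pow_succ', mul_assoc]
    have fD' : ∀ p X, f (ug q .D ^ p * X) = x⁻¹ ^ p * f X := by
      intro p X
      induction p with
      | zero => simp
      | succ p ih => rw [pow_succ', mul_assoc, fD, ih, pow_succ', mul_assoc]
    simp only [uMon, mul_assoc, fA', fD']
    congr 2
    rcases m with _ | m
    · rcases n with _ | n
      · simp
      · rw [pow_succ, ← mul_assoc, fB]; simp
    · rw [pow_succ', mul_assoc, fC]; simp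
  refine LinearMap.ext_on (uMon_span q) ?_
  rintro _ ⟨⟨p, r, m, n⟩, rfl⟩
  rw [key f fA fC fB, key g gA gC gB, h1]

theorem pairing_α_pow_lowest (L : ℕ) :
    (∀ X, pairing q (ag q .α ^ L) (ug q .A * X) =
      qpow q (1 / 2) ^ L * pairing q (ag q .α ^ L) X) ∧
    (∀ X, pairing q (ag q .α ^ L) (ug q .C * X) = 0) ∧
    (∀ X, pairing q (ag q .α ^ L) (X * ug q .B) = 0) ∧ pairing q (ag q .α ^ L) 1 = 1 := by
  induction L with
  | zero => simp only [pow_zero, pairing_one, map_mul, one_mul]; simp [uCounit]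
  | succ L ih =>
    obtain ⟨hA, hC, hB, h1⟩ := ih
    have h : ∀ X, pairing q (ag q .α ^ (L + 1)) X =
        pairing q (ag q .α ^ L) (fundCoact q X 0 0) := by
      intro X
      rw [pow_succ]
      exact pairing_mul_agMat q _ 0 0 X
    refine ⟨fun X => ?_, fun X => ?_, fun X => ?_, ?_⟩
    · rw [h, h, map_mul, Matrix.mul_apply, Fin.sum_univ_two, fundCoact_ug, pow_succ]
      simp only [fundCoactGen, Matrix.of_apply, Matrix.cons_val', Matrix.cons_val_zero,
        Matrix.cons_val_one, Matrix.cons_val_fin_one, zero_mul, add_zero, smul_mul_assoc]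
      rw [pairing_smul_apply, hA]
      ring
    · rw [h, map_mul, Matrix.mul_apply, Fin.sum_univ_two, fundCoact_ug]
      simp only [fundCoactGen, Matrix.of_apply, Matrix.cons_val', Matrix.cons_val_zero,
        Matrix.cons_val_one, Matrix.cons_val_fin_one, zero_mul, add_zero, smul_mul_assoc]
      rw [pairing_smul_apply, hC, mul_zero]
    · rw [h, map_mul, Matrix.mul_apply, Fin.sum_univ_two, fundCoact_ug]
      simp only [fundCoactGen, Matrix.of_apply, Matrix.cons_val', Matrix.cons_val_zero,
        Matrix.cons_val_one, Matrix.cons_val_fin_one, mul_zero, add_zero, mul_smul_comm]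
      rw [pairing_smul_apply, hB, mul_zero]
    · rw [h, map_one]
      simpa using h1

@[simp] theorem rep_ug (L : ℕ) (g : UGen) : rep q L (ug q g) = repGen q L g := by
  simp [rep]

/-- Both functionals are of the kind treated in `linearMap_ext_of_lowest`, with eigenvalue
`(q^{1/2})^L`: the last basis vector has `n = -l`, and `A` acts on it by `q^l`. -/
theorem pairing_α_pow (L : ℕ) (X : Uq q) :
    pairing q (ag q .α ^ L) X = rep q L X (Fin.last L) (Fin.last L) := by
  obtain ⟨hA, hC, hB, h1⟩ := pairing_α_pow_lowest q L
  let g : Uq q →ₗ[ℂ] ℂ :=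
    Matrix.entryLinearMap ℂ ℂ (Fin.last L) (Fin.last L) ∘ₗ (rep q L).toLinearMap
  have hs : qpow q (-((L : ℝ) / 2 - L)) = qpow q (1 / 2) ^ L := by
    simp only [qpow, ← Complex.ofReal_pow, ← Real.rpow_mul_natCast q.2.1.le]
    congr 2; ring
  have : (pairing q (ag q .α ^ L)).ofConv = g := by
    refine linearMap_ext_of_lowest q (pow_ne_zero L (qpow_ne_zero q (1 / 2))) hA hC hB
      (fun Y => ?_) (fun Y => ?_) (fun Y => ?_) ?_
    · simp [g, repGen, Matrix.diagonal_mul, -neg_sub, -one_div, hs]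
    · simp only [g, LinearMap.comp_apply, AlgHom.toLinearMap_apply, map_mul, rep_ug,
        Matrix.entryLinearMap_apply, Matrix.mul_apply, repGen, Matrix.of_apply]
      refine Finset.sum_eq_zero fun k _ => ?_
      rw [if_neg (by simp only [Fin.val_last]; omega), zero_mul]
    · simp only [g, LinearMap.comp_apply, AlgHom.toLinearMap_apply, map_mul, rep_ug,
        Matrix.entryLinearMap_apply, Matrix.mul_apply, repGen, Matrix.of_apply]
      refine Finset.sum_eq_zero fun k _ => ?_
      rw [if_neg (by simp only [Fin.val_last]; omega), mul_zero]
    · simpa [g] using h1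
  exact LinearMap.congr_fun this X

theorem zpow_neg_sub_zpow_pos {z : ℤ} (hz : 0 < z) : 0 < (q : ℝ) ^ (-z) - (q : ℝ) ^ z :=
  sub_pos.2 (zpow_lt_zpow_right_of_lt_one₀ q.2.1 q.2.2 (by omega))

theorem inv_sub_pos : 0 < (q : ℝ)⁻¹ - q := by
  simpa using zpow_neg_sub_zpow_pos q (z := 1) one_pos

theorem ladder_pos {L k : ℕ} (h0 : 0 < k) (h1 : k ≤ L) : 0 < ladder q L k :=
  div_pos (Real.sqrt_pos.2 (mul_pos (zpow_neg_sub_zpow_pos q (by omega))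
    (zpow_neg_sub_zpow_pos q (by omega)))) (inv_sub_pos q)

/-- Starting from the corner entry `α^L`, right multiplication of the argument by `C` lowers the
column index and left multiplication by `B` lowers the row index. The ladder coefficients that
appear are nonzero and can be divided out. -/
theorem exists_pairing_eq_rep (L : ℕ) (i j : Fin (L + 1)) :
    ∃ ξ, ∀ X, pairing q ξ X = rep q L X i j := by
  induction i using Fin.reverseInduction with
  | last =>
    induction j using Fin.reverseInduction with
    | last => exact ⟨_, pairing_α_pow q L⟩
    | cast j ih =>
      obtain ⟨ξ, h⟩ := ih
      have hl : (ladder q L (j + 1) : ℂ) ≠ 0 := by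
        exact_mod_cast (ladder_pos q (Nat.succ_pos _) (by omega)).ne'
      refine ⟨(ladder q L (j + 1) : ℂ)⁻¹ • leftAct q (ug q .C) ξ, fun X => ?_⟩
      rw [map_smul]
      change _ * pairing q (leftAct q (ug q .C) ξ) X = _
      rw [pairing_leftAct, h, map_mul, rep_ug, Matrix.mul_apply,
        Finset.sum_eq_single j.castSucc]
      · simp [repGen, mul_comm, hl]
      · intro b _ hb
        rw [repGen, Matrix.of_apply, if_neg, mul_zero]
        intro h; apply hb; apply Fin.ext; simp at h ⊢; omega
      · simp
  | cast i ih =>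
    obtain ⟨ξ, h⟩ := ih
    have hl : (ladder q L (i + 1) : ℂ) ≠ 0 := by
      exact_mod_cast (ladder_pos q (Nat.succ_pos _) (by omega)).ne'
    obtain ⟨η, hη⟩ := exists_pairing_mul_left q ξ (ug q .B)
    refine ⟨(ladder q L (i + 1) : ℂ)⁻¹ • η, fun X => ?_⟩
    rw [map_smul]
    change _ * pairing q η X = _
    rw [hη, h, map_mul, rep_ug, Matrix.mul_apply, Finset.sum_eq_single i.castSucc]
    · simp [repGen, hl]
    · intro b _ hb
      rw [repGen, Matrix.of_apply, if_neg, zero_mul]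
      intro h; apply hb; apply Fin.ext; simp at h ⊢; omega
    · simp

theorem exists_isGenMatElt (L : ℕ) (I J : ℤ) (τ σ : ℝ) : ∃ a, IsGenMatElt q L I J τ σ a := by
  choose ξ hξ using exists_pairing_eq_rep q L
  refine ⟨∑ i, ∑ j, (star (vec q L I τ i) * vec q L J σ j) • ξ i j, fun X => ?_⟩
  change pairL q X _ = _
  simp only [map_sum, map_smul, dotProduct, Matrix.mulVec, Finset.mul_sum]
  refine Finset.sum_congr rfl fun i _ => Finset.sum_congr rfl fun j _ => ?_
  change _ • pairing q (ξ i j) X = _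
  rw [hξ, smul_eq_mul, Pi.star_apply]
  ring

theorem isGenMatElt_unique (L : ℕ) (I J : ℤ) (τ σ : ℝ) :
    ∃! a, IsGenMatElt q L I J τ σ a := by
  obtain ⟨a, ha⟩ := exists_isGenMatElt q L I J τ σ
  refine ⟨a, ha, fun b hb => pairing_injective q ?_⟩
  apply WithConv.ofConv_injective
  ext X
  exact (hb X).trans (ha X).symm

theorem isGenMatElt_genMatElt (L : ℕ) (I J : ℤ) (τ σ : ℝ) :
    IsGenMatElt q L I J τ σ (genMatElt q L I J τ σ) :=
  Classical.epsilon_spec (exists_isGenMatElt q L I J τ σ)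

theorem pairing_defMatElt (L : ℕ) (I J : ℤ) (τ σ : ℝ) (X : Uq q) :
    pairing q (defMatElt q L I J τ σ) X = star (vec q L I τ) ⬝ᵥ
      Matrix.mulVec (rep q L X) (Matrix.mulVec (rep q L (ug q .A)) (vec q L J σ)) := by
  rw [defMatElt, pairing_leftAct, isGenMatElt_genMatElt, map_mul, Matrix.mulVec_mulVec]

end Existence

/-! ### Covariant elements are determined by their restriction to the torus -/

section Torus
variable (q : Set.Ioo (0 : ℝ) 1)

theorem pairing_add_apply (ξ : Aq q) (X Y : Uq q) :
    pairing q ξ (X + Y) = pairing q ξ X + pairing q ξ Y := (pairing q ξ).ofConv.map_add X Y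

/-- The span of the functions `p ↦ q^{np/2}`, `n ∈ ℤ`. -/
def expSums : Submodule ℂ (ℕ → ℂ) :=
  Submodule.span ℂ (Set.range fun (n : ℤ) (p : ℕ) => (qpow q (1 / 2) ^ n) ^ p)

theorem eq_zero_of_mem_expSums {f : ℕ → ℂ} (hf : f ∈ expSums q)
    (h : ∀ᶠ p in Filter.atTop, f p = 0) : f = 0 := by
  rw [expSums, ← Finsupp.range_linearCombination] at hf
  obtain ⟨y, rfl⟩ := hf
  obtain ⟨P₀, hP⟩ := Filter.eventually_atTop.1 h
  rw [expSum_eq_zero q y P₀, map_zero]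
  intro p hp
  rw [← hP p hp, Finsupp.linearCombination_apply]
  simp only [Finsupp.sum, Finset.sum_apply, Pi.smul_apply, smul_eq_mul]

theorem mul_mem_expSums (m : ℤ) {f : ℕ → ℂ} (hf : f ∈ expSums q) :
    (fun p => (qpow q (1 / 2) ^ m) ^ p * f p) ∈ expSums q := by
  induction hf using Submodule.span_induction with
  | mem x h =>
    obtain ⟨n, rfl⟩ := h
    refine Submodule.subset_span ⟨m + n, ?_⟩
    funext p
    simp only
    rw [zpow_add₀ (qpow_ne_zero q _), mul_pow]
  | zero => simp only [Pi.zero_apply, mul_zero]; exact Submodule.zero_mem (expSums q)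
  | add x y _ _ hx hy => simp only [Pi.add_apply, mul_add]; exact add_mem hx hy
  | smul c x _ hx =>
    simp only [Pi.smul_apply, mul_smul_comm]; exact Submodule.smul_mem _ c hx

/-- `A^p` acts diagonally in `fundCoact`, so each generator stripped from `ξ` contributes a factor
`(q^{1/2})^p` or `(q^{-1/2})^p`, according to its row. -/
theorem pairing_A_pow_mul_mem_expSums (ξ : Aq q) (X : Uq q) :
    (fun p => pairing q ξ (ug q .A ^ p * X)) ∈ expSums q := by
  induction ξ using aInduction generalizing X with
  | h1 =>
    convert Submodule.smul_mem (expSums q) (uCounit q X) (Submodule.subset_span ⟨0, rfl⟩) using 1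
    funext p
    simp [pairing_one, uCounit, -map_one]
  | hm ξ i j h =>
    simp only [pairing_mul_agMat]
    simp only [map_mul, Matrix.mul_apply, Fin.sum_univ_two, fundCoact_A_pow]
    fin_cases i
    · convert mul_mem_expSums q 1 (h (fundCoact q X 0 j)) using 2 with p
      simp [-one_div, pairing_smul_apply]
    · convert mul_mem_expSums q (-1) (h (fundCoact q X 1 j)) using 2 with p
      simp [-one_div, pairing_smul_apply]
  | ha ξ η h h' => simp only [map_add]; exact add_mem (h X) (h' X)
  | hs c ξ h => simp only [map_smul]; exact Submodule.smul_mem _ c (h X)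

/-- The functional `⟨·, ξ⟩` vanishes on `A^p X` for all `p`. -/
def TorusNull (ξ : Aq q) (X : Uq q) : Prop := ∀ p : ℕ, pairing q ξ (ug q .A ^ p * X) = 0

variable {q} {ξ : Aq q} {X Y : Uq q}

theorem TorusNull.of_eventually
    (h : ∀ᶠ p in Filter.atTop, pairing q ξ (ug q .A ^ p * X) = 0) : TorusNull q ξ X :=
  fun p => congr_fun (eq_zero_of_mem_expSums q (pairing_A_pow_mul_mem_expSums q ξ X) h) p

theorem TorusNull.A_mul (h : TorusNull q ξ X) : TorusNull q ξ (ug q .A * X) := fun p => by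
  rw [← mul_assoc, ← pow_succ, h]

/-- For `p ≥ 1` the factor `D` cancels one `A`; the remaining value `p = 0` comes from
`TorusNull.of_eventually`. -/
theorem TorusNull.D_mul (h : TorusNull q ξ X) : TorusNull q ξ (ug q .D * X) := by
  apply TorusNull.of_eventually
  filter_upwards [Filter.eventually_ge_atTop 1] with p hp
  obtain ⟨p, rfl⟩ := Nat.exists_eq_add_of_le' hp
  rw [pow_succ, mul_assoc, ← mul_assoc (ug q .A) (ug q .D), u_AD, one_mul, h]

theorem TorusNull.D_pow_mul (h : TorusNull q ξ X) (r : ℕ) : TorusNull q ξ (ug q .D ^ r * X) := by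
  induction r with
  | zero => simpa
  | succ r ih => rw [pow_succ', mul_assoc]; exact ih.D_mul

theorem TorusNull.A_pow_mul (h : TorusNull q ξ X) (r : ℕ) : TorusNull q ξ (ug q .A ^ r * X) := by
  induction r with
  | zero => simpa
  | succ r ih => rw [pow_succ', mul_assoc]; exact ih.A_mul

theorem TorusNull.add (h : TorusNull q ξ X) (h' : TorusNull q ξ Y) : TorusNull q ξ (X + Y) :=
  fun p => by rw [mul_add, pairing_add_apply, h, h', add_zero]

theorem TorusNull.smul (c : ℂ) (h : TorusNull q ξ X) : TorusNull q ξ (c • X) :=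
  fun p => by rw [mul_smul_comm, pairing_smul_apply, h, mul_zero]

variable (q) in
theorem exists_u_C_mul_B_pow (m : ℕ) : ∃ a b : ℂ, ug q .C * ug q .B ^ (m + 1) =
    ug q .B ^ (m + 1) * ug q .C + (a • (ug q .A ^ 2 * ug q .B ^ m) +
      b • (ug q .D ^ 2 * ug q .B ^ m)) := by
  have hCB : ug q .C * ug q .B = ug q .B * ug q .C -
      (qc q - (qc q)⁻¹)⁻¹ • (ug q .A * ug q .A - ug q .D * ug q .D) := by
    rw [u_BC']; abel
  induction m with
  | zero =>
    refine ⟨-(qc q - (qc q)⁻¹)⁻¹, (qc q - (qc q)⁻¹)⁻¹, ?_⟩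
    simp only [zero_add, pow_one, pow_zero, mul_one, hCB, sq]
    module
  | succ m ih =>
    obtain ⟨a, b, h⟩ := ih
    have hA := pow_mul_pow_of_mul_eq_smul (u_BA q) (m + 1) 2
    have hD := pow_mul_pow_of_mul_eq_smul (u_BD q) (m + 1) 2
    refine ⟨a - (qc q - (qc q)⁻¹)⁻¹ * (((qc q)⁻¹) ^ (m + 1)) ^ 2,
      b + (qc q - (qc q)⁻¹)⁻¹ * (qc q ^ (m + 1)) ^ 2, ?_⟩
    rw [pow_succ (ug q .B) (m + 1), ← mul_assoc, h, add_mul, add_mul, mul_assoc, hCB, mul_sub,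
      mul_smul_comm, mul_sub, ← sq, ← sq, hA, hD]
    simp only [smul_mul_assoc, mul_assoc, ← pow_succ]
    rw [← mul_assoc (ug q .B ^ (m + 1)) (ug q .B), ← pow_succ]
    module

variable {c₁ c₂ : ℂ}

/-- Induction on `n`. Modulo values already known to vanish, the right relation at `A^p B^n`
involves `A^p B^{n+1}` and `A^p B^n C`. The left relation involves the same two elements, but
weighted by `q^{-p}` and `q^p`. Eliminating the term with `C` leaves `c₁ (q^{-p} - q^p)` times the
wanted value, which settles `p ≥ 1`. -/
theorem torusNull_B_pow (h₁ : c₁ ≠ 0) {a b a' b' : ℂ}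
    (hR : ∀ X, c₁ * pairing q ξ (X * ug q .B) + c₂ * pairing q ξ (X * ug q .C) =
      a * pairing q ξ (X * ug q .A) + b * pairing q ξ (X * ug q .D))
    (hL : ∀ X, c₁ * pairing q ξ (ug q .B * X) + c₂ * pairing q ξ (ug q .C * X) =
      a' * pairing q ξ (ug q .A * X) + b' * pairing q ξ (ug q .D * X))
    (h0 : TorusNull q ξ 1) (n : ℕ) : TorusNull q ξ (ug q .B ^ n) := by
  induction n using Nat.strong_induction_on with | _ n ih => ?_
  rcases n with _ | n
  · simpa using h0
  have hn := ih n (Nat.lt_succ_self n)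
  have hlow : ∃ Z, ug q .C * ug q .B ^ n = ug q .B ^ n * ug q .C + Z ∧ TorusNull q ξ Z := by
    rcases n with _ | n
    · exact ⟨0, by simp, fun p => by rw [mul_zero]; exact (pairing q ξ).ofConv.map_zero⟩
    · obtain ⟨a, b, h⟩ := exists_u_C_mul_B_pow q n
      have hn' := ih n (by omega)
      exact ⟨_, h, ((hn'.A_pow_mul 2).smul a).add ((hn'.D_pow_mul 2).smul b)⟩
  obtain ⟨Z, hZ, hZ0⟩ := hlow
  apply TorusNull.of_eventually
  filter_upwards [Filter.eventually_ge_atTop 1] with p hp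
  have e1 := hR (ug q .A ^ p * ug q .B ^ n)
  have e2 := hL (ug q .A ^ p * ug q .B ^ n)
  rw [mul_assoc, mul_assoc, mul_assoc, mul_assoc, pow_mul_of_mul_eq_smul (u_BA q) n,
    pow_mul_of_mul_eq_smul (u_BD q) n, mul_smul_comm, mul_smul_comm, pairing_smul_apply,
    pairing_smul_apply, hn.A_mul, hn.D_mul, ← pow_succ] at e1
  rw [← mul_assoc, ← mul_assoc, ← mul_assoc, ← mul_assoc, mul_pow_of_mul_eq_smul (u_BA q) p,
    mul_pow_of_mul_eq_smul (u_CA q) p, ← pow_succ', hn, ((commute_u_DA q).pow_right p).eq,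
    smul_mul_assoc, smul_mul_assoc, mul_assoc, mul_assoc, mul_assoc, hn.D_mul, hZ, mul_add,
    pairing_smul_apply, pairing_smul_apply, pairing_add_apply, hZ0, ← pow_succ'] at e2
  have hq : qc q ≠ 0 := q_ne q
  have hne : ((qc q)⁻¹ ^ p - qc q ^ p) ≠ 0 := by
    have := zpow_neg_sub_zpow_pos q (z := p) (by exact_mod_cast hp)
    rw [zpow_neg, zpow_natCast] at this
    have h2 : (((q : ℝ) ^ p)⁻¹ - (q : ℝ) ^ p : ℂ) ≠ 0 := by exact_mod_cast this.ne'
    simpa [qc] using h2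
  apply mul_left_cancel₀ (mul_ne_zero h₁ hne)
  linear_combination e2 - qc q ^ p * e1

/-- A covariant element of `A` is determined by its restriction to the torus. -/
theorem eq_zero_of_torusNull (h₁ : c₁ ≠ 0) (h₂ : c₂ ≠ 0) {a b a' b' : ℂ}
    (hR : ∀ X, c₁ * pairing q ξ (X * ug q .B) + c₂ * pairing q ξ (X * ug q .C) =
      a * pairing q ξ (X * ug q .A) + b * pairing q ξ (X * ug q .D))
    (hL : ∀ X, c₁ * pairing q ξ (ug q .B * X) + c₂ * pairing q ξ (ug q .C * X) =
      a' * pairing q ξ (ug q .A * X) + b' * pairing q ξ (ug q .D * X))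
    (h0 : TorusNull q ξ 1) : ξ = 0 := by
  -- Powers of `C` are removed by the left relation alone. Applied to `A^p C^m B^n`, it expresses
  -- the value at `A^p C^{m+1} B^n` through lower terms with coefficient `c₂ q^p`, which is nonzero
  -- for every `p`.
  have key : ∀ m n, TorusNull q ξ (ug q .C ^ m * ug q .B ^ n) := by
    intro m
    induction m using Nat.strong_induction_on with | _ m ih => ?_
    intro n
    rcases m with _ | m
    · simpa using torusNull_B_pow h₁ hR hL h0 n
    have hm := ih m (Nat.lt_succ_self m)
    have hlow : ∃ Z, ug q .B * ug q .C ^ m * ug q .B ^ n = ug q .C ^ m * ug q .B ^ (n + 1) + Z ∧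
        TorusNull q ξ Z := by
      rcases m with _ | m
      · exact ⟨0, by simp [pow_succ'], fun p => by rw [mul_zero]; exact (pairing q ξ).ofConv.map_zero⟩
      · obtain ⟨a, b, h⟩ := exists_u_B_mul_C_pow q m
        have hn' := ih m (by omega) n
        refine ⟨_, ?_, ((hn'.A_pow_mul 2).smul a).add ((hn'.D_pow_mul 2).smul b)⟩
        rw [h, pow_succ' (ug q .B) n]
        simp only [add_mul, smul_mul_assoc, mul_assoc, add_assoc]
    obtain ⟨Z, hZ, hZ0⟩ := hlow
    intro p
    obtain ⟨W, hW⟩ : ∃ W, W = ug q .C ^ m * ug q .B ^ n := ⟨_, rfl⟩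
    have hWn : TorusNull q ξ W := hW ▸ hm n
    have e2 := hL (ug q .A ^ p * W)
    rw [← mul_assoc, ← mul_assoc, ← mul_assoc, ← mul_assoc, mul_pow_of_mul_eq_smul (u_BA q) p,
      mul_pow_of_mul_eq_smul (u_CA q) p, ← pow_succ', hWn, ((commute_u_DA q).pow_right p).eq,
      smul_mul_assoc, smul_mul_assoc, mul_assoc, mul_assoc, mul_assoc, hWn.D_mul, hW,
      ← mul_assoc (ug q .B), hZ, mul_add, pairing_smul_apply, pairing_smul_apply,
      pairing_add_apply, hZ0, hm (n + 1), ← mul_assoc (ug q .C), ← pow_succ'] at e2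
    apply mul_left_cancel₀ (mul_ne_zero h₂ (pow_ne_zero p (q_ne q)))
    linear_combination e2
  apply pairing_injective q
  rw [map_zero]
  apply WithConv.ofConv_injective
  refine LinearMap.ext_on (uMon_span q) ?_
  rintro _ ⟨⟨p, r, m, n⟩, rfl⟩
  have := ((key m n).D_pow_mul r) p
  simp only [uMon, mul_assoc]
  exact this

end Torus

/-! ### Twisted primitive elements and covariance -/

section Covariance
variable (q : Set.Ioo (0 : ℝ) 1)

/-- A twisted primitive element: `Δ Y = A ⊗ Y + Y ⊗ D`. -/
def twPrim (s : ℂ) : Uq q :=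
  (Complex.I * qpow q (1 / 2)) • ug q .B - (Complex.I * (qpow q (1 / 2))⁻¹) • ug q .C +
    s • (ug q .A - ug q .D)

theorem uComul_twPrim (s : ℂ) : uComul q (twPrim q s) =
    ug q .A ⊗ₜ twPrim q s + twPrim q s ⊗ₜ ug q .D := by
  simp only [twPrim, map_add, map_sub, map_smul, uComul, uLift_ug, uComulGen,
    TensorProduct.tmul_add, TensorProduct.add_tmul, TensorProduct.tmul_sub,
    TensorProduct.sub_tmul, TensorProduct.tmul_smul, ← TensorProduct.smul_tmul', smul_add, smul_sub]
  abel

theorem uCounit_twPrim (s : ℂ) : uCounit q (twPrim q s) = 0 := by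
  simp [twPrim, uCounit]

/-- The eigenvalue equations `Y_s.ξ = l D.ξ` and `ξ.Y_t = m ξ.D`. -/
structure Covariant (s t l m : ℂ) (ξ : Aq q) : Prop where
  right : ∀ X, pairing q ξ (X * twPrim q s) = l * pairing q ξ (X * ug q .D)
  left : ∀ X, pairing q ξ (twPrim q t * X) = m * pairing q ξ (ug q .D * X)

theorem pairing_mul_apply (ξ η : Aq q) (X : Uq q) : pairing q (ξ * η) X =
    LinearMap.mul' ℂ ℂ (TensorProduct.map (pairing q ξ).ofConv (pairing q η).ofConv
      (uComul q X)) := by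
  rw [map_mul]; rfl

variable {q} {s t l m l' m' : ℂ} {ξ η : Aq q}

/-- In `Δ Y = A ⊗ Y + Y ⊗ D` the first term dies on `η`, whose eigenvalues are zero, and the second
reproduces the eigenvalue of `ξ` because `D` is grouplike. The asymmetry is why polynomials in `ρ`
stand to the right of `b`. -/
theorem Covariant.mul (hξ : Covariant q s t l m ξ) (hη : Covariant q s t 0 0 η) :
    Covariant q s t l m (ξ * η) where
  right X := by
    simp only [pairing_mul_apply]
    simp only [map_mul, uComul_twPrim]
    have hD : uComul q (ug q .D) = ug q .D ⊗ₜ ug q .D := by simp [uComul, uComulGen]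
    rw [hD]
    generalize uComul q X = z
    induction z with
    | zero => simp
    | add x y hx hy => simp only [add_mul, map_add, mul_add] at hx hy ⊢; rw [← hx, ← hy]; ring
    | tmul x y =>
      simp only [mul_add, Algebra.TensorProduct.tmul_mul_tmul, map_add, TensorProduct.map_tmul,
        LinearMap.mul'_apply, hξ.right, hη.right]
      ring
  left X := by
    simp only [pairing_mul_apply]
    simp only [map_mul, uComul_twPrim]
    have hD : uComul q (ug q .D) = ug q .D ⊗ₜ ug q .D := by simp [uComul, uComulGen]
    rw [hD]
    generalize uComul q X = z
    induction z with
    | zero => simp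
    | add x y hx hy => simp only [add_mul, map_add, mul_add] at hx hy ⊢; rw [← hx, ← hy]
    | tmul x y =>
      simp only [add_mul, Algebra.TensorProduct.tmul_mul_tmul, map_add, TensorProduct.map_tmul,
        LinearMap.mul'_apply, hξ.left, hη.left]
      ring

theorem Covariant.add (hξ : Covariant q s t l m ξ) (hη : Covariant q s t l m η) :
    Covariant q s t l m (ξ + η) where
  right X := by
    rw [map_add]
    change pairing q ξ _ + pairing q η _ = l * (pairing q ξ _ + pairing q η _)
    rw [hξ.right, hη.right]; ring
  left X := by
    rw [map_add]
    change pairing q ξ _ + pairing q η _ = m * (pairing q ξ _ + pairing q η _)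
    rw [hξ.left, hη.left]; ring

theorem Covariant.smul (c : ℂ) (hξ : Covariant q s t l m ξ) : Covariant q s t l m (c • ξ) where
  right X := by
    rw [map_smul]
    change c * pairing q ξ _ = l * (c * pairing q ξ _)
    rw [hξ.right]; ring
  left X := by
    rw [map_smul]
    change c * pairing q ξ _ = m * (c * pairing q ξ _)
    rw [hξ.left]; ring

variable (q s t) in
theorem Covariant.one : Covariant q s t 0 0 1 where
  right X := by simp only [pairing_one, map_mul, uCounit_twPrim, mul_zero, zero_mul]
  left X := by simp only [pairing_one, map_mul, uCounit_twPrim, mul_zero, zero_mul]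

theorem Covariant.aeval (hξ : Covariant q s t 0 0 ξ) (P : Polynomial ℂ) :
    Covariant q s t 0 0 (Polynomial.aeval ξ P) := by
  have hpow : ∀ n, Covariant q s t 0 0 (ξ ^ n) := by
    intro n
    induction n with
    | zero => rw [pow_zero]; exact Covariant.one q s t
    | succ n ih => rw [pow_succ]; exact ih.mul hξ
  induction P using Polynomial.induction_on' with
  | add p r hp hr => rw [map_add]; exact hp.add hr
  | monomial n a =>
    rw [Polynomial.aeval_monomial, ← Algebra.smul_def]
    exact (hpow n).smul a

variable (q) in
theorem pairing_sub_apply (ξ : Aq q) (X Y : Uq q) :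
    pairing q ξ (X - Y) = pairing q ξ X - pairing q ξ Y := (pairing q ξ).ofConv.map_sub X Y

/-- Expanding `twPrim` turns the eigenvalue equations into relations between `B`, `C` and the torus
whose `B` and `C` coefficients are nonzero, as `eq_zero_of_torusNull` requires. This is the
principle that reduces the theorem to torus values. -/
theorem Covariant.eq_zero (hξ : Covariant q s t l m ξ)
    (h0 : ∀ p : ℕ, pairing q ξ (ug q .A ^ p) = 0) : ξ = 0 := by
  have hq := qpow_ne_zero q (1 / 2)
  refine eq_zero_of_torusNull (c₁ := Complex.I * qpow q (1 / 2))
    (c₂ := -(Complex.I * (qpow q (1 / 2))⁻¹)) (a := -s) (b := s + l) (a' := -t) (b' := t + m)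
    (mul_ne_zero Complex.I_ne_zero hq)
    (neg_ne_zero.2 (mul_ne_zero Complex.I_ne_zero (inv_ne_zero hq))) (fun X => ?_) (fun X => ?_)
    (fun p => by rw [mul_one, h0])
  · have h := hξ.right X
    simp only [twPrim, mul_add, mul_sub, mul_smul_comm, pairing_sub_apply,
      pairing_add_apply, pairing_smul_apply] at h
    linear_combination h
  · have h := hξ.left X
    simp only [twPrim, add_mul, sub_mul, smul_mul_assoc, pairing_sub_apply,
      pairing_add_apply, pairing_smul_apply] at h
    linear_combination h

/-- `q^x - q^{-x}`. -/
def qdiff (q : Set.Ioo (0 : ℝ) 1) (x : ℝ) : ℝ := (q : ℝ) ^ x - (q : ℝ) ^ (-x)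

variable (q) in
theorem pairing_agMat_mul_agMat (i j k l : Fin 2) (X : Uq q) :
    pairing q (agMat q i j * agMat q k l) X = entry₂ i j k l (fundSq q X) := by
  rw [map_mul, pairing_agMat, pairing_agMat, entry_mul]

variable (q) in
theorem pairing_rho (τ σ : ℝ) (X : Uq q) : pairing q (rho q τ σ) X = (1 / 2 : ℂ) *
    (entry₂ 0 0 0 0 (fundSq q X) + entry₂ 1 1 1 1 (fundSq q X) +
      qc q * entry₂ 1 0 1 0 (fundSq q X) + (qc q)⁻¹ * entry₂ 0 1 0 1 (fundSq q X) -
      Complex.I * qdiff q σ * (qc q * entry₂ 1 1 1 0 (fundSq q X) + entry₂ 0 1 0 0 (fundSq q X)) +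
      Complex.I * qdiff q τ * (entry₂ 1 1 0 1 (fundSq q X) + qc q * entry₂ 1 0 0 0 (fundSq q X)) +
      qdiff q σ * qdiff q τ * entry₂ 0 1 1 0 (fundSq q X)) := by
  simp only [← pairing_agMat_mul_agMat]
  rw [rho]
  change pairL q X _ = _
  simp only [map_add, map_sub, map_smul, sq]
  simp only [pairL, LinearMap.coe_mk, AddHom.coe_mk, smul_eq_mul, agMat, Matrix.of_apply,
    Matrix.cons_val', Matrix.cons_val_zero, Matrix.cons_val_one, Matrix.cons_val_fin_one]
  simp only [qdiff, qpow]
  push_cast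
  ring

variable (q) in
theorem entry₂_βγ (X : Uq q) : entry₂ 0 1 1 0 (fundSq q X) = entry₂ 1 0 0 1 (fundSq q X) := by
  rw [← pairing_agMat_mul_agMat, ← pairing_agMat_mul_agMat]
  have h : agMat q 0 1 * agMat q 1 0 = agMat q 1 0 * agMat q 0 1 := a_βγ q
  rw [h]

variable (q) in
theorem entry₂_fundSq_twPrim (i j k l : Fin 2) (s : ℂ) : entry₂ i j k l (fundSq q (twPrim q s)) =
    (fundGen q .A i j * fund q (twPrim q s) k l + fund q (twPrim q s) i j * fundGen q .D k l) := by
  rw [fundSq, AlgHom.comp_apply, uComul_twPrim]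
  simp [entry₂, fund]

variable (q) in
theorem fund_twPrim (s : ℂ) : fund q (twPrim q s) =
    !![s * (qpow q (1 / 2) - (qpow q (1 / 2))⁻¹), Complex.I * qpow q (1 / 2);
      -(Complex.I * (qpow q (1 / 2))⁻¹), -(s * (qpow q (1 / 2) - (qpow q (1 / 2))⁻¹))] := by
  rw [twPrim]
  simp only [map_add, map_sub, map_smul]
  simp only [fund, uLift_ug, fundGen, qpow_neg_half]
  ext i j
  fin_cases i <;> fin_cases j <;> simp
  ring

-- Since `ρ` is quadratic in the generators, both equations are linear identities among the entries
-- of the tensor square of the two-dimensional representation.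
variable (q) in
theorem covariant_rho (τ σ : ℝ) : Covariant q (qdiff q σ / ((q : ℝ)⁻¹ - q : ℝ))
    (qdiff q τ / ((q : ℝ)⁻¹ - q : ℝ)) 0 0 (rho q τ σ) := by
  have hq := qpow_ne_zero q (1 / 2)
  have h4 := qpow_half_four_sub_one_ne q
  have hc : (((q : ℝ)⁻¹ - q : ℝ) : ℂ) = (qpow q (1 / 2) ^ 2)⁻¹ - qpow q (1 / 2) ^ 2 := by
    rw [← qc_eq_sq, qc]; push_cast; rfl
  have hc0 : (((q : ℝ)⁻¹ - q : ℝ) : ℂ) ≠ 0 := by exact_mod_cast (inv_sub_pos q).ne'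
  constructor
  · intro X
    -- Here the row indices belong to `X`. Writing `βγ` as `γβ` gives this term the rows `(1, 0)` of
    -- `δβ` and `γα`, so that the terms can cancel.
    rw [zero_mul, pairing_rho, entry₂_βγ]
    simp only [map_mul, entry₂_mul, Fin.sum_univ_two, entry₂_fundSq_twPrim, fund_twPrim, fundGen,
      qpow_neg_half, qc_eq_sq]
    rw [hc] at hc0 ⊢
    generalize qpow q (1 / 2) = x at *
    have hs : (x ^ 2)⁻¹ - x ^ 2 = -((x ^ 4 - 1) / x ^ 2) := by field_simp; ring
    simp
    rw [hs]
    field_simp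
    ring_nf
    simp only [Complex.I_sq]
    ring_nf
  · intro X
    rw [zero_mul, pairing_rho]
    simp only [map_mul, entry₂_mul, Fin.sum_univ_two, entry₂_fundSq_twPrim, fund_twPrim, fundGen,
      qpow_neg_half, qc_eq_sq]
    rw [hc] at hc0 ⊢
    generalize qpow q (1 / 2) = x at *
    have hs : (x ^ 2)⁻¹ - x ^ 2 = -((x ^ 4 - 1) / x ^ 2) := by field_simp; ring
    simp
    rw [hs]
    field_simp
    ring_nf
    simp only [Complex.I_sq]
    ring_nf

end Covariance

/-! ### Dual `q`-Krawtchouk polynomials -/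

section Krawtchouk

theorem qPoch_zero (a Q : ℝ) : qPoch a Q 0 = 1 := by simp [qPoch]

theorem qPoch_succ (a Q : ℝ) (k : ℕ) : qPoch a Q (k + 1) = qPoch a Q k * (1 - a * Q ^ k) := by
  simp [qPoch, Finset.prod_range_succ]

theorem qPoch_succ' (a Q : ℝ) (k : ℕ) : qPoch a Q (k + 1) = (1 - a) * qPoch (a * Q) Q k := by
  simp only [qPoch, Finset.prod_range_succ', pow_zero, mul_one]
  rw [mul_comm]
  congr 1
  exact Finset.prod_congr rfl fun r _ => by rw [pow_succ']; ring

theorem qPoch_zero_left (Q : ℝ) (k : ℕ) : qPoch 0 Q k = 1 := by simp [qPoch]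

variable {Q : ℝ}

theorem qPoch_zpow_neg_eq_zero (hQ : Q ≠ 0) {n k : ℕ} (h : n < k) :
    qPoch (Q ^ (-(n : ℤ))) Q k = 0 :=
  Finset.prod_eq_zero (Finset.mem_range.2 h) (by simp [hQ])

theorem qPoch_zpow_neg_ne_zero (hQ : 0 < Q) (hQ1 : Q < 1) {n k : ℕ} (h : k ≤ n) :
    qPoch (Q ^ (-(n : ℤ))) Q k ≠ 0 := by
  refine Finset.prod_ne_zero_iff.2 fun r hr => ?_
  have hr := Finset.mem_range.1 hr
  rw [← zpow_natCast, ← zpow_add₀ hQ.ne', sub_ne_zero]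
  exact (one_lt_zpow_of_neg₀ hQ hQ1 (by omega)).ne

theorem qPoch_self_pos (hQ : 0 < Q) (hQ1 : Q < 1) (k : ℕ) : 0 < qPoch Q Q k := by
  refine Finset.prod_pos fun r _ => ?_
  rw [← pow_succ', sub_pos]
  exact pow_lt_one₀ hQ.le hQ1 (by omega)

/-- At `n = 0` the truncated `n - 1` is harmless, because the factor `1 - Q^n` vanishes. The
recurrences below rely on this to hold uniformly in `n`. -/
theorem one_sub_pow_mul_qPoch (hQ : Q ≠ 0) (n k : ℕ) :
    (1 - Q ^ n) * qPoch (Q ^ (-((n - 1 : ℕ) : ℤ))) Q k =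
      -Q ^ n * qPoch (Q ^ (-(n : ℤ))) Q (k + 1) := by
  rcases n with _ | n
  · rw [qPoch_zpow_neg_eq_zero hQ (n := 0) (k := k + 1) (by omega)]; simp
  · rw [qPoch_succ']
    have h : Q ^ (-((n + 1 : ℕ) : ℤ)) * Q = Q ^ (-((n + 1 - 1 : ℕ) : ℤ)) := by
      rw [← zpow_add_one₀ hQ]; congr 1; push_cast; omega
    have e : Q ^ (n + 1) * Q ^ (-((n + 1 : ℕ) : ℤ)) = 1 := by
      rw [zpow_neg, zpow_natCast, mul_inv_cancel₀ (pow_ne_zero _ hQ)]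
    rw [h]
    linear_combination -qPoch (Q ^ (-((n + 1 - 1 : ℕ) : ℤ))) Q k * e

/-- The coefficients of `₃φ₂(Q^{-n}, a, b; D, 0; Q, Q)` with respect to `(a, b; Q)_k`. -/
def krawCoeff (D Q : ℝ) (n k : ℕ) : ℝ :=
  qPoch (Q ^ (-(n : ℤ))) Q k / (qPoch D Q k * qPoch Q Q k) * Q ^ k

theorem krawCoeff_eq_zero (D : ℝ) (hQ : Q ≠ 0) {n k : ℕ} (h : n < k) : krawCoeff D Q n k = 0 := by
  rw [krawCoeff, qPoch_zpow_neg_eq_zero hQ h, zero_div, zero_mul]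

/-- This is the coefficient of `(a, b; Q)_{j+1}` in the three-term recurrence, with `z = ab`.
Multiplication by `a + b` is two-term on this basis because `(1 - aQ^k)(1 - bQ^k) = 1 - (a + b) Q^k
+ ab Q^{2k}`, which accounts for the right-hand side. -/
theorem krawCoeff_rec {D : ℝ} (hQ : 0 < Q) (hQ1 : Q < 1) (n j : ℕ) (hD : qPoch D Q (j + 1) ≠ 0)
    (z : ℝ) :
    (Q ^ n * D - 1) * krawCoeff D Q (n + 1) (j + 1) - (D + z) * Q ^ n * krawCoeff D Q n (j + 1) +
      (Q ^ (j + 1))⁻¹ * (1 + z * Q ^ (2 * (j + 1))) * krawCoeff D Q n (j + 1) -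
      z * ((1 - Q ^ n) * krawCoeff D Q (n - 1) (j + 1)) = (Q ^ j)⁻¹ * krawCoeff D Q n j := by
  have h1 : (1 - Q ^ n) * krawCoeff D Q (n - 1) (j + 1) =
      ((1 - Q ^ n) * qPoch (Q ^ (-((n - 1 : ℕ) : ℤ))) Q (j + 1)) /
        (qPoch D Q (j + 1) * qPoch Q Q (j + 1)) * Q ^ (j + 1) := by
    rw [krawCoeff]; ring
  have h2 : qPoch (Q ^ (-((n + 1 : ℕ) : ℤ))) Q (j + 1) =
      (1 - (Q ^ n * Q)⁻¹) * qPoch (Q ^ (-(n : ℤ))) Q j := by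
    rw [qPoch_succ']
    have h : Q ^ (-((n + 1 : ℕ) : ℤ)) * Q = Q ^ (-(n : ℤ)) := by
      rw [← zpow_add_one₀ hQ.ne']; congr 1; push_cast; omega
    rw [h, zpow_neg, zpow_natCast, pow_succ]
  have hq' := (qPoch_self_pos hQ hQ1 (j + 1)).ne'
  rw [h1, one_sub_pow_mul_qPoch hQ.ne']
  simp only [krawCoeff, h2]
  simp only [qPoch_succ] at hD hq' ⊢
  have hD1 := left_ne_zero_of_mul hD
  have hD2 := right_ne_zero_of_mul hD
  have hq1 := left_ne_zero_of_mul hq'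
  have hq2 := right_ne_zero_of_mul hq'
  simp only [zpow_neg, zpow_natCast, pow_succ, pow_mul, pow_zero, one_mul, mul_pow]
  have hu : Q ^ n ≠ 0 := pow_ne_zero n hQ.ne'
  have hw : Q ^ j ≠ 0 := pow_ne_zero j hQ.ne'
  have hQ0 := hQ.ne'
  generalize qPoch (Q ^ n)⁻¹ Q j = P at *
  generalize qPoch D Q j = Pd at *
  generalize qPoch Q Q j = Pq at *
  generalize Q ^ n = u at *
  have e : ((Q * Q) ^ j) = Q ^ j * Q ^ j := mul_pow _ _ _
  simp only [e] at *
  generalize Q ^ j = w at *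
  field_simp
  ring

theorem krawCoeff_rec_zero {D : ℝ} (n : ℕ) (z : ℝ) :
    (Q ^ n * D - 1) * krawCoeff D Q (n + 1) 0 - (D + z) * Q ^ n * krawCoeff D Q n 0 +
      (1 + z) * krawCoeff D Q n 0 - z * ((1 - Q ^ n) * krawCoeff D Q (n - 1) 0) = 0 := by
  simp only [krawCoeff, qPoch_zero]
  ring

/-- The polynomial `₃φ₂(Q^{-n}, a, b; D, 0; Q, Q)`. -/
def kraw (a b D Q : ℝ) (n : ℕ) : ℝ :=
  ∑ k ∈ Finset.range (n + 1), krawCoeff D Q n k * (qPoch a Q k * qPoch b Q k)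

theorem kraw_eq_sum (a b D : ℝ) (hQ : Q ≠ 0) {n K : ℕ} (h : n + 1 ≤ K) :
    kraw a b D Q n = ∑ k ∈ Finset.range K, krawCoeff D Q n k * (qPoch a Q k * qPoch b Q k) := by
  refine Finset.sum_subset (Finset.range_mono h) fun k _ hk => ?_
  rw [krawCoeff_eq_zero D hQ (by simpa using hk), zero_mul]

/-- Summing `krawCoeff_rec` telescopes. All sums are truncated at the same `K`, which isolates one
boundary term and keeps the denominators nonzero; at `K = N` the boundary term vanishes when `(a, b;
Q)_{N+1} = 0`. -/
theorem kraw_partial_sum (a b : ℝ) {D : ℝ} (hQ : 0 < Q) (hQ1 : Q < 1) (n K : ℕ)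
    (hD : qPoch D Q K ≠ 0) :
    (Q ^ n * D - 1) * ∑ k ∈ Finset.range (K + 1),
        krawCoeff D Q (n + 1) k * (qPoch a Q k * qPoch b Q k) -
      ((D + a * b) * Q ^ n - (a + b)) * ∑ k ∈ Finset.range (K + 1),
        krawCoeff D Q n k * (qPoch a Q k * qPoch b Q k) -
      a * b * (1 - Q ^ n) * ∑ k ∈ Finset.range (K + 1),
        krawCoeff D Q (n - 1) k * (qPoch a Q k * qPoch b Q k) =
    -((Q ^ K)⁻¹ * krawCoeff D Q n K * (qPoch a Q (K + 1) * qPoch b Q (K + 1))) := by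
  induction K with
  | zero =>
    have h := krawCoeff_rec_zero (D := D) (Q := Q) n (a * b)
    simp only [zero_add, Finset.sum_range_one, qPoch_succ, qPoch_zero, pow_zero]
    linear_combination h
  | succ K ih =>
    have h := krawCoeff_rec hQ hQ1 n K hD (a * b)
    have ih := ih (by rw [qPoch_succ] at hD; exact left_ne_zero_of_mul hD)
    simp only [Finset.sum_range_succ _ (K + 1)]
    have e : ∀ X Y Z x y z A B C : ℝ, A * (X + x) - B * (Y + y) - C * (Z + z) =
        (A * X - B * Y - C * Z) + (A * x - B * y - C * z) := by intros; ring
    rw [e, ih]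
    have hw : Q ^ (K + 1) ≠ 0 := pow_ne_zero _ hQ.ne'
    simp only [qPoch_succ _ _ (K + 1)]
    have h2 : Q ^ (2 * (K + 1)) = Q ^ (K + 1) * Q ^ (K + 1) := by rw [two_mul, pow_add]
    rw [h2] at h
    rw [show qPoch a Q (K + 1) = qPoch a Q K * (1 - a * Q ^ K) from qPoch_succ _ _ _,
      show qPoch b Q (K + 1) = qPoch b Q K * (1 - b * Q ^ K) from qPoch_succ _ _ _]
    generalize Q ^ (K + 1) = w at *
    have h3 : w⁻¹ * w = 1 := inv_mul_cancel₀ hw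
    linear_combination ((qPoch a Q K * (1 - a * Q ^ K)) * (qPoch b Q K * (1 - b * Q ^ K))) * h -
      (a + b) * krawCoeff D Q n (K + 1) *
      ((qPoch a Q K * (1 - a * Q ^ K)) * (qPoch b Q K * (1 - b * Q ^ K))) * h3

/-- The three-term recurrence relation for the dual `q`-Krawtchouk polynomials. -/
theorem kraw_rec (a b : ℝ) (hQ : 0 < Q) (hQ1 : Q < 1) {n N : ℕ} (hn : n ≤ N)
    (hN : qPoch a Q (N + 1) * qPoch b Q (N + 1) = 0) :
    (Q ^ n * Q ^ (-(N : ℤ)) - 1) * kraw a b (Q ^ (-(N : ℤ))) Q (n + 1) =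
      ((Q ^ (-(N : ℤ)) + a * b) * Q ^ n - (a + b)) * kraw a b (Q ^ (-(N : ℤ))) Q n +
        a * b * (1 - Q ^ n) * kraw a b (Q ^ (-(N : ℤ))) Q (n - 1) := by
  have h := kraw_partial_sum a b hQ hQ1 n N (qPoch_zpow_neg_ne_zero hQ hQ1 le_rfl)
  rw [hN, mul_zero, neg_zero, ← kraw_eq_sum a b _ hQ.ne' (n := n) (by omega),
    ← kraw_eq_sum a b _ hQ.ne' (n := n - 1) (by omega)] at h
  rcases hn.lt_or_eq with hlt | rfl
  · rw [← kraw_eq_sum a b _ hQ.ne' (by omega)] at h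
    linear_combination h
  -- For `n = N` the polynomial of degree `N + 1` has a vanishing denominator, but its coefficient
  -- in the recurrence is zero.
  · have e : Q ^ n * Q ^ (-(n : ℤ)) - 1 = 0 := by
      rw [zpow_neg, zpow_natCast, mul_inv_cancel₀ (pow_ne_zero _ hQ.ne'), sub_self]
    rw [e] at h ⊢
    linear_combination h

theorem dualQKrawtchouk_eq_kraw (n x : ℕ) (c : ℝ) (N : ℕ) : dualQKrawtchouk n x c N Q =
    kraw (Q ^ (-(x : ℤ))) (-(Q ^ ((x : ℤ) - N)) / c) (Q ^ (-(N : ℤ))) Q n := by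
  rw [dualQKrawtchouk, kraw]
  refine Finset.sum_congr rfl fun k _ => ?_
  rw [krawCoeff, qPoch_zero_left]
  ring

theorem dualQKrawtchouk_rec (hQ : 0 < Q) (hQ1 : Q < 1) {c : ℝ} (hc : c ≠ 0) {n x N : ℕ}
    (hn : n ≤ N) (hx : x ≤ N) :
    (Q ^ n - Q ^ N) * dualQKrawtchouk (n + 1) x c N Q =
      ((1 - c⁻¹) * Q ^ n - Q ^ (N - x) + Q ^ x / c) * dualQKrawtchouk n x c N Q -
        c⁻¹ * (1 - Q ^ n) * dualQKrawtchouk (n - 1) x c N Q := by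
  simp only [dualQKrawtchouk_eq_kraw]
  have h := kraw_rec (Q ^ (-(x : ℤ))) (-(Q ^ ((x : ℤ) - N)) / c) hQ hQ1 hn
    (by rw [qPoch_zpow_neg_eq_zero hQ.ne' (by omega), zero_mul])
  have e1 : Q ^ ((x : ℤ) - N) = Q ^ x / Q ^ N := by rw [zpow_sub₀ hQ.ne']; simp
  have e2 : Q ^ (N - x) = Q ^ N / Q ^ x := by
    rw [eq_div_iff (pow_ne_zero _ hQ.ne'), ← pow_add]; congr 1; omega
  rw [e1] at h ⊢
  rw [e2]
  simp only [zpow_neg, zpow_natCast] at h ⊢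
  have h1 : Q ^ N ≠ 0 := pow_ne_zero _ hQ.ne'
  have h2 : Q ^ x ≠ 0 := pow_ne_zero _ hQ.ne'
  generalize kraw _ _ _ _ (n + 1) = R at *
  generalize kraw _ _ _ _ (n - 1) = R' at *
  generalize kraw _ _ _ _ n = R'' at *
  field_simp at h ⊢
  linear_combination h

/-- Both sides satisfy the same three-term recurrence in `n`, whose leading coefficient `Q^n - Q^N`
is nonzero for `n < N`. -/
theorem dualQKrawtchouk_flip (hQ : 0 < Q) (hQ1 : Q < 1) {c : ℝ} (hc : c ≠ 0) {n x N : ℕ}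
    (hn : n ≤ N) (hx : x ≤ N) :
    dualQKrawtchouk n (N - x) c⁻¹ N Q = (-c) ^ n * dualQKrawtchouk n x c N Q := by
  induction n using Nat.strong_induction_on with | _ n ih => ?_
  rcases n with _ | n
  · simp [dualQKrawtchouk, qPoch_zero]
  have h1 := dualQKrawtchouk_rec hQ hQ1 (inv_ne_zero hc) (n := n) (x := N - x) (N := N)
    (by omega) (by omega)
  have h2 := dualQKrawtchouk_rec hQ hQ1 hc (n := n) (x := x) (N := N) (by omega) hx
  have hne : Q ^ n - Q ^ N ≠ 0 := by
    rw [sub_ne_zero]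
    exact (pow_lt_pow_right_of_lt_one₀ hQ hQ1 (by omega)).ne'
  apply mul_left_cancel₀ hne
  rw [h1, ih n (by omega) (by omega), show N - (N - x) = x by omega, inv_inv, mul_left_comm (Q ^ n - Q ^ N), h2]
  rcases n with _ | n
  · simp; field_simp; ring
  · rw [ih (n + 1 - 1) (by omega) (by omega)]
    simp only [Nat.add_sub_cancel, pow_succ]
    field_simp
    ring

end Krawtchouk

/-! ### The eigenvectors `v^{l,j}(σ)` -/

section Rep
variable (q : Set.Ioo (0 : ℝ) 1) (L : ℕ)

theorem ladder_zero : ladder q L 0 = 0 := by simp [ladder]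

theorem ladder_succ_self : ladder q L (L + 1) = 0 := by simp [ladder]

variable (v : ℕ → ℂ) (k : Fin (L + 1))

/-- Components are indexed by all of `ℕ`. The truncated index at `k = 0`, and the overflow at `k =
L` in the companion lemma for `C`, are multiplied by vanishing ladder coefficients. -/
theorem repGen_B_mulVec : Matrix.mulVec (repGen q L .B) (fun a => v a) k =
    ladder q L k * v (k - 1) := by
  simp only [repGen, Matrix.mulVec, dotProduct, Matrix.of_apply]
  rcases Nat.eq_zero_or_pos (k : ℕ) with h | h
  · rw [h, ladder_zero, Complex.ofReal_zero, zero_mul]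
    exact Finset.sum_eq_zero fun b _ => by rw [if_neg (by omega), zero_mul]
  · rw [Finset.sum_eq_single ⟨k - 1, by omega⟩]
    · rw [if_pos (by simp only; omega)]
      congr 3
      simp only; omega
    · intro b _ hb
      rw [if_neg, zero_mul]
      intro h'; apply hb; apply Fin.ext; simp only; omega
    · simp

theorem repGen_C_mulVec : Matrix.mulVec (repGen q L .C) (fun a => v a) k =
    ladder q L (k + 1) * v (k + 1) := by
  simp only [repGen, Matrix.mulVec, dotProduct, Matrix.of_apply]
  rcases (Nat.lt_succ_iff.1 k.2).eq_or_lt with h | h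
  · rw [h, ladder_succ_self, Complex.ofReal_zero, zero_mul]
    exact Finset.sum_eq_zero fun b _ => by rw [if_neg (by omega), zero_mul]
  · rw [Finset.sum_eq_single ⟨k + 1, by omega⟩]
    · rw [if_pos rfl]
    · intro b _ hb
      rw [if_neg, zero_mul]
      intro h'; apply hb; apply Fin.ext; simp only; omega
    · simp

theorem vecMul_repGen_B : Matrix.vecMul (fun a : Fin (L + 1) => v a) (repGen q L .B) k =
    ladder q L (k + 1) * v (k + 1) := by
  have h : repGen q L .B = (repGen q L .C).transpose := by
    ext a b; simp only [repGen, Matrix.transpose_apply, Matrix.of_apply]; split_ifs with h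
    · rw [h]
    · rfl
  rw [h, Matrix.vecMul_transpose, repGen_C_mulVec]

theorem vecMul_repGen_C : Matrix.vecMul (fun a : Fin (L + 1) => v a) (repGen q L .C) k =
    ladder q L k * v (k - 1) := by
  have h : repGen q L .C = (repGen q L .B).transpose := by
    ext a b; simp only [repGen, Matrix.transpose_apply, Matrix.of_apply]; split_ifs with h
    · rw [h]
    · rfl
  rw [h, Matrix.vecMul_transpose, repGen_B_mulVec]

theorem repGen_A_mulVec : Matrix.mulVec (repGen q L .A) (fun a => v a) k =
    qpow q ((k : ℕ) - (L : ℝ) / 2) * v k := by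
  rw [repGen, Matrix.mulVec_diagonal, neg_sub]

theorem repGen_D_mulVec : Matrix.mulVec (repGen q L .D) (fun a => v a) k =
    qpow q ((L : ℝ) / 2 - (k : ℕ)) * v k := by
  rw [repGen, Matrix.mulVec_diagonal]

theorem vecMul_repGen_A : Matrix.vecMul (fun a : Fin (L + 1) => v a) (repGen q L .A) k =
    qpow q ((k : ℕ) - (L : ℝ) / 2) * v k := by
  rw [repGen, Matrix.vecMul_diagonal, neg_sub, mul_comm]

theorem vecMul_repGen_D : Matrix.vecMul (fun a : Fin (L + 1) => v a) (repGen q L .D) k =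
    qpow q ((L : ℝ) / 2 - (k : ℕ)) * v k := by
  rw [repGen, Matrix.vecMul_diagonal, mul_comm]

end Rep

/-! ### Three-term recurrence for the components of the eigenvectors. -/

section Eigenvectors
variable (q : Set.Ioo (0 : ℝ) 1)

/-- The `q²`-binomial weight `(q^{4l}; q^{-2})_k / (q²; q²)_k`. -/
def binomWeight (L k : ℕ) : ℝ :=
  qPoch ((q : ℝ) ^ (2 * L)) ((q : ℝ) ^ 2)⁻¹ k / qPoch ((q : ℝ) ^ 2) ((q : ℝ) ^ 2) k

theorem sq_pos_lt_one : 0 < (q : ℝ) ^ 2 ∧ (q : ℝ) ^ 2 < 1 :=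
  ⟨pow_pos q.2.1 2, pow_lt_one₀ q.2.1.le q.2.2 two_ne_zero⟩

theorem binomWeight_succ {L k : ℕ} (hk : k < L) : binomWeight q L (k + 1) *
    (1 - (q : ℝ) ^ (2 * (k + 1))) = binomWeight q L k * (1 - (q : ℝ) ^ (2 * (L - k))) := by
  have h1 := (qPoch_self_pos (sq_pos_lt_one q).1 (sq_pos_lt_one q).2 (k + 1)).ne'
  simp only [binomWeight, qPoch_succ] at h1 ⊢
  have h2 := left_ne_zero_of_mul h1
  have h3 := right_ne_zero_of_mul h1
  have e1 : (q : ℝ) ^ 2 * ((q : ℝ) ^ 2) ^ k = (q : ℝ) ^ (2 * (k + 1)) := by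
    rw [← pow_succ', ← pow_mul]
  have e2 : (q : ℝ) ^ (2 * L) * (((q : ℝ) ^ 2)⁻¹) ^ k = (q : ℝ) ^ (2 * (L - k)) := by
    rw [inv_pow, ← pow_mul, ← div_eq_mul_inv, div_eq_iff (pow_ne_zero _ q.2.1.ne'), ← pow_add]
    congr 1; omega
  rw [e1] at h3
  rw [e1, e2]
  field_simp

theorem one_sub_pow_pos {n : ℕ} (hn : n ≠ 0) : 0 < 1 - (q : ℝ) ^ n :=
  sub_pos.2 (pow_lt_one₀ q.2.1.le q.2.2 hn)

theorem binomWeight_pos {L k : ℕ} (hk : k ≤ L) : 0 < binomWeight q L k := by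
  induction k with
  | zero => simp [binomWeight, qPoch_zero]
  | succ k ih =>
    have h := binomWeight_succ q (L := L) (k := k) hk
    have h1 := one_sub_pow_pos q (n := 2 * (k + 1)) (by omega)
    have h2 := one_sub_pow_pos q (n := 2 * (L - k)) (by omega)
    have h3 := mul_pos (ih (by omega)) h2
    rw [← h] at h3
    exact pos_of_mul_pos_left h3 h1.le

/-- The recurrence `e` between neighbouring weights makes the radicand a perfect square times the
other weight. This is how the square roots in the ladder operators are absorbed by those in the
vectors. -/
theorem sqrt_mul_sqrt_eq {w u v h h' : ℝ} (hw : 0 ≤ w) (hu : 0 ≤ u) (hh : 0 ≤ h)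
    (e : h' * u = h * v) : √(w ^ 2 * (u * v)) * √h = √h' * (w * u) := by
  rw [← Real.sqrt_mul' _ hh, show w ^ 2 * (u * v) * h = h' * (w * u) ^ 2 by
    linear_combination (-(w ^ 2 * u)) * e, Real.sqrt_mul' _ (sq_nonneg _),
    Real.sqrt_sq (mul_nonneg hw hu)]

theorem ladder_eq {L k : ℕ} (hk : k < L) : ladder q L (k + 1) =
    √(((q : ℝ) ^ (-((L : ℝ) + 1) / 2)) ^ 2 *
      ((1 - (q : ℝ) ^ (2 * (k + 1))) * (1 - (q : ℝ) ^ (2 * (L - k))))) / ((q : ℝ)⁻¹ - q) := by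
  have h0 := q.2.1.ne'
  obtain ⟨m, rfl⟩ := Nat.exists_eq_add_of_lt hk
  rw [ladder]
  congr 2
  have e1 : ((q : ℝ) ^ (-(((k + m + 1 : ℕ) : ℝ) + 1) / 2)) ^ 2 = ((q : ℝ) ^ (k + m + 2))⁻¹ := by
    rw [← Real.rpow_natCast, ← Real.rpow_mul q.2.1.le, ← Real.rpow_natCast (q : ℝ) (k + m + 2),
      ← Real.rpow_neg q.2.1.le]
    congr 1; push_cast; ring
  have e2 : ((k + m + 1 : ℕ) : ℤ) + 1 - ((k + 1 : ℕ) : ℤ) = ((m + 1 : ℕ) : ℤ) := by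
    push_cast; ring
  rw [e1, e2, show k + m + 1 - k = m + 1 by omega]
  simp only [zpow_neg, zpow_natCast]
  field_simp
  ring

theorem ladder_mul_sqrt_pred {L k : ℕ} (hk : k ≤ L) : ladder q L k * √(binomWeight q L (k - 1)) =
    √(binomWeight q L k) * ((q : ℝ) ^ (-((L : ℝ) + 1) / 2) * (1 - (q : ℝ) ^ (2 * k)) /
      ((q : ℝ)⁻¹ - q)) := by
  rcases k with _ | k
  · simp [ladder_zero]
  · rw [ladder_eq q hk, Nat.add_sub_cancel, div_mul_eq_mul_div, sqrt_mul_sqrt_eq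
      (Real.rpow_nonneg q.2.1.le _) (one_sub_pow_pos q (by omega)).le
      (binomWeight_pos q (by omega)).le
      (binomWeight_succ q hk), mul_div_assoc]

theorem ladder_succ_mul_sqrt_succ {L k : ℕ} (hk : k ≤ L) :
    ladder q L (k + 1) * √(binomWeight q L (k + 1)) =
    √(binomWeight q L k) * ((q : ℝ) ^ (-((L : ℝ) + 1) / 2) * (1 - (q : ℝ) ^ (2 * (L - k))) /
      ((q : ℝ)⁻¹ - q)) := by
  rcases hk.eq_or_lt with rfl | hk
  · simp [ladder_succ_self]
  · rw [ladder_eq q hk, mul_comm (1 - (q : ℝ) ^ (2 * (k + 1))), div_mul_eq_mul_div, sqrt_mul_sqrt_eq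
      (Real.rpow_nonneg q.2.1.le _) (one_sub_pow_pos q (by omega)).le
      (binomWeight_pos q (by omega)).le
      (binomWeight_succ q hk).symm, mul_div_assoc]

/-- The scalar factor of the components of `v^{l,j}(σ)`. -/
def vecScale (L : ℕ) (J : ℤ) (σ : ℝ) (k : ℕ) : ℝ :=
  normC q L J σ * (q : ℝ) ^ (σ * k) * (q : ℝ) ^ ((k : ℝ) * (k - 1) / 2)

theorem vecScale_succ (L : ℕ) (J : ℤ) (σ : ℝ) (k : ℕ) :
    vecScale q L J σ (k + 1) = vecScale q L J σ k * ((q : ℝ) ^ σ * (q : ℝ) ^ k) := by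
  have e1 : (q : ℝ) ^ (σ * ((k + 1 : ℕ) : ℝ)) = (q : ℝ) ^ (σ * k) * (q : ℝ) ^ σ := by
    rw [← Real.rpow_add q.2.1]; congr 1; push_cast; ring
  have e2 : (q : ℝ) ^ (((k + 1 : ℕ) : ℝ) * (((k + 1 : ℕ) : ℝ) - 1) / 2) =
      (q : ℝ) ^ ((k : ℝ) * (k - 1) / 2) * (q : ℝ) ^ k := by
    rw [← Real.rpow_natCast (q : ℝ) k, ← Real.rpow_add q.2.1]; congr 1; push_cast; ring
  rw [vecScale, e1, e2, vecScale]
  ring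

/-- The components of `v^{l,j}(σ)` without the phase factors. -/
def realVec (L : ℕ) (J : ℤ) (σ : ℝ) (k : ℕ) : ℝ :=
  vecScale q L J σ k * √(binomWeight q L k) *
    dualQKrawtchouk k (((L : ℤ) - J) / 2).toNat ((q : ℝ) ^ (2 * σ)) L ((q : ℝ) ^ 2)

theorem vec_eq (L : ℕ) (J : ℤ) (σ : ℝ) :
    vec q L J σ = fun k : Fin (L + 1) =>
      (fun k : ℕ => Complex.I ^ (-(k : ℤ)) * (realVec q L J σ k : ℂ)) k := rfl

theorem ladder_mul_realVec_pred {L k : ℕ} (hk : k ≤ L) (J : ℤ) (σ : ℝ) :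
    ladder q L k * realVec q L J σ (k - 1) = vecScale q L J σ k * √(binomWeight q L k) *
      ((q : ℝ) ^ (-((L : ℝ) + 1) / 2) * (1 - (q : ℝ) ^ (2 * k)) / ((q : ℝ)⁻¹ - q)) *
      ((q : ℝ) / ((q : ℝ) ^ σ * (q : ℝ) ^ k)) *
      dualQKrawtchouk (k - 1) (((L : ℤ) - J) / 2).toNat ((q : ℝ) ^ (2 * σ)) L ((q : ℝ) ^ 2) := by
  have h := ladder_mul_sqrt_pred q hk
  rcases k with _ | k
  · simp [ladder_zero]
  · have h1 := q.2.1.ne'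
    have h2 := (Real.rpow_pos_of_pos q.2.1 σ).ne'
    have e : ((q : ℝ) ^ σ * (q : ℝ) ^ k) * ((q : ℝ) / ((q : ℝ) ^ σ * (q : ℝ) ^ (k + 1))) = 1 := by
      rw [pow_succ]; field_simp
    rw [realVec, vecScale_succ]
    simp only [Nat.add_sub_cancel] at h ⊢
    linear_combination (vecScale q L J σ k * dualQKrawtchouk k (((L : ℤ) - J) / 2).toNat
      ((q : ℝ) ^ (2 * σ)) L ((q : ℝ) ^ 2)) * h - (vecScale q L J σ k * dualQKrawtchouk k
      (((L : ℤ) - J) / 2).toNat ((q : ℝ) ^ (2 * σ)) L ((q : ℝ) ^ 2) * (√(binomWeight q L (k + 1)) *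
      ((q : ℝ) ^ (-((L : ℝ) + 1) / 2) * (1 - (q : ℝ) ^ (2 * (k + 1))) / ((q : ℝ)⁻¹ - q)))) * e

theorem ladder_mul_realVec_succ {L k : ℕ} (hk : k ≤ L) (J : ℤ) (σ : ℝ) :
    ladder q L (k + 1) * realVec q L J σ (k + 1) = vecScale q L J σ k * √(binomWeight q L k) *
      ((q : ℝ) ^ (-((L : ℝ) + 1) / 2) * (1 - (q : ℝ) ^ (2 * (L - k))) / ((q : ℝ)⁻¹ - q)) *
      ((q : ℝ) ^ σ * (q : ℝ) ^ k) *
      dualQKrawtchouk (k + 1) (((L : ℤ) - J) / 2).toNat ((q : ℝ) ^ (2 * σ)) L ((q : ℝ) ^ 2) := by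
  have h := ladder_succ_mul_sqrt_succ q hk
  rw [realVec, vecScale_succ]
  linear_combination (vecScale q L J σ k * ((q : ℝ) ^ σ * (q : ℝ) ^ k) *
    dualQKrawtchouk (k + 1) (((L : ℤ) - J) / 2).toNat ((q : ℝ) ^ (2 * σ)) L ((q : ℝ) ^ 2)) * h

/-- `J = L - 2x` with `0 ≤ x ≤ L`. -/
def IsWeight (L : ℕ) (J : ℤ) : Prop := ∃ x : ℕ, x ≤ L ∧ J = L - 2 * x

/-- Once the square roots are removed, this is the dual `q`-Krawtchouk recurrence in `k` at `x = (L
- J)/2`. -/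
theorem realVec_eigen {L k : ℕ} (hk : k ≤ L) {J : ℤ} (hJ : IsWeight L J) (σ : ℝ) :
    -((q : ℝ) ^ (-(1 / 2) : ℝ) * (ladder q L k * realVec q L J σ (k - 1))) -
      (q : ℝ) ^ (1 / 2 : ℝ) * (ladder q L (k + 1) * realVec q L J σ (k + 1)) +
      qdiff q σ / ((q : ℝ)⁻¹ - q) *
        ((q : ℝ) ^ ((k : ℝ) - (L : ℝ) / 2) - (q : ℝ) ^ ((L : ℝ) / 2 - k)) * realVec q L J σ k =
      (qdiff q (σ + J) - qdiff q σ) / ((q : ℝ)⁻¹ - q) * (q : ℝ) ^ ((L : ℝ) / 2 - k) *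
        realVec q L J σ k := by
  obtain ⟨x, hx, rfl⟩ := hJ
  have hq := q.2.1
  have hxx : (((L : ℤ) - (L - 2 * x)) / 2).toNat = x := by omega
  have hrec := dualQKrawtchouk_rec (sq_pos_lt_one q).1 (sq_pos_lt_one q).2
    (c := (q : ℝ) ^ (2 * σ)) (Real.rpow_pos_of_pos hq _).ne' hk hx
  rw [ladder_mul_realVec_pred q hk, ladder_mul_realVec_succ q hk, realVec, hxx]
  have hκ := (inv_sub_pos q).ne'
  generalize dualQKrawtchouk (k + 1) _ _ _ _ = R₁ at *
  generalize dualQKrawtchouk (k - 1) _ _ _ _ = R₂ at *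
  generalize dualQKrawtchouk k _ _ _ _ = R₀ at *
  generalize vecScale q L _ σ k * √(binomWeight q L k) = U
  have e1 : (q : ℝ) ^ (2 * σ) = (q : ℝ) ^ σ * (q : ℝ) ^ σ := by
    rw [← Real.rpow_add hq]; congr 1; ring
  have e2 : (q : ℝ) ^ (-((L : ℝ) + 1) / 2) = ((q : ℝ) ^ ((L : ℝ) / 2) * (q : ℝ) ^ (1 / 2 : ℝ))⁻¹ := by
    rw [← Real.rpow_add hq, ← Real.rpow_neg hq.le]; congr 1; ring
  have e3 : (q : ℝ) ^ (-(1 / 2) : ℝ) = ((q : ℝ) ^ (1 / 2 : ℝ))⁻¹ := Real.rpow_neg hq.le _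
  have e4 : (q : ℝ) ^ ((k : ℝ) - (L : ℝ) / 2) = (q : ℝ) ^ k / (q : ℝ) ^ ((L : ℝ) / 2) := by
    rw [Real.rpow_sub hq, Real.rpow_natCast]
  have e5 : (q : ℝ) ^ ((L : ℝ) / 2 - k) = (q : ℝ) ^ ((L : ℝ) / 2) / (q : ℝ) ^ k := by
    rw [Real.rpow_sub hq, Real.rpow_natCast]
  have e6 : (q : ℝ) ^ L = ((q : ℝ) ^ ((L : ℝ) / 2)) ^ 2 := by
    rw [← Real.rpow_natCast, ← Real.rpow_mul_natCast hq.le]; congr 1; push_cast; ring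
  have e7 : (q : ℝ) ^ (2 * (L - k)) = ((q : ℝ) ^ L) ^ 2 / ((q : ℝ) ^ k) ^ 2 := by
    rw [eq_div_iff (pow_ne_zero _ (pow_ne_zero _ hq.ne')), ← pow_mul, ← pow_mul, ← pow_add]
    congr 1; omega
  have e8 : (q : ℝ) ^ (2 * (L - x)) = ((q : ℝ) ^ L) ^ 2 / ((q : ℝ) ^ x) ^ 2 := by
    rw [eq_div_iff (pow_ne_zero _ (pow_ne_zero _ hq.ne')), ← pow_mul, ← pow_mul, ← pow_add]
    congr 1; omega
  have e9 : (q : ℝ) ^ (σ + ((L - 2 * x : ℤ) : ℝ)) =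
      (q : ℝ) ^ σ * (q : ℝ) ^ L / ((q : ℝ) ^ x) ^ 2 := by
    rw [Real.rpow_add hq, Real.rpow_intCast, zpow_sub₀ hq.ne', mul_comm (2 : ℤ), zpow_mul]
    simp only [zpow_natCast, mul_div_assoc]
    rfl
  have e10 : (q : ℝ) = (q : ℝ) ^ (1 / 2 : ℝ) * (q : ℝ) ^ (1 / 2 : ℝ) := by
    rw [← Real.rpow_add hq]; norm_num
  have e11 : ∀ n : ℕ, ((q : ℝ) ^ 2) ^ n = ((q : ℝ) ^ n) ^ 2 := fun n => by
    rw [← pow_mul, ← pow_mul, mul_comm]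
  rw [e1, ← pow_mul (q : ℝ) 2 (L - x), e8, e11, e11, e11, e6] at hrec
  rw [qdiff, qdiff, Real.rpow_neg hq.le σ, Real.rpow_neg hq.le (σ + _), e9, e2, e3, e4, e5, e7,
    pow_mul (q : ℝ) 2 k, e11, e6]
  have hg := (Real.rpow_pos_of_pos hq σ).ne'
  have hl := (Real.rpow_pos_of_pos hq ((L : ℝ) / 2)).ne'
  have hs := (Real.rpow_pos_of_pos hq (1 / 2 : ℝ)).ne'
  have hy := pow_ne_zero k hq.ne'
  have hX := pow_ne_zero x hq.ne'
  generalize (q : ℝ)⁻¹ - q = κ at *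
  generalize (q : ℝ) ^ σ = g at *
  generalize (q : ℝ) ^ ((L : ℝ) / 2) = l at *
  generalize (q : ℝ) ^ (1 / 2 : ℝ) = s at *
  generalize (q : ℝ) ^ k = y at *
  generalize (q : ℝ) ^ x = X at *
  rw [e10]
  rw [← sub_eq_zero] at hrec ⊢
  -- With all powers of `q` named, the eigenvalue equation is the recurrence multiplied by this
  -- factor.
  rw [← mul_zero (-(U * g / (κ * l * y))), ← hrec]
  field_simp
  ring

end Eigenvectors

/-! ### Covariance of the deformed matrix elements -/

section DefMatElt
variable (q : Set.Ioo (0 : ℝ) 1)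

theorem rep_twPrim_mulVec (L : ℕ) (s : ℂ) (v : ℕ → ℂ) (k : Fin (L + 1)) :
    Matrix.mulVec (rep q L (twPrim q s)) (fun a => v a) k =
      Complex.I * qpow q (1 / 2) * (ladder q L k * v (k - 1)) -
        Complex.I * (qpow q (1 / 2))⁻¹ * (ladder q L (k + 1) * v (k + 1)) +
        s * (qpow q ((k : ℕ) - (L : ℝ) / 2) * v k - qpow q ((L : ℝ) / 2 - (k : ℕ)) * v k) := by
  simp only [twPrim, map_add, map_sub, map_smul, rep_ug, Matrix.add_mulVec, Matrix.sub_mulVec,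
    Matrix.smul_mulVec, Pi.add_apply, Pi.sub_apply, Pi.smul_apply, smul_eq_mul, repGen_A_mulVec,
    repGen_B_mulVec, repGen_C_mulVec, repGen_D_mulVec]

theorem vecMul_rep_twPrim (L : ℕ) (s : ℂ) (v : ℕ → ℂ) (k : Fin (L + 1)) :
    Matrix.vecMul (fun a : Fin (L + 1) => v a) (rep q L (twPrim q s)) k =
      Complex.I * qpow q (1 / 2) * (ladder q L (k + 1) * v (k + 1)) -
        Complex.I * (qpow q (1 / 2))⁻¹ * (ladder q L k * v (k - 1)) +
        s * (qpow q ((k : ℕ) - (L : ℝ) / 2) * v k - qpow q ((L : ℝ) / 2 - (k : ℕ)) * v k) := by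
  simp only [twPrim, map_add, map_sub, map_smul, rep_ug, Matrix.vecMul_add, Matrix.vecMul_sub,
    Matrix.vecMul_smul, Pi.add_apply, Pi.sub_apply, Pi.smul_apply, smul_eq_mul, vecMul_repGen_A,
    vecMul_repGen_B, vecMul_repGen_C, vecMul_repGen_D]

/-- The conjugate components of `v^{l,j}(σ)`. -/
def starVec (L : ℕ) (J : ℤ) (σ : ℝ) (k : ℕ) : ℂ := Complex.I ^ k * (realVec q L J σ k : ℂ)

/-- The components of `t^l(A) v^{l,j}(σ)`. -/
def torusVec (L : ℕ) (J : ℤ) (σ : ℝ) (k : ℕ) : ℂ :=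
  qpow q (k - (L : ℝ) / 2) * (Complex.I ^ (-(k : ℤ)) * (realVec q L J σ k : ℂ))

theorem star_vec_eq (L : ℕ) (J : ℤ) (σ : ℝ) :
    star (vec q L J σ) = fun k : Fin (L + 1) => starVec q L J σ k := by
  ext k
  rw [vec_eq, starVec, Pi.star_apply, star_mul', Complex.star_def,
    Complex.conj_ofReal, map_zpow₀, Complex.conj_I, zpow_neg, ← inv_zpow, inv_neg, Complex.inv_I,
    neg_neg, zpow_natCast]

theorem rep_A_mulVec_vec (L : ℕ) (J : ℤ) (σ : ℝ) :
    Matrix.mulVec (rep q L (ug q .A)) (vec q L J σ) = fun k : Fin (L + 1) =>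
      torusVec q L J σ k := by
  ext k
  rw [vec_eq, rep_ug, repGen, Matrix.mulVec_diagonal, neg_sub, torusVec]

variable {q}

/-- The eigenvalue of the twisted primitive element on `v^{l,j}(σ)`. -/
def twEig (q : Set.Ioo (0 : ℝ) 1) (J : ℤ) (σ : ℝ) : ℝ :=
  (qdiff q (σ + J) - qdiff q σ) / ((q : ℝ)⁻¹ - q)

theorem realVec_eigen_complex {L k : ℕ} (hk : k ≤ L) {J : ℤ} (hJ : IsWeight L J) (σ : ℝ) :
    -((qpow q (1 / 2))⁻¹ * (ladder q L k * realVec q L J σ (k - 1) : ℂ)) -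
      qpow q (1 / 2) * (ladder q L (k + 1) * realVec q L J σ (k + 1) : ℂ) +
      ((qdiff q σ / ((q : ℝ)⁻¹ - q : ℝ) : ℝ) : ℂ) *
        (qpow q (k - (L : ℝ) / 2) - qpow q ((L : ℝ) / 2 - k)) * realVec q L J σ k =
      (twEig q J σ : ℂ) * qpow q ((L : ℝ) / 2 - k) * realVec q L J σ k := by
  rw [← qpow_neg_half]
  simp only [qpow]
  exact_mod_cast congrArg (fun x : ℝ => (x : ℂ)) (realVec_eigen q hk hJ σ)

/-- Applying `A` first multiplies the two neighbouring components by `q^{-1}` and `q` relative to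
the middle one. This converts the weights `q^{1/2}`, `q^{-1/2}` of `twPrim` into those of
`realVec_eigen`, so the same real identity serves the column vector here and the row vector in
`vecMul_star_vec_rep_twPrim`. It is the reason for working with `b = A.a`. -/
theorem rep_twPrim_mulVec_vec (L : ℕ) {J : ℤ} (hJ : IsWeight L J) (σ : ℝ) :
    Matrix.mulVec (rep q L (twPrim q ((qdiff q σ / ((q : ℝ)⁻¹ - q : ℝ) : ℝ) : ℂ)))
      (Matrix.mulVec (rep q L (ug q .A)) (vec q L J σ)) =
    (twEig q J σ : ℂ) • Matrix.mulVec (rep q L (ug q .D))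
      (Matrix.mulVec (rep q L (ug q .A)) (vec q L J σ)) := by
  rw [rep_A_mulVec_vec]
  ext k
  rw [rep_twPrim_mulVec, Pi.smul_apply, rep_ug, repGen_D_mulVec, smul_eq_mul]
  simp only [torusVec]
  have h := realVec_eigen_complex (q := q) (Nat.lt_succ_iff.1 k.2) hJ σ
  have hs := qpow_ne_zero q (1 / 2)
  have h1 : (ladder q L k : ℂ) * (qpow q ((((k : ℕ) - 1 : ℕ) : ℝ) - (L : ℝ) / 2) *
      (Complex.I ^ (-(((k : ℕ) - 1 : ℕ) : ℤ)) * (realVec q L J σ (k - 1) : ℂ))) =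
      (qpow q (1 / 2))⁻¹ ^ 2 * qpow q ((k : ℕ) - (L : ℝ) / 2) * (Complex.I *
        Complex.I ^ (-((k : ℕ) : ℤ))) * (ladder q L k * realVec q L J σ (k - 1)) := by
    rcases (k : ℕ) with _ | k
    · simp [ladder_zero]
    · rw [Nat.add_sub_cancel, show (k : ℝ) - (L : ℝ) / 2 = -1 + (((k + 1 : ℕ) : ℝ) - (L : ℝ) / 2) by
        push_cast; ring, qpow_add, qpow_neg_one, qc_eq_sq, ← zpow_one_add₀ Complex.I_ne_zero,
        show 1 + -((k + 1 : ℕ) : ℤ) = -(k : ℤ) by push_cast; ring, inv_pow]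
      ring
  have h2 : qpow q ((((k : ℕ) + 1 : ℕ) : ℝ) - (L : ℝ) / 2) =
      qpow q (1 / 2) ^ 2 * qpow q ((k : ℕ) - (L : ℝ) / 2) := by
    rw [← qc_eq_sq, ← qpow_one, ← qpow_add]; congr 1; push_cast; ring
  have h3 : Complex.I ^ (-(((k : ℕ) + 1 : ℕ) : ℤ)) =
      -Complex.I * Complex.I ^ (-((k : ℕ) : ℤ)) := by
    rw [show -(((k : ℕ) + 1 : ℕ) : ℤ) = -1 + -((k : ℕ) : ℤ) by push_cast; ring,
      zpow_add₀ Complex.I_ne_zero]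
    simp
  rw [h1, h2, h3]
  have h4 : qpow q (1 / 2) * (qpow q (1 / 2))⁻¹ = 1 := mul_inv_cancel₀ hs
  have hI := Complex.I_mul_I
  generalize (qpow q (1 / 2))⁻¹ = s' at *
  linear_combination (qpow q ((k : ℕ) - (L : ℝ) / 2) * Complex.I ^ (-((k : ℕ) : ℤ))) * h +
    (Complex.I * Complex.I * s' * (ladder q L k * realVec q L J σ (k - 1)) +
      Complex.I * Complex.I * qpow q (1 / 2) * (ladder q L (k + 1) * realVec q L J σ (k + 1))) *
      (qpow q ((k : ℕ) - (L : ℝ) / 2) * Complex.I ^ (-((k : ℕ) : ℤ))) * h4 +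
    (s' * (ladder q L k * realVec q L J σ (k - 1)) +
      qpow q (1 / 2) * (ladder q L (k + 1) * realVec q L J σ (k + 1))) *
      (qpow q ((k : ℕ) - (L : ℝ) / 2) * Complex.I ^ (-((k : ℕ) : ℤ))) * hI

theorem vecMul_star_vec_rep_twPrim (L : ℕ) {J : ℤ} (hJ : IsWeight L J) (σ : ℝ) :
    Matrix.vecMul (star (vec q L J σ))
      (rep q L (twPrim q ((qdiff q σ / ((q : ℝ)⁻¹ - q : ℝ) : ℝ) : ℂ))) =
    (twEig q J σ : ℂ) • Matrix.vecMul (star (vec q L J σ)) (rep q L (ug q .D)) := by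
  rw [star_vec_eq]
  ext k
  rw [vecMul_rep_twPrim, Pi.smul_apply, rep_ug, vecMul_repGen_D, smul_eq_mul]
  simp only [starVec]
  have h := realVec_eigen_complex (q := q) (Nat.lt_succ_iff.1 k.2) hJ σ
  have hs := qpow_ne_zero q (1 / 2)
  have h1 : (ladder q L k : ℂ) * (Complex.I ^ ((k : ℕ) - 1) * (realVec q L J σ (k - 1) : ℂ)) =
      -Complex.I * Complex.I ^ (k : ℕ) * (ladder q L k * realVec q L J σ (k - 1)) := by
    rcases (k : ℕ) with _ | k
    · simp [ladder_zero]
    · rw [Nat.add_sub_cancel, pow_succ]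
      linear_combination (Complex.I ^ k * (ladder q L (k + 1) * realVec q L J σ k)) *
        Complex.I_mul_I
  have hI := Complex.I_mul_I
  rw [h1, pow_succ]
  linear_combination (Complex.I ^ (k : ℕ)) * h + Complex.I ^ (k : ℕ) *
    ((qpow q (1 / 2))⁻¹ * (ladder q L k * realVec q L J σ (k - 1)) +
      qpow q (1 / 2) * (ladder q L (k + 1) * realVec q L J σ (k + 1))) * hI

theorem covariant_defMatElt {L : ℕ} {I J : ℤ} (hI : IsWeight L I) (hJ : IsWeight L J) (τ σ : ℝ) :
    Covariant q ((qdiff q σ / ((q : ℝ)⁻¹ - q : ℝ) : ℝ) : ℂ)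
      ((qdiff q τ / ((q : ℝ)⁻¹ - q : ℝ) : ℝ) : ℂ) (twEig q J σ) (twEig q I τ)
      (defMatElt q L I J τ σ) where
  right X := by
    simp only [pairing_defMatElt]
    rw [map_mul, map_mul, ← Matrix.mulVec_mulVec, ← Matrix.mulVec_mulVec,
      rep_twPrim_mulVec_vec L hJ, Matrix.mulVec_smul, dotProduct_smul, smul_eq_mul]
  left X := by
    simp only [pairing_defMatElt]
    rw [map_mul, map_mul, ← Matrix.mulVec_mulVec, ← Matrix.mulVec_mulVec, Matrix.dotProduct_mulVec,
      vecMul_star_vec_rep_twPrim L hI, smul_dotProduct, smul_eq_mul,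
      ← Matrix.dotProduct_mulVec]

/-- The values of `b^l_{i,j}(τ, σ)` on the powers of `A`. -/
def torusVal (q : Set.Ioo (0 : ℝ) 1) (L : ℕ) (I J : ℤ) (τ σ : ℝ) (p : ℕ) : ℝ :=
  ∑ k ∈ Finset.range (L + 1), realVec q L I τ k * realVec q L J σ k *
    ((q : ℝ) ^ ((k : ℝ) - (L : ℝ) / 2)) ^ (p + 1)

theorem pairing_defMatElt_A_pow (L : ℕ) (I J : ℤ) (τ σ : ℝ) (p : ℕ) :
    pairing q (defMatElt q L I J τ σ) (ug q .A ^ p) = torusVal q L I J τ σ p := by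
  have hA : rep q L (ug q .A) ^ (p + 1) = Matrix.diagonal fun k : Fin (L + 1) =>
      (((q : ℝ) ^ (((k : ℕ) : ℝ) - (L : ℝ) / 2) : ℝ) : ℂ) ^ (p + 1) := by
    rw [rep_ug, repGen, Matrix.diagonal_pow]
    congr 1
    funext k
    simp only [Pi.pow_apply, qpow, neg_sub]
  rw [pairing_defMatElt, Matrix.mulVec_mulVec, map_pow, ← pow_succ, hA, star_vec_eq, vec_eq,
    torusVal, Finset.sum_range, Complex.ofReal_sum, dotProduct]
  refine Finset.sum_congr rfl fun k _ => ?_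
  rw [Matrix.mulVec_diagonal, starVec]
  have h : Complex.I ^ (k : ℕ) * Complex.I ^ (-((k : ℕ) : ℤ)) = 1 := by
    rw [zpow_neg, zpow_natCast, mul_inv_cancel₀ (pow_ne_zero _ Complex.I_ne_zero)]
  push_cast
  linear_combination (realVec q L I τ k * realVec q L J σ k *
    ((((q : ℝ) ^ (((k : ℕ) : ℝ) - (L : ℝ) / 2) : ℝ) : ℂ) ^ (p + 1))) * h

theorem ladder_sq_eq {L k : ℕ} (hk : k ≤ L + 1) : ladder q L k ^ 2 =
    ((q : ℝ) ^ (L + 1) + ((q : ℝ) ^ (L + 1))⁻¹ - ((q : ℝ) ^ (L + 1) / ((q : ℝ) ^ k) ^ 2 +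
      ((q : ℝ) ^ k) ^ 2 / (q : ℝ) ^ (L + 1))) / ((q : ℝ)⁻¹ - q) ^ 2 := by
  rw [ladder_sq q L k hk]
  congr 1
  have h0 := q.2.1.ne'
  rw [neg_sub, zpow_sub₀ h0, zpow_sub₀ h0, zpow_neg, zpow_natCast,
    show (L : ℤ) + 1 = ((L + 1 : ℕ) : ℤ) by push_cast; ring, zpow_natCast]
  have h1 := pow_ne_zero k h0
  have h2 := pow_ne_zero (L + 1) h0
  field_simp
  ring

theorem repGen_sq (L : ℕ) : repGen q L .A ^ 2 = Matrix.diagonal (fun k : Fin (L + 1) =>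
      ((((q : ℝ) ^ (k : ℕ)) ^ 2 / (q : ℝ) ^ L : ℝ) : ℂ)) ∧
    repGen q L .D ^ 2 = Matrix.diagonal (fun k : Fin (L + 1) =>
      (((q : ℝ) ^ L / ((q : ℝ) ^ (k : ℕ)) ^ 2 : ℝ) : ℂ)) := by
  have hq := q.2.1
  have h : ∀ k : ℕ, (q : ℝ) ^ ((L : ℝ) / 2 - k) * (q : ℝ) ^ ((L : ℝ) / 2 - k) =
      (q : ℝ) ^ L / ((q : ℝ) ^ k) ^ 2 := fun k => by
    rw [← Real.rpow_add hq, ← pow_mul, ← Real.rpow_natCast, ← Real.rpow_natCast,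
      ← Real.rpow_sub hq]
    congr 1; push_cast; ring
  constructor
  · rw [repGen, Matrix.diagonal_pow]
    congr 1
    funext k
    rw [Pi.pow_apply, qpow, Real.rpow_neg hq.le, ← Complex.ofReal_pow, inv_pow, sq, h, inv_div]
  · rw [repGen, Matrix.diagonal_pow]
    congr 1
    funext k
    rw [Pi.pow_apply, qpow, ← Complex.ofReal_pow, sq, h]

/-- The Casimir element acts by a scalar depending only on `L`. Solving for `BC` expresses it
through the torus. -/
theorem repGen_B_mul_C (L : ℕ) : repGen q L .B * repGen q L .C =
    (((((q : ℝ)⁻¹ - q) ^ 2)⁻¹ : ℝ) : ℂ) •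
      ((((q : ℝ) ^ (L + 1) + ((q : ℝ) ^ (L + 1))⁻¹ : ℝ) : ℂ) • (1 : Matrix _ _ ℂ) -
        ((q : ℝ) : ℂ) • repGen q L .D ^ 2 - (((q : ℝ)⁻¹ : ℝ) : ℂ) • repGen q L .A ^ 2) := by
  rw [rep_BC, (repGen_sq L).1, (repGen_sq L).2, ← Matrix.diagonal_one, ← Matrix.diagonal_smul,
    ← Matrix.diagonal_smul, ← Matrix.diagonal_smul, Matrix.diagonal_sub, Matrix.diagonal_sub,
    ← Matrix.diagonal_smul]
  congr 1
  funext k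
  have h := ladder_sq_eq (q := q) (k.2.le)
  have h0 := q.2.1.ne'
  simp only [Pi.smul_apply, smul_eq_mul, mul_one, ← Complex.ofReal_mul, ← Complex.ofReal_sub,
    ← Complex.ofReal_pow]
  congr 1
  rw [h, pow_succ (q : ℝ) L]
  field_simp
  ring

theorem repGen_C_mul_B (L : ℕ) : repGen q L .C * repGen q L .B =
    (((((q : ℝ)⁻¹ - q) ^ 2)⁻¹ : ℝ) : ℂ) •
      ((((q : ℝ) ^ (L + 1) + ((q : ℝ) ^ (L + 1))⁻¹ : ℝ) : ℂ) • (1 : Matrix _ _ ℂ) -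
        (((q : ℝ)⁻¹ : ℝ) : ℂ) • repGen q L .D ^ 2 - ((q : ℝ) : ℂ) • repGen q L .A ^ 2) := by
  rw [rep_CB, (repGen_sq L).1, (repGen_sq L).2, ← Matrix.diagonal_one, ← Matrix.diagonal_smul,
    ← Matrix.diagonal_smul, ← Matrix.diagonal_smul, Matrix.diagonal_sub, Matrix.diagonal_sub,
    ← Matrix.diagonal_smul]
  congr 1
  funext k
  have h := ladder_sq_eq (q := q) (L := L) (k := k + 1) k.2
  have h0 := q.2.1.ne'
  simp only [Pi.smul_apply, smul_eq_mul, mul_one, ← Complex.ofReal_mul, ← Complex.ofReal_sub,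
    ← Complex.ofReal_pow]
  congr 1
  rw [h, pow_succ (q : ℝ) L, pow_succ (q : ℝ) k]
  field_simp
  ring

end DefMatElt

/-! ### The Casimir `q`-difference equation on the torus. -/

section Casimir
variable {q : Set.Ioo (0 : ℝ) 1} {s t l m : ℂ} {ξ : Aq q}

theorem pairing_mul_twPrim (ξ : Aq q) (s : ℂ) (X : Uq q) : pairing q ξ (X * twPrim q s) =
    Complex.I * qpow q (1 / 2) * pairing q ξ (X * ug q .B) -
      Complex.I * (qpow q (1 / 2))⁻¹ * pairing q ξ (X * ug q .C) +
      s * (pairing q ξ (X * ug q .A) - pairing q ξ (X * ug q .D)) := by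
  simp only [twPrim, mul_add, mul_sub, mul_smul_comm, pairing_add_apply, pairing_sub_apply,
    pairing_smul_apply, smul_sub]

theorem pairing_twPrim_mul (ξ : Aq q) (s : ℂ) (X : Uq q) : pairing q ξ (twPrim q s * X) =
    Complex.I * qpow q (1 / 2) * pairing q ξ (ug q .B * X) -
      Complex.I * (qpow q (1 / 2))⁻¹ * pairing q ξ (ug q .C * X) +
      s * (pairing q ξ (ug q .A * X) - pairing q ξ (ug q .D * X)) := by
  simp only [twPrim, add_mul, sub_mul, smul_mul_assoc, pairing_add_apply, pairing_sub_apply,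
    pairing_smul_apply, smul_sub, mul_sub]

theorem B_mul_A_pow (p : ℕ) :
    ug q .B * ug q .A ^ p = (qc q ^ p)⁻¹ • (ug q .A ^ p * ug q .B) := by
  rw [← inv_pow]; exact mul_pow_of_mul_eq_smul (u_BA q) p

theorem C_mul_A_pow (p : ℕ) :
    ug q .C * ug q .A ^ p = qc q ^ p • (ug q .A ^ p * ug q .C) :=
  mul_pow_of_mul_eq_smul (u_CA q) p

theorem A_pow_succ_mul_D (p : ℕ) : ug q .A ^ (p + 1) * ug q .D = ug q .A ^ p := by
  rw [pow_succ, mul_assoc, u_AD, mul_one]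

theorem D_mul_A_pow_succ (p : ℕ) : ug q .D * ug q .A ^ (p + 1) = ug q .A ^ p := by
  rw [pow_succ', ← mul_assoc, u_DA, one_mul]

/-- Eliminating `A^{p+1} C` between the right and left equations at `A^{p+1}` leaves the value at
`A^{p+1} B` in terms of torus values. -/
theorem Covariant.pairing_A_pow_mul_B (h : Covariant q s t l m ξ) (p : ℕ) :
    Complex.I * qpow q (1 / 2) * (qc q ^ (p + 1) - (qc q ^ (p + 1))⁻¹) *
      pairing q ξ (ug q .A ^ (p + 1) * ug q .B) =
    (qc q ^ (p + 1) * (l + s) - (m + t)) * pairing q ξ (ug q .A ^ p) +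
      (t - qc q ^ (p + 1) * s) * pairing q ξ (ug q .A ^ (p + 2)) := by
  have hr := h.right (ug q .A ^ (p + 1))
  have hl := h.left (ug q .A ^ (p + 1))
  rw [pairing_mul_twPrim, A_pow_succ_mul_D, ← pow_succ] at hr
  rw [pairing_twPrim_mul, D_mul_A_pow_succ, ← pow_succ', B_mul_A_pow, C_mul_A_pow,
    pairing_smul_apply, pairing_smul_apply] at hl
  linear_combination qc q ^ (p + 1) * hr - hl

/-- The same elimination one degree higher: the equations at `A^{p+2} B` share the term `A^{p+2}
B^2`, which cancels. The products `BC` and `CB` that remain are the ones governed by the Casimir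
element. -/
theorem Covariant.pairing_A_pow_mul_BC_sub (h : Covariant q s t l m ξ) (p : ℕ) :
    Complex.I * (qpow q (1 / 2))⁻¹ * ((qc q ^ (p + 2))⁻¹ *
        pairing q ξ (ug q .A ^ (p + 2) * (ug q .B * ug q .C)) -
      qc q ^ (p + 2) * pairing q ξ (ug q .A ^ (p + 2) * (ug q .C * ug q .B))) =
    (s * (qc q ^ (p + 3))⁻¹ - t) * pairing q ξ (ug q .A ^ (p + 3) * ug q .B) +
      (t + m - (s + l) * (qc q ^ (p + 1))⁻¹) * pairing q ξ (ug q .A ^ (p + 1) * ug q .B) := by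
  have hr := h.right (ug q .A ^ (p + 2) * ug q .B)
  have hl := h.left (ug q .A ^ (p + 2) * ug q .B)
  have h0 := q_ne q
  have e1 : ug q .A ^ (p + 2) * ug q .B * ug q .A =
      (qc q)⁻¹ • (ug q .A ^ (p + 3) * ug q .B) := by
    have := B_mul_A_pow (q := q) 1
    rw [pow_one, pow_one] at this
    rw [mul_assoc, this, mul_smul_comm, ← mul_assoc, ← pow_succ]
  have e2 : ug q .A ^ (p + 2) * ug q .B * ug q .D = qc q • (ug q .A ^ (p + 1) * ug q .B) := by
    rw [mul_assoc, u_BD, mul_smul_comm, ← mul_assoc, A_pow_succ_mul_D]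
  have e3 : ug q .A ^ (p + 2) * ug q .B * ug q .C = ug q .A ^ (p + 2) * (ug q .B * ug q .C) :=
    mul_assoc _ _ _
  rw [pairing_mul_twPrim, e1, e2, e3, pairing_smul_apply, pairing_smul_apply] at hr
  rw [pairing_twPrim_mul] at hl
  simp only [← mul_assoc (ug q _) (ug q .A ^ (p + 2))] at hl
  rw [D_mul_A_pow_succ, ← pow_succ', B_mul_A_pow, C_mul_A_pow, smul_mul_assoc, smul_mul_assoc,
    pairing_smul_apply, pairing_smul_apply, mul_assoc (ug q .A ^ (p + 2)) (ug q .C)] at hl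
  have hz : qc q ^ p ≠ 0 := pow_ne_zero _ h0
  have e4 : qc q * (qc q ^ (p + 2))⁻¹ = (qc q ^ (p + 1))⁻¹ := by
    rw [pow_succ _ (p + 1)]; field_simp
  have e5 : (qc q)⁻¹ * (qc q ^ (p + 2))⁻¹ = (qc q ^ (p + 3))⁻¹ := by
    rw [pow_succ _ (p + 2)]; field_simp
  linear_combination hl - (qc q ^ (p + 2))⁻¹ * hr -
    (s + l) * pairing q ξ (ug q .A ^ (p + 1) * ug q .B) * e4 +
    s * pairing q ξ (ug q .A ^ (p + 3) * ug q .B) * e5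

theorem pairing_defMatElt_A_pow_mul_BC (L : ℕ) (I J : ℤ) (τ σ : ℝ) (p : ℕ) :
    pairing q (defMatElt q L I J τ σ) (ug q .A ^ (p + 2) * (ug q .B * ug q .C)) =
    (((((q : ℝ)⁻¹ - q) ^ 2)⁻¹ * (((q : ℝ) ^ (L + 1) + ((q : ℝ) ^ (L + 1))⁻¹) *
      torusVal q L I J τ σ (p + 2) - q * torusVal q L I J τ σ p -
      (q : ℝ)⁻¹ * torusVal q L I J τ σ (p + 4)) : ℝ) : ℂ) := by
  have hX : rep q L (ug q .A ^ (p + 2) * (ug q .B * ug q .C)) =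
      (((((q : ℝ)⁻¹ - q) ^ 2)⁻¹ : ℝ) : ℂ) •
      ((((q : ℝ) ^ (L + 1) + ((q : ℝ) ^ (L + 1))⁻¹ : ℝ) : ℂ) • rep q L (ug q .A ^ (p + 2)) -
        ((q : ℝ) : ℂ) • rep q L (ug q .A ^ p) -
        (((q : ℝ)⁻¹ : ℝ) : ℂ) • rep q L (ug q .A ^ (p + 4))) := by
    have e : (ug q .A ^ p : Uq q) = ug q .A ^ (p + 2) * ug q .D ^ 2 := by
      rw [sq, ← mul_assoc, A_pow_succ_mul_D, A_pow_succ_mul_D]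
    have e' : (ug q .A ^ (p + 4) : Uq q) = ug q .A ^ (p + 2) * ug q .A ^ 2 := by
      rw [← pow_add]
    rw [e, e', map_mul _ _ (_ ^ 2), map_mul _ _ (_ ^ 2), map_mul, map_mul _ (ug q _) (ug q _)]
    simp only [map_pow _ _ 2, rep_ug, repGen_B_mul_C]
    simp only [Matrix.mul_smul, mul_sub, mul_one]
  simp only [Complex.ofReal_mul, Complex.ofReal_sub, ← pairing_defMatElt_A_pow]
  simp only [pairing_defMatElt, hX, Matrix.smul_mulVec, Matrix.sub_mulVec, dotProduct_smul,
    dotProduct_sub, smul_eq_mul]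

theorem pairing_defMatElt_A_pow_mul_CB (L : ℕ) (I J : ℤ) (τ σ : ℝ) (p : ℕ) :
    pairing q (defMatElt q L I J τ σ) (ug q .A ^ (p + 2) * (ug q .C * ug q .B)) =
    (((((q : ℝ)⁻¹ - q) ^ 2)⁻¹ * (((q : ℝ) ^ (L + 1) + ((q : ℝ) ^ (L + 1))⁻¹) *
      torusVal q L I J τ σ (p + 2) - (q : ℝ)⁻¹ * torusVal q L I J τ σ p -
      q * torusVal q L I J τ σ (p + 4)) : ℝ) : ℂ) := by
  have hX : rep q L (ug q .A ^ (p + 2) * (ug q .C * ug q .B)) =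
      (((((q : ℝ)⁻¹ - q) ^ 2)⁻¹ : ℝ) : ℂ) •
      ((((q : ℝ) ^ (L + 1) + ((q : ℝ) ^ (L + 1))⁻¹ : ℝ) : ℂ) • rep q L (ug q .A ^ (p + 2)) -
        (((q : ℝ)⁻¹ : ℝ) : ℂ) • rep q L (ug q .A ^ p) -
        ((q : ℝ) : ℂ) • rep q L (ug q .A ^ (p + 4))) := by
    have e : (ug q .A ^ p : Uq q) = ug q .A ^ (p + 2) * ug q .D ^ 2 := by
      rw [sq, ← mul_assoc, A_pow_succ_mul_D, A_pow_succ_mul_D]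
    have e' : (ug q .A ^ (p + 4) : Uq q) = ug q .A ^ (p + 2) * ug q .A ^ 2 := by
      rw [← pow_add]
    rw [e, e', map_mul _ _ (_ ^ 2), map_mul _ _ (_ ^ 2), map_mul, map_mul _ (ug q _) (ug q _)]
    simp only [map_pow _ _ 2, rep_ug, repGen_C_mul_B]
    simp only [Matrix.mul_smul, mul_sub, mul_one]
  simp only [Complex.ofReal_mul, Complex.ofReal_sub, ← pairing_defMatElt_A_pow]
  simp only [pairing_defMatElt, hX, Matrix.smul_mulVec, Matrix.sub_mulVec, dotProduct_smul,
    dotProduct_sub, smul_eq_mul]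

/-- The second order `q`-difference equation for a function on the powers of `q`, expressing that
the Casimir element acts by a scalar. -/
def CasimirEq (Q S SJ T TI ω z Fm F Fp : ℝ) : Prop :=
  (Q * z - (Q * z)⁻¹) * (z / Q - Q / z) *
      (z⁻¹ * (ω * F - Q * Fm - Q⁻¹ * Fp) - z * (ω * F - Q⁻¹ * Fm - Q * Fp)) +
    (z / Q - Q / z) * ((Q * z * SJ - TI) * F + (T - Q * z * S) * Fp) * (S / (Q * z) - T) +
    (Q * z - (Q * z)⁻¹) * ((z / Q * SJ - TI) * Fm + (T - z / Q * S) * F) * (TI - Q * SJ / z) = 0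

/-- Substituting the two degree-one values `b1` and `b3` into the degree-two relation. Here `c`
stands for `i q^{-1/2}`, so `-c⁻¹` is `i q^{1/2}`, and `κ = q⁻¹ - q` clears the denominators of the
eigenvalues. -/
theorem casimir_elimination {K : Type*} [Field K] {Q z κ c s s' t t' ω F1 F2 F3 b1 b3 : K}
    (hQ : Q ≠ 0) (hz : z ≠ 0) (hκ : κ ≠ 0) (hc : c ≠ 0)
    (h1 : -c⁻¹ * (z / Q - (z / Q)⁻¹) * b1 =
      (z / Q * (s' - s + s) - (t' - t + t)) * F1 + (t - z / Q * s) * F2)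
    (h2 : -c⁻¹ * (Q * z - (Q * z)⁻¹) * b3 =
      (Q * z * (s' - s + s) - (t' - t + t)) * F2 + (t - Q * z * s) * F3)
    (h3 : c * (z⁻¹ * ((κ ^ 2)⁻¹ * (ω * F2 - Q * F1 - Q⁻¹ * F3)) -
        z * ((κ ^ 2)⁻¹ * (ω * F2 - Q⁻¹ * F1 - Q * F3))) =
      (s * (Q * z)⁻¹ - t) * b3 + (t + (t' - t) - (s + (s' - s)) * (z / Q)⁻¹) * b1) :
    (Q * z - (Q * z)⁻¹) * (z / Q - Q / z) *
      (z⁻¹ * (ω * F2 - Q * F1 - Q⁻¹ * F3) - z * (ω * F2 - Q⁻¹ * F1 - Q * F3)) +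
    (z / Q - Q / z) * ((Q * z * (κ * s') - κ * t') * F2 + (κ * t - Q * z * (κ * s)) * F3) *
      (κ * s / (Q * z) - κ * t) +
    (Q * z - (Q * z)⁻¹) * ((z / Q * (κ * s') - κ * t') * F1 + (κ * t - z / Q * (κ * s)) * F2) *
      (κ * t' - Q * (κ * s') / z) = 0 := by
  have h : (Q * z - (Q * z)⁻¹) * (z / Q - Q / z) *
      (z⁻¹ * (ω * F2 - Q * F1 - Q⁻¹ * F3) - z * (ω * F2 - Q⁻¹ * F1 - Q * F3)) =
      (κ ^ 2 * c⁻¹ * (Q * z - (Q * z)⁻¹) * (z / Q - Q / z)) *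
      (c * (z⁻¹ * ((κ ^ 2)⁻¹ * (ω * F2 - Q * F1 - Q⁻¹ * F3)) -
        z * ((κ ^ 2)⁻¹ * (ω * F2 - Q⁻¹ * F1 - Q * F3)))) := by
    field_simp
  have e1 : Q / z = (z / Q)⁻¹ := by rw [inv_div]
  have e2 : Q * (κ * s') / z = κ * s' * (z / Q)⁻¹ := by rw [← e1]; ring
  have e3 : κ * s / (Q * z) = κ * s * (Q * z)⁻¹ := div_eq_mul_inv _ _
  rw [h, h3, e2, e3, e1]
  linear_combination (-(κ ^ 2 * (z / Q - (z / Q)⁻¹) * (s * (Q * z)⁻¹ - t))) * h2 -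
    (κ ^ 2 * (Q * z - (Q * z)⁻¹) * (t' - s' * (z / Q)⁻¹)) * h1

/-- The equation is centred at `z = q^{p+2}`. The exponent moves in steps of two, which gives the
base `q²` of the Askey-Wilson polynomials. -/
theorem torusVal_casimir {L : ℕ} {I J : ℤ} (hI : IsWeight L I) (hJ : IsWeight L J) (τ σ : ℝ)
    (p : ℕ) : CasimirEq q (qdiff q σ) (qdiff q (σ + J)) (qdiff q τ) (qdiff q (τ + I))
      ((q : ℝ) ^ (L + 1) + ((q : ℝ) ^ (L + 1))⁻¹) ((q : ℝ) ^ (p + 2))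
      (torusVal q L I J τ σ p) (torusVal q L I J τ σ (p + 2)) (torusVal q L I J τ σ (p + 4)) := by
  have hc := covariant_defMatElt (q := q) hI hJ τ σ
  have h1 := hc.pairing_A_pow_mul_B p
  have h2 := hc.pairing_A_pow_mul_B (p + 2)
  have h3 := hc.pairing_A_pow_mul_BC_sub p
  rw [pairing_defMatElt_A_pow_mul_BC, pairing_defMatElt_A_pow_mul_CB] at h3
  simp only [pairing_defMatElt_A_pow, twEig, sub_div] at h1 h2 h3
  have hκ := (inv_sub_pos q).ne'
  have h0 := q.2.1.ne'
  have hs : (Complex.I * qpow q (1 / 2)) * (Complex.I * (qpow q (1 / 2))⁻¹) = -1 := by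
    rw [mul_mul_mul_comm, mul_inv_cancel₀ (qpow_ne_zero q _), Complex.I_mul_I, mul_one]
  have e : ∀ x : ℝ, ∃ y : ℝ, y = x / ((q : ℝ)⁻¹ - q) ∧ x = ((q : ℝ)⁻¹ - q) * y :=
    fun x => ⟨_, rfl, by rw [mul_div_cancel₀ _ hκ]⟩
  obtain ⟨s, hs1, hs2⟩ := e (qdiff q σ)
  obtain ⟨s', hs1', hs2'⟩ := e (qdiff q (σ + J))
  obtain ⟨t, ht1, ht2⟩ := e (qdiff q τ)
  obtain ⟨t', ht1', ht2'⟩ := e (qdiff q (τ + I))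
  rw [← hs1, ← hs1', ← ht1, ← ht1'] at h1 h2 h3
  rw [hs2, hs2', ht2, ht2', CasimirEq]
  have hz1 : qc q ^ (p + 1) = (((q : ℝ) ^ (p + 2) / q : ℝ) : ℂ) := by
    rw [qc, ← Complex.ofReal_pow, pow_succ _ (p + 1), mul_div_cancel_right₀ _ h0]
  have hz2 : qc q ^ (p + 2) = (((q : ℝ) ^ (p + 2) : ℝ) : ℂ) := by rw [qc, ← Complex.ofReal_pow]
  have hz3 : qc q ^ (p + 3) = ((q * (q : ℝ) ^ (p + 2) : ℝ) : ℂ) := by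
    rw [qc, ← Complex.ofReal_pow, pow_succ' _ (p + 2)]
  rw [hz1] at h1
  rw [show p + 2 + 1 = p + 3 from rfl, show p + 2 + 2 = p + 4 from rfl, hz3] at h2
  rw [hz1, hz2, hz3] at h3
  have hz : (q : ℝ) ^ (p + 2) ≠ 0 := pow_ne_zero _ h0
  generalize (q : ℝ) ^ (p + 2) = z at *
  generalize (q : ℝ) ^ (L + 1) + ((q : ℝ) ^ (L + 1))⁻¹ = ω at *
  generalize torusVal q L I J τ σ p = F1 at *
  generalize torusVal q L I J τ σ (p + 2) = F2 at *
  generalize torusVal q L I J τ σ (p + 4) = F3 at *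
  generalize pairing q (defMatElt q L I J τ σ) _ = b1 at *
  generalize pairing q (defMatElt q L I J τ σ) _ = b3 at *
  have hκ2 : ((q : ℝ)⁻¹ - q) ^ 2 * (((q : ℝ)⁻¹ - q) ^ 2)⁻¹ = 1 :=
    mul_inv_cancel₀ (pow_ne_zero _ hκ)
  generalize (((q : ℝ)⁻¹ - q) ^ 2)⁻¹ = κ' at *
  generalize (q : ℝ)⁻¹ - q = κ at *
  generalize Complex.I * qpow q (1 / 2) = c1 at *
  generalize Complex.I * (qpow q (1 / 2))⁻¹ = c2 at *
  have hκ3 := congrArg (fun x : ℝ => (x : ℂ)) hκ2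
  apply Complex.ofReal_injective
  push_cast at h1 h2 h3 hκ3 ⊢
  have h0' : (q : ℂ) ≠ 0 := by exact_mod_cast h0
  have hz' : (z : ℂ) ≠ 0 := by exact_mod_cast hz
  have hc2 : c2 ≠ 0 := by rintro rfl; simp at hs
  have hc1 : c1 = -c2⁻¹ := by field_simp; linear_combination hs
  have hκ' : (κ' : ℂ) = ((κ : ℂ) ^ 2)⁻¹ := eq_inv_of_mul_eq_one_right hκ3
  have hκ0 : (κ : ℂ) ≠ 0 := by exact_mod_cast hκ
  exact casimir_elimination h0' hz' hκ0 hc2 (by rw [← hc1]; exact h1) (by rw [← hc1]; exact h2)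
    (by rw [← hκ']; exact h3)

end Casimir

/-! ### The extremal matrix elements -/

section Extremal
variable {q : Set.Ioo (0 : ℝ) 1}

theorem dualQKrawtchouk_zero_right (n : ℕ) (c : ℝ) (N : ℕ) (Q : ℝ) :
    dualQKrawtchouk n 0 c N Q = 1 := by
  rw [dualQKrawtchouk, Finset.sum_range_succ', Finset.sum_eq_zero]
  · simp [qPoch_zero]
  · intro k _
    have : qPoch (Q ^ (-((0 : ℕ) : ℤ))) Q (k + 1) = 0 := by simp [qPoch_succ']
    rw [this]; ring

theorem realVec_top (L k : ℕ) (τ : ℝ) :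
    realVec q L L τ k = vecScale q L L τ k * √(binomWeight q L k) := by
  rw [realVec, sub_self, Int.zero_ediv, Int.toNat_zero, dualQKrawtchouk_zero_right, mul_one]

theorem isWeight_self (L : ℕ) : IsWeight L L := ⟨0, Nat.zero_le _, by simp⟩

/-- For `j = l` the Krawtchouk factor is `1`, so neighbouring components are related by a two-term
recurrence. It says that `B` acts on the conjugate vector, from the right, as a combination of `A`
and `D`. -/
theorem ladder_mul_realVec_top {L k : ℕ} (hk : k ≤ L) (τ : ℝ) :
    ladder q L (k + 1) * realVec q L L τ (k + 1) = (q : ℝ) ^ τ * (q : ℝ) ^ (-(1 / 2) : ℝ) /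
      ((q : ℝ)⁻¹ - q) * ((q : ℝ) ^ ((k : ℝ) - (L : ℝ) / 2) -
        (q : ℝ) ^ L * (q : ℝ) ^ ((L : ℝ) / 2 - k)) * realVec q L L τ k := by
  have hq := q.2.1
  rw [ladder_mul_realVec_succ q hk, realVec_top, sub_self, Int.zero_ediv, Int.toNat_zero,
    dualQKrawtchouk_zero_right]
  have e1 : (q : ℝ) ^ (-((L : ℝ) + 1) / 2) =
      (q : ℝ) ^ (-(1 / 2) : ℝ) * ((q : ℝ) ^ ((L : ℝ) / 2))⁻¹ := by
    rw [← Real.rpow_neg hq.le, ← Real.rpow_add hq]; congr 1; ring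
  have e4 : (q : ℝ) ^ ((k : ℝ) - (L : ℝ) / 2) = (q : ℝ) ^ k / (q : ℝ) ^ ((L : ℝ) / 2) := by
    rw [Real.rpow_sub hq, Real.rpow_natCast]
  have e5 : (q : ℝ) ^ ((L : ℝ) / 2 - k) = (q : ℝ) ^ ((L : ℝ) / 2) / (q : ℝ) ^ k := by
    rw [Real.rpow_sub hq, Real.rpow_natCast]
  have e6 : (q : ℝ) ^ L = ((q : ℝ) ^ ((L : ℝ) / 2)) ^ 2 := by
    rw [← Real.rpow_natCast, ← Real.rpow_mul_natCast hq.le]; congr 1; push_cast; ring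
  have e7 : (q : ℝ) ^ (2 * (L - k)) = ((q : ℝ) ^ L) ^ 2 / ((q : ℝ) ^ k) ^ 2 := by
    rw [eq_div_iff (pow_ne_zero _ (pow_ne_zero _ hq.ne')), ← pow_mul, ← pow_mul, ← pow_add]
    congr 1; omega
  rw [e1, e4, e5, e7, e6]
  have hl := (Real.rpow_pos_of_pos hq ((L : ℝ) / 2)).ne'
  have hy := pow_ne_zero k hq.ne'
  have hκ := (inv_sub_pos q).ne'
  generalize (q : ℝ)⁻¹ - q = κ at *
  field_simp

theorem vecMul_star_vec_top_B (L : ℕ) (τ : ℝ) :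
    Matrix.vecMul (star (vec q L L τ)) (rep q L (ug q .B)) =
      (Complex.I * (((q : ℝ) ^ τ * (q : ℝ) ^ (-(1 / 2) : ℝ) / ((q : ℝ)⁻¹ - q) : ℝ) : ℂ)) •
        (Matrix.vecMul (star (vec q L L τ)) (rep q L (ug q .A)) -
          (((q : ℝ) ^ L : ℝ) : ℂ) •
            Matrix.vecMul (star (vec q L L τ)) (rep q L (ug q .D))) := by
  rw [star_vec_eq, rep_ug, rep_ug, rep_ug]
  ext k
  rw [vecMul_repGen_B, Pi.smul_apply, Pi.sub_apply, Pi.smul_apply, vecMul_repGen_A,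
    vecMul_repGen_D]
  have h := congrArg (fun x : ℝ => (x : ℂ)) (ladder_mul_realVec_top (Nat.lt_succ_iff.1 k.2) τ
    (q := q))
  simp only [Complex.ofReal_mul, Complex.ofReal_sub] at h
  simp only [starVec, smul_eq_mul, qpow, pow_succ]
  linear_combination (Complex.I ^ (k : ℕ) * Complex.I) * h

/-- For `i = l` the value at `B A^{p+1}` is a combination of torus values by
`vecMul_star_vec_top_B`. Equating this with the value found in `Covariant.pairing_A_pow_mul_B` gives
an equation of first order. -/
theorem torusVal_extremal {L : ℕ} {J : ℤ} (hJ : IsWeight L J) (τ σ : ℝ) (p : ℕ) :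
    torusVal q L L J τ σ (p + 2) * (qdiff q τ - (q : ℝ) ^ (p + 1) * qdiff q σ +
      (q : ℝ) ^ τ * (((q : ℝ) ^ (p + 1)) ^ 2 - 1)) =
    torusVal q L L J τ σ p * (qdiff q (τ + L) - (q : ℝ) ^ (p + 1) * qdiff q (σ + J) +
      (q : ℝ) ^ τ * (q : ℝ) ^ L * (((q : ℝ) ^ (p + 1)) ^ 2 - 1)) := by
  have h1 := (covariant_defMatElt (q := q) (isWeight_self L) hJ τ σ).pairing_A_pow_mul_B p
  have h2 : pairing q (defMatElt q L L J τ σ) (ug q .B * ug q .A ^ (p + 1)) =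
      (Complex.I * (((q : ℝ) ^ τ * (q : ℝ) ^ (-(1 / 2) : ℝ) / ((q : ℝ)⁻¹ - q) : ℝ) : ℂ)) *
        (torusVal q L L J τ σ (p + 2) - (((q : ℝ) ^ L : ℝ) : ℂ) * torusVal q L L J τ σ p) := by
    rw [← pairing_defMatElt_A_pow, ← pairing_defMatElt_A_pow, ← D_mul_A_pow_succ p,
      pow_succ' _ (p + 1)]
    simp only [pairing_defMatElt, map_mul _ (ug q _), ← Matrix.mulVec_mulVec]
    rw [Matrix.dotProduct_mulVec, vecMul_star_vec_top_B, smul_dotProduct, sub_dotProduct,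
      smul_dotProduct, ← Matrix.dotProduct_mulVec, ← Matrix.dotProduct_mulVec, smul_eq_mul,
      smul_eq_mul]
  rw [B_mul_A_pow, pairing_smul_apply] at h2
  have hz : qc q ^ (p + 1) = (((q : ℝ) ^ (p + 1) : ℝ) : ℂ) := by rw [qc, ← Complex.ofReal_pow]
  have hz0 : (q : ℝ) ^ (p + 1) ≠ 0 := pow_ne_zero _ q.2.1.ne'
  have hκ := (inv_sub_pos q).ne'
  have hh : qpow q (1 / 2) * (((q : ℝ) ^ (-(1 / 2) : ℝ) : ℝ) : ℂ) = 1 := qpow_half_mul_neg q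
  have e : ∀ x : ℝ, ∃ y : ℝ, y = x / ((q : ℝ)⁻¹ - q) ∧ x = ((q : ℝ)⁻¹ - q) * y :=
    fun x => ⟨_, rfl, by rw [mul_div_cancel₀ _ hκ]⟩
  obtain ⟨s, hs1, hs2⟩ := e (qdiff q σ)
  obtain ⟨s', hs1', hs2'⟩ := e (qdiff q (σ + J))
  obtain ⟨t, ht1, ht2⟩ := e (qdiff q τ)
  obtain ⟨t', ht1', ht2'⟩ := e (qdiff q (τ + L))
  obtain ⟨g, hg1, hg2⟩ := e ((q : ℝ) ^ τ)
  simp only [pairing_defMatElt_A_pow, twEig, sub_div, Int.cast_natCast] at h1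
  rw [← hs1, ← hs1', ← ht1, ← ht1', hz] at h1
  rw [mul_div_right_comm, ← hg1, hz] at h2
  rw [hs2, hs2', ht2, ht2', hg2]
  generalize torusVal q L L J τ σ p = F1 at *
  generalize torusVal q L L J τ σ (p + 2) = F2 at *
  generalize (q : ℝ) ^ (p + 1) = z at *
  generalize (q : ℝ) ^ L = y at *
  generalize pairing q (defMatElt q L L J τ σ) _ = b at *
  generalize qpow q (1 / 2) = h at *
  generalize (q : ℝ) ^ (-(1 / 2) : ℝ) = h' at *
  generalize (q : ℝ)⁻¹ - q = κ at *
  apply Complex.ofReal_injective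
  push_cast at h1 h2 hh ⊢
  have hz' : (z : ℂ) ≠ 0 := by exact_mod_cast hz0
  have e5 : (z : ℂ) * (z : ℂ)⁻¹ = 1 := mul_inv_cancel₀ hz'
  have hb : h * b * Complex.I = -z * g * (F2 - y * F1) := by
    have : b = z * (Complex.I * (g * h') * (F2 - y * F1)) := by
      rw [← h2, ← mul_assoc, e5, one_mul]
    rw [this]
    linear_combination (z * g * (F2 - y * F1)) * (Complex.I * Complex.I * hh + Complex.I_mul_I)
  linear_combination (κ : ℂ) * (-h1 + (z - (z : ℂ)⁻¹) * hb) + (κ : ℂ) * g * (F2 - y * F1) * e5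

end Extremal

/-! ### The Askey-Wilson `q`-difference equation -/

section AskeyWilson
variable {a b c d Q z : ℝ}

/-- The function `(az, a/z; Q)_k`. -/
def awBasis (a Q : ℝ) (k : ℕ) (z : ℝ) : ℝ := qPoch (a * z) Q k * qPoch (a * z⁻¹) Q k

/-- The coefficient of the Askey-Wilson operator. -/
def awCoeff (a b c d Q z : ℝ) : ℝ :=
  (1 - a * z) * (1 - b * z) * (1 - c * z) * (1 - d * z) / ((1 - z ^ 2) * (1 - Q * z ^ 2))

/-- The Askey-Wilson operator. -/
def awOp (a b c d Q : ℝ) (f : ℝ → ℝ) (z : ℝ) : ℝ :=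
  awCoeff a b c d Q z * (f (Q * z) - f z) + awCoeff a b c d Q z⁻¹ * (f (z / Q) - f z)

theorem awBasis_shift (hQ : Q ≠ 0) (hz : z ≠ 0) (k : ℕ) (a : ℝ) :
    (1 - a * z) * (awBasis a Q (k + 1) (Q * z) - awBasis a Q (k + 1) z) =
      -(a / (Q * z)) * (1 - Q ^ (k + 1)) * (1 - Q * z ^ 2) *
        (awBasis a Q k z * (1 - a * Q ^ k * z)) := by
  have h1 := qPoch_succ' (a * z) Q k
  have h2 := qPoch_succ' (a * (Q * z)⁻¹) Q k
  have h3 := qPoch_succ (a * z) Q k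
  rw [show a * (Q * z)⁻¹ * Q = a * z⁻¹ by field_simp] at h2
  rw [show a * z * Q = a * (Q * z) by ring, h3] at h1
  rw [awBasis, awBasis, awBasis, qPoch_succ (a * (Q * z)), h2, h3, qPoch_succ (a * z⁻¹)]
  have e : (1 - a * (Q * z) * Q ^ k) * (1 - a * (Q * z)⁻¹) -
      (1 - a * z) * (1 - a * z⁻¹ * Q ^ k) =
      -(a / (Q * z)) * (1 - Q ^ (k + 1)) * (1 - Q * z ^ 2) := by
    field_simp; ring
  linear_combination (-(1 - a * (Q * z) * Q ^ k) * (1 - a * (Q * z)⁻¹) * qPoch (a * z⁻¹) Q k) * h1 +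
    (qPoch (a * z⁻¹) Q k * qPoch (a * z) Q k * (1 - a * z * Q ^ k)) * e

theorem awBasis_inv (a Q : ℝ) (k : ℕ) (z : ℝ) : awBasis a Q k z⁻¹ = awBasis a Q k z := by
  rw [awBasis, awBasis, inv_inv, mul_comm]

theorem awCoeff_mul_shift (hQ : Q ≠ 0) (hz : z ≠ 0) (hz2 : 1 - Q * z ^ 2 ≠ 0) (k : ℕ) :
    awCoeff a b c d Q z * (awBasis a Q (k + 1) (Q * z) - awBasis a Q (k + 1) z) =
      -(a / Q) * (1 - Q ^ (k + 1)) * awBasis a Q k z *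
        ((1 - b * z) * (1 - c * z) * (1 - d * z) * (1 - a * Q ^ k * z) / (z * (1 - z ^ 2))) := by
  have h := awBasis_shift hQ hz k a
  calc _ = (1 - b * z) * (1 - c * z) * (1 - d * z) / ((1 - z ^ 2) * (1 - Q * z ^ 2)) *
      ((1 - a * z) * (awBasis a Q (k + 1) (Q * z) - awBasis a Q (k + 1) z)) := by
        rw [awCoeff]; ring
    _ = _ := by
      rw [h]
      generalize 1 - Q * z ^ 2 = w at *
      field_simp

/-- The Askey-Wilson operator is bidiagonal on the basis `(az, a/z; Q)_k`: the poles in the two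
shifted terms cancel after `z` and `z⁻¹` are combined. -/
theorem awOp_awBasis (hQ : Q ≠ 0) (hz : z ≠ 0) (hz1 : 1 - z ^ 2 ≠ 0) (hz2 : 1 - Q * z ^ 2 ≠ 0)
    (hz3 : z ^ 2 - Q ≠ 0) (k : ℕ) :
    awOp a b c d Q (awBasis a Q (k + 1)) z = (1 - Q ^ (k + 1)) / Q ^ (k + 1) *
      ((1 - a * b * c * d * Q ^ k) * awBasis a Q (k + 1) z -
        (1 - a * b * Q ^ k) * (1 - a * c * Q ^ k) * (1 - a * d * Q ^ k) * awBasis a Q k z) := by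
  have h1 := awCoeff_mul_shift (a := a) (b := b) (c := c) (d := d) hQ hz hz2 k
  have h2 := awCoeff_mul_shift (a := a) (b := b) (c := c) (d := d) hQ (inv_ne_zero hz)
    (by rw [inv_pow, ← div_eq_mul_inv, one_sub_div (pow_ne_zero _ hz)]
        exact div_ne_zero hz3 (pow_ne_zero _ hz)) k
  rw [show Q * z⁻¹ = (z / Q)⁻¹ by rw [inv_div, div_eq_mul_inv], awBasis_inv, awBasis_inv,
    awBasis_inv] at h2
  rw [awOp, h1, h2]
  have h3 : awBasis a Q (k + 1) z = awBasis a Q k z *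
      ((1 - a * Q ^ k * z) * (1 - a * Q ^ k * z⁻¹)) := by
    simp only [awBasis, qPoch_succ]; ring
  rw [h3]
  have hz4 : z ^ 2 - 1 ≠ 0 := fun h => hz1 (by linarith)
  have h5 : (1 - b * z) * (1 - c * z) * (1 - d * z) * (1 - a * Q ^ k * z) / (z * (1 - z ^ 2)) +
      (1 - b * z⁻¹) * (1 - c * z⁻¹) * (1 - d * z⁻¹) * (1 - a * Q ^ k * z⁻¹) /
        (z⁻¹ * (1 - z⁻¹ ^ 2)) = (1 - b * c * d * (a * Q ^ k)) * (z + z⁻¹) -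
        (b + c + d + a * Q ^ k - (b * c * d + (a * Q ^ k) * (b * c + b * d + c * d))) := by
    have : z⁻¹ * (1 - z⁻¹ ^ 2) = -((1 - z ^ 2) / z ^ 3) := by field_simp; ring
    rw [this]
    generalize a * Q ^ k = α
    field_simp
    ring
  rw [← mul_add, h5, pow_succ]
  have hk := pow_ne_zero k hQ
  generalize Q ^ k = y at *
  field_simp
  ring

theorem awOp_sum {ι : Type*} (s : Finset ι) (C : ι → ℝ) (φ : ι → ℝ → ℝ) :
    awOp a b c d Q (fun z => ∑ i ∈ s, C i * φ i z) z = ∑ i ∈ s, C i * awOp a b c d Q (φ i) z := by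
  simp only [awOp, ← Finset.sum_sub_distrib, Finset.mul_sum, ← Finset.sum_add_distrib]
  exact Finset.sum_congr rfl fun i _ => by ring

/-- The coefficients of the Askey-Wilson polynomials. -/
def awTerm (a b c d Q : ℝ) (n k : ℕ) : ℝ :=
  qPoch (Q ^ (-(n : ℤ))) Q k * qPoch (a * b * c * d * Q ^ ((n : ℤ) - 1)) Q k /
    (qPoch (a * b) Q k * qPoch (a * c) Q k * qPoch (a * d) Q k * qPoch Q Q k) * Q ^ k

theorem awTerm_succ (n k : ℕ) (hQ : 0 < Q) (hQ1 : Q < 1)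
    (hab : qPoch (a * b) Q (k + 1) ≠ 0) (hac : qPoch (a * c) Q (k + 1) ≠ 0)
    (had : qPoch (a * d) Q (k + 1) ≠ 0) :
    awTerm a b c d Q n (k + 1) * ((1 - Q ^ (k + 1)) * ((1 - a * b * Q ^ k) * (1 - a * c * Q ^ k) *
      (1 - a * d * Q ^ k))) = awTerm a b c d Q n k * Q *
        ((1 - Q ^ (-(n : ℤ)) * Q ^ k) * (1 - a * b * c * d * Q ^ ((n : ℤ) - 1) * Q ^ k)) := by
  have hq := (qPoch_self_pos hQ hQ1 (k + 1)).ne'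
  simp only [awTerm, qPoch_succ] at *
  rw [← pow_succ'] at *
  have h1 := left_ne_zero_of_mul hab
  have h2 := right_ne_zero_of_mul hab
  have h3 := left_ne_zero_of_mul hac
  have h4 := right_ne_zero_of_mul hac
  have h5 := left_ne_zero_of_mul had
  have h6 := right_ne_zero_of_mul had
  have h7 := left_ne_zero_of_mul hq
  have h8 := right_ne_zero_of_mul hq
  generalize qPoch _ _ _ = x1 at *
  generalize qPoch _ _ _ = x2 at *
  generalize qPoch _ _ _ = x3 at *
  generalize qPoch _ _ _ = x4 at *
  generalize qPoch _ _ _ = x5 at *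
  generalize qPoch _ _ _ = x6 at *
  rw [div_mul_eq_mul_div, div_mul_eq_mul_div, div_mul_eq_mul_div, div_mul_eq_mul_div,
    div_mul_eq_mul_div, div_eq_div_iff (by simp [*]) (by simp [*])]
  ring

/-- Applying the operator minus its eigenvalue to the basis expansion telescopes. The boundary term
carries the factor `1 - Q^{K-n}`, which vanishes at `K = n`. -/
theorem awOp_partial_sum (n K : ℕ) (hQ : 0 < Q) (hQ1 : Q < 1) (hz : z ≠ 0) (hz1 : 1 - z ^ 2 ≠ 0)
    (hz2 : 1 - Q * z ^ 2 ≠ 0) (hz3 : z ^ 2 - Q ≠ 0)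
    (hab : qPoch (a * b) Q K ≠ 0) (hac : qPoch (a * c) Q K ≠ 0)
    (had : qPoch (a * d) Q K ≠ 0) :
    ∑ k ∈ Finset.range (K + 1), awTerm a b c d Q n k * (awOp a b c d Q (awBasis a Q k) z -
      (Q ^ (-(n : ℤ)) - 1) * (1 - a * b * c * d * Q ^ ((n : ℤ) - 1)) * awBasis a Q k z) =
    awTerm a b c d Q n K * awBasis a Q K z / Q ^ K *
      ((1 - Q ^ (-(n : ℤ)) * Q ^ K) * (1 - a * b * c * d * Q ^ ((n : ℤ) - 1) * Q ^ K)) := by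
  induction K with
  | zero =>
    rw [Finset.sum_range_one]
    simp [awOp, awBasis, qPoch_zero]
    ring
  | succ K ih =>
    have h := awTerm_succ (a := a) (b := b) (c := c) (d := d) n K hQ hQ1 hab hac had
    rw [Finset.sum_range_succ, ih (left_ne_zero_of_mul (qPoch_succ _ _ _ ▸ hab))
      (left_ne_zero_of_mul (qPoch_succ _ _ _ ▸ hac)) (left_ne_zero_of_mul (qPoch_succ _ _ _ ▸ had)),
      awOp_awBasis hQ.ne' hz hz1 hz2 hz3]
    have hk := pow_ne_zero K hQ.ne'
    have h0 := hQ.ne'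
    rw [mul_div_right_comm, mul_div_right_comm]
    have h' : awTerm a b c d Q n K / Q ^ K *
        ((1 - Q ^ (-(n : ℤ)) * Q ^ K) * (1 - a * b * c * d * Q ^ ((n : ℤ) - 1) * Q ^ K)) =
        awTerm a b c d Q n (K + 1) * ((1 - Q ^ (K + 1)) * ((1 - a * b * Q ^ K) *
          (1 - a * c * Q ^ K) * (1 - a * d * Q ^ K))) / Q ^ (K + 1) := by
      rw [h, pow_succ]; field_simp
    have hX : a * b * c * d * Q ^ K = a * b * c * d * Q ^ ((n : ℤ) - 1) * Q ^ (-(n : ℤ)) * Q * Q ^ K := by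
      have : Q ^ ((n : ℤ) - 1) * Q ^ (-(n : ℤ)) * Q = 1 := by
        rw [← zpow_add₀ h0, ← zpow_add_one₀ h0, show (n : ℤ) - 1 + -n + 1 = 0 by ring, zpow_zero]
      linear_combination (-(a * b * c * d * Q ^ K)) * this
    have hs : awTerm a b c d Q n K / Q ^ K * awBasis a Q K z *
        ((1 - Q ^ (-(n : ℤ)) * Q ^ K) * (1 - a * b * c * d * Q ^ ((n : ℤ) - 1) * Q ^ K)) =
        awTerm a b c d Q n (K + 1) * ((1 - Q ^ (K + 1)) * ((1 - a * b * Q ^ K) *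
          (1 - a * c * Q ^ K) * (1 - a * d * Q ^ K))) / Q ^ (K + 1) * awBasis a Q K z := by
      rw [← h']; ring
    rw [hs, hX]
    generalize Q ^ (-(n : ℤ)) = u at *
    generalize a * b * c * d * Q ^ ((n : ℤ) - 1) = v at *
    rw [pow_succ]
    field_simp
    ring

theorem askeyWilson_eval (n : ℕ) (hz : z ≠ 0) : (askeyWilson n a b c d Q).eval ((z + z⁻¹) / 2) =
    a⁻¹ ^ n * (qPoch (a * b) Q n * qPoch (a * c) Q n * qPoch (a * d) Q n) *
      ∑ k ∈ Finset.range (n + 1), awTerm a b c d Q n k * awBasis a Q k z := by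
  rw [askeyWilson, Polynomial.eval_mul, Polynomial.eval_C, Polynomial.eval_finsetSum]
  congr 1
  refine Finset.sum_congr rfl fun k _ => ?_
  rw [Polynomial.eval_mul, Polynomial.eval_C, Polynomial.eval_prod, awTerm]
  congr 1
  rw [awBasis, qPoch, qPoch, ← Finset.prod_mul_distrib]
  refine Finset.prod_congr rfl fun r _ => ?_
  simp only [Polynomial.eval_add, Polynomial.eval_sub, Polynomial.eval_mul, Polynomial.eval_one,
    Polynomial.eval_C, Polynomial.eval_X]
  rw [mul_comm 2 r, pow_mul]
  linear_combination (-(a * Q ^ r) ^ 2) * mul_inv_cancel₀ hz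

theorem awOp_askeyWilson (n : ℕ) (hQ : 0 < Q) (hQ1 : Q < 1) (hz : z ≠ 0) (hz1 : 1 - z ^ 2 ≠ 0)
    (hz2 : 1 - Q * z ^ 2 ≠ 0) (hz3 : z ^ 2 - Q ≠ 0)
    (hab : qPoch (a * b) Q n ≠ 0) (hac : qPoch (a * c) Q n ≠ 0)
    (had : qPoch (a * d) Q n ≠ 0) :
    awOp a b c d Q (fun z => (askeyWilson n a b c d Q).eval ((z + z⁻¹) / 2)) z =
      (Q ^ (-(n : ℤ)) - 1) * (1 - a * b * c * d * Q ^ ((n : ℤ) - 1)) *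
        (askeyWilson n a b c d Q).eval ((z + z⁻¹) / 2) := by
  have h := awOp_partial_sum (a := a) (b := b) (c := c) (d := d) n n hQ hQ1 hz hz1 hz2 hz3
    hab hac had
  have h0 : Q ^ (-(n : ℤ)) * Q ^ n = 1 := by
    rw [zpow_neg, zpow_natCast, inv_mul_cancel₀ (pow_ne_zero _ hQ.ne')]
  rw [h0, sub_self, zero_mul, mul_zero] at h
  have e : ∀ (X Y : ℕ → ℝ) (C : ℝ), ∑ k ∈ Finset.range (n + 1), awTerm a b c d Q n k *
      (X k - C * Y k) = ∑ k ∈ Finset.range (n + 1), awTerm a b c d Q n k * X k -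
        C * ∑ k ∈ Finset.range (n + 1), awTerm a b c d Q n k * Y k := fun X Y C => by
    rw [Finset.mul_sum, ← Finset.sum_sub_distrib]
    exact Finset.sum_congr rfl fun _ _ => by ring
  rw [e, ← awOp_sum] at h
  rw [awOp, askeyWilson_eval _ hz, askeyWilson_eval _ (mul_ne_zero hQ.ne' hz),
    askeyWilson_eval _ (div_ne_zero hz hQ.ne')]
  rw [awOp] at h
  linear_combination a⁻¹ ^ n * (qPoch (a * b) Q n * qPoch (a * c) Q n * qPoch (a * d) Q n) * h

end AskeyWilson

/-! ### Polynomials on the torus -/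

section Torus
variable {q : Set.Ioo (0 : ℝ) 1}
open Polynomial Filter Topology

theorem qPoch_zpow_neg_self {Q : ℝ} (hQ : Q ≠ 0) (n : ℕ) :
    qPoch (Q ^ (-(n : ℤ))) Q n * Q ^ n * ∏ r ∈ Finset.range n, -Q ^ r = qPoch Q Q n := by
  have h1 : Q ^ n * ∏ r ∈ Finset.range n, -Q ^ r = ∏ r ∈ Finset.range n, -Q ^ (n - r) := by
    rw [← Finset.prod_range_reflect (fun r => -Q ^ (n - r)), ← Finset.card_range n,
      ← Finset.prod_const, Finset.card_range, ← Finset.prod_mul_distrib]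
    refine Finset.prod_congr rfl fun r hr => ?_
    rw [Finset.mem_range] at hr
    rw [show n - (n - 1 - r) = r + 1 by omega, pow_succ]; ring
  rw [mul_assoc, h1, qPoch, qPoch, ← Finset.prod_mul_distrib,
    ← Finset.prod_range_reflect (fun r => 1 - Q * Q ^ r)]
  refine Finset.prod_congr rfl fun r hr => ?_
  rw [Finset.mem_range] at hr
  rw [← pow_succ', show n - 1 - r + 1 = n - r by omega]
  have : Q ^ (-(n : ℤ)) * Q ^ r * Q ^ (n - r) = 1 := by
    rw [mul_assoc, ← pow_add, show r + (n - r) = n by omega, zpow_neg, zpow_natCast,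
      inv_mul_cancel₀ (pow_ne_zero _ hQ)]
  linear_combination this

/-- The polynomial `z ↦ zⁿ pₙ((z + z⁻¹) / 2)` has degree at most `2 n` and constant term
`(a b c d Qⁿ⁻¹; Q)ₙ`. -/
theorem exists_laurent_askeyWilson {a b c d Q : ℝ} (n : ℕ) (hQ : 0 < Q) (hQ1 : Q < 1) (ha : a ≠ 0)
    (hab : qPoch (a * b) Q n ≠ 0) (hac : qPoch (a * c) Q n ≠ 0) (had : qPoch (a * d) Q n ≠ 0) :
    ∃ Y : ℝ[X], Y.natDegree ≤ 2 * n ∧ Y.eval 0 = qPoch (a * b * c * d * Q ^ ((n : ℤ) - 1)) Q n ∧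
      ∀ z : ℝ, z ≠ 0 → Y.eval z = z ^ n * (askeyWilson n a b c d Q).eval ((z + z⁻¹) / 2) := by
  refine ⟨∑ k ∈ Finset.range (n + 1),
    C (a⁻¹ ^ n * (qPoch (a * b) Q n * qPoch (a * c) Q n * qPoch (a * d) Q n) *
      awTerm a b c d Q n k) * (X ^ (n - k) *
      ∏ r ∈ Finset.range k, ((1 - C (a * Q ^ r) * X) * (X - C (a * Q ^ r)))), ?_, ?_, ?_⟩
  · refine natDegree_sum_le_of_forall_le _ _ fun k hk => ?_
    rw [Finset.mem_range] at hk
    refine (natDegree_C_mul_le _ _).trans (natDegree_mul_le.trans ?_)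
    have h1 : (∏ r ∈ Finset.range k, ((1 - C (a * Q ^ r) * X) * (X - C (a * Q ^ r)))).natDegree ≤
        k * 2 := by
      refine (natDegree_prod_le _ _).trans ((Finset.sum_le_card_nsmul _ _ 2 fun r _ => ?_).trans
        (by simp))
      compute_degree
    have h2 := natDegree_X_pow_le (R := ℝ) (n - k)
    omega
  -- At `z = 0` the factor `X^{n-k}` leaves only the term `k = n`.
  · rw [eval_finsetSum, Finset.sum_range_succ, Finset.sum_eq_zero, zero_add]
    · simp only [eval_mul, eval_C, eval_prod, eval_sub, eval_X, eval_one, Nat.sub_self, pow_zero,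
        mul_zero, sub_zero, one_mul, zero_sub]
      have h1 : ∏ r ∈ Finset.range n, -(a * Q ^ r) = a ^ n * ∏ r ∈ Finset.range n, -Q ^ r := by
        rw [← Finset.card_range n, ← Finset.prod_const, Finset.card_range,
          ← Finset.prod_mul_distrib]
        exact Finset.prod_congr rfl fun r _ => by ring
      have h2 := qPoch_zpow_neg_self hQ.ne' n
      have h3 := (qPoch_self_pos hQ hQ1 n).ne'
      have h4 := pow_ne_zero n ha
      rw [h1, awTerm, ← h2, inv_pow]
      rw [← h2] at h3
      have h5 := right_ne_zero_of_mul h3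
      have h6 := left_ne_zero_of_mul h3
      have h7 := right_ne_zero_of_mul h6
      have h8 := left_ne_zero_of_mul h6
      field_simp
    · intro k hk
      rw [Finset.mem_range] at hk
      rw [eval_mul, eval_mul, eval_pow, eval_X, zero_pow (by omega), zero_mul, mul_zero]
  · intro z hz
    rw [askeyWilson_eval _ hz, eval_finsetSum, Finset.mul_sum, Finset.mul_sum]
    refine Finset.sum_congr rfl fun k hk => ?_
    rw [Finset.mem_range] at hk
    have h1 : z ^ n = z ^ (n - k) * ∏ _r ∈ Finset.range k, z := by
      rw [Finset.prod_const, Finset.card_range, ← pow_add]; congr 1; omega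
    have h2 : (∏ _r ∈ Finset.range k, z) * awBasis a Q k z =
        ∏ r ∈ Finset.range k, ((1 - a * Q ^ r * z) * (z - a * Q ^ r)) := by
      rw [awBasis, qPoch, qPoch, ← Finset.prod_mul_distrib, ← Finset.prod_mul_distrib]
      refine Finset.prod_congr rfl fun r _ => ?_
      field_simp
    simp only [eval_mul, eval_C, eval_prod, eval_sub, eval_X, eval_one, eval_pow]
    rw [← h2, h1]
    ring

theorem CasimirEq.sub {Q S SJ T TI ω z Fm F Fp Gm G Gp : ℝ}
    (hF : CasimirEq Q S SJ T TI ω z Fm F Fp) (hG : CasimirEq Q S SJ T TI ω z Gm G Gp) :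
    CasimirEq Q S SJ T TI ω z (Fm - Gm) (F - G) (Fp - Gp) := by
  rw [CasimirEq] at *
  linear_combination hF - hG

theorem CasimirEq.const_mul {Q S SJ T TI ω z Fm F Fp : ℝ} (c : ℝ)
    (hF : CasimirEq Q S SJ T TI ω z Fm F Fp) :
    CasimirEq Q S SJ T TI ω z (c * Fm) (c * F) (c * Fp) := by
  rw [CasimirEq] at *
  linear_combination c * hF

theorem casimirEq_clear {Q S SJ T TI ω z Fm F Fp : ℝ} (hQ : Q ≠ 0) (hz : z ≠ 0)
    (h : CasimirEq Q S SJ T TI ω z Fm F Fp) :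
    (Q * z ^ 2 - Q⁻¹) * (z ^ 2 / Q - Q) *
      ((ω * F - Q * Fm - Q⁻¹ * Fp) - z ^ 2 * (ω * F - Q⁻¹ * Fm - Q * Fp)) +
    z * (z ^ 2 / Q - Q) * ((Q * z * SJ - TI) * F + (T - Q * z * S) * Fp) * (S / Q - T * z) +
    z * (Q * z ^ 2 - Q⁻¹) * ((z / Q * SJ - TI) * Fm + (T - z / Q * S) * F) *
      (TI * z - Q * SJ) = 0 := by
  rw [CasimirEq] at h
  rw [← mul_zero (z ^ 3), ← h]
  field_simp

/-- A Frobenius argument at `z = 0`. Write `Y = z^e Y₁` with `Y₁(0) ≠ 0`. The equation holds at the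
points `z = q^{p+2}`, which tend to zero, and its limit is the indicial equation `(q^{2e} -
1)(q^{2(L+1)} - q^{2e}) = 0`. Its roots `0` and `L + 1` are excluded because `Y(0) = 0` gives `e ≥
1` and the degree gives `e ≤ L`. -/
theorem casimirEq_unique {L : ℕ} {S SJ T TI : ℝ} {H : ℕ → ℝ} {Y : ℝ[X]}
    (hY : ∀ p, ((q : ℝ) ^ ((L : ℝ) / 2)) ^ (p + 1) * H p = Y.eval ((q : ℝ) ^ p))
    (hdeg : Y.natDegree ≤ L) (h0 : Y.eval 0 = 0)
    (hH : ∀ p, CasimirEq q S SJ T TI ((q : ℝ) ^ (L + 1) + ((q : ℝ) ^ (L + 1))⁻¹)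
      ((q : ℝ) ^ (p + 2)) (H p) (H (p + 2)) (H (p + 4))) (p : ℕ) : H p = 0 := by
  have hq := q.2.1
  have hl := Real.rpow_pos_of_pos hq ((L : ℝ) / 2)
  suffices hY0 : Y = 0 by
    have := hY p
    rw [hY0, eval_zero] at this
    exact (mul_eq_zero.1 this).resolve_left (pow_ne_zero _ hl.ne')
  by_contra hne
  obtain ⟨Y₁, hY₁, hdvd⟩ := exists_eq_pow_rootMultiplicity_mul_and_not_dvd Y hne 0
  rw [dvd_iff_isRoot, IsRoot.def] at hdvd
  rw [C_0, sub_zero] at hY₁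
  set e := rootMultiplicity 0 Y
  have he1 : 0 < e := (rootMultiplicity_pos hne).2 h0
  have he2 : e ≤ L := by
    refine le_trans ?_ hdeg
    have hY₁0 : Y₁ ≠ 0 := by rintro rfl; simp at hdvd
    rw [hY₁, natDegree_mul (pow_ne_zero _ X_ne_zero) hY₁0, natDegree_X_pow]
    exact Nat.le_add_right _ _
  have hl2 : ((q : ℝ) ^ ((L : ℝ) / 2)) ^ 2 = (q : ℝ) ^ L := by
    rw [← Real.rpow_natCast, ← Real.rpow_mul hq.le, ← Real.rpow_natCast]; congr 1; push_cast; ring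
  set u := (q : ℝ) ^ L with hu
  set w := ((q : ℝ) ^ 2) ^ e with hw
  have hu0 : 0 < u := pow_pos hq _
  have hw0 : 0 < w := pow_pos (pow_pos hq _) _
  -- The cleared equation divided by `z^e`. The ratios `u / w` and `w / u` record how `z^e` and the
  -- prefactor `(q^{L/2})^{p+1}` change when `p` moves by two.
  let Ψ : ℝ → ℝ := fun z => (q * z ^ 2 - (q : ℝ)⁻¹) * (z ^ 2 / q - q) *
      ((((q : ℝ) ^ (L + 1) + ((q : ℝ) ^ (L + 1))⁻¹) * Y₁.eval z -
        q * (u / w * Y₁.eval (z / (q : ℝ) ^ 2)) - (q : ℝ)⁻¹ * (w / u * Y₁.eval ((q : ℝ) ^ 2 * z))) -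
      z ^ 2 * (((q : ℝ) ^ (L + 1) + ((q : ℝ) ^ (L + 1))⁻¹) * Y₁.eval z -
        (q : ℝ)⁻¹ * (u / w * Y₁.eval (z / (q : ℝ) ^ 2)) -
        q * (w / u * Y₁.eval ((q : ℝ) ^ 2 * z)))) +
    z * (z ^ 2 / q - q) * ((q * z * SJ - TI) * Y₁.eval z +
      (T - q * z * S) * (w / u * Y₁.eval ((q : ℝ) ^ 2 * z))) * (S / q - T * z) +
    z * (q * z ^ 2 - (q : ℝ)⁻¹) * ((z / q * SJ - TI) * (u / w * Y₁.eval (z / (q : ℝ) ^ 2)) +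
      (T - z / q * S) * Y₁.eval z) * (TI * z - q * SJ)
  have hcont : Continuous Ψ := by
    have h1 : Continuous fun z : ℝ => Y₁.eval z := Y₁.continuous
    have h2 : Continuous fun z : ℝ => Y₁.eval (z / (q : ℝ) ^ 2) :=
      Y₁.continuous.comp (continuous_id.div_const _)
    have h3 : Continuous fun z : ℝ => Y₁.eval ((q : ℝ) ^ 2 * z) :=
      Y₁.continuous.comp (continuous_const.mul continuous_id)
    fun_prop
  have hzero : ∀ p : ℕ, Ψ ((q : ℝ) ^ (p + 2)) = 0 := fun p => by
    have hz : (q : ℝ) ^ (p + 2) ≠ 0 := pow_ne_zero _ hq.ne'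
    have h1 := casimirEq_clear hq.ne' hz
      ((hH p).const_mul (((q : ℝ) ^ ((L : ℝ) / 2)) ^ (p + 3)))
    have e1 : ((q : ℝ) ^ ((L : ℝ) / 2)) ^ (p + 3) * H (p + 2) =
        ((q : ℝ) ^ (p + 2)) ^ e * Y₁.eval ((q : ℝ) ^ (p + 2)) := by
      rw [hY (p + 2), hY₁, eval_mul, eval_pow, eval_X]
    have e2 : ((q : ℝ) ^ ((L : ℝ) / 2)) ^ (p + 3) * H p = ((q : ℝ) ^ (p + 2)) ^ e *
        (u / w * Y₁.eval ((q : ℝ) ^ (p + 2) / (q : ℝ) ^ 2)) := by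
      have : (q : ℝ) ^ (p + 2) / (q : ℝ) ^ 2 = (q : ℝ) ^ p := by
        rw [pow_add, mul_div_cancel_right₀ _ (pow_ne_zero _ hq.ne')]
      have h4 := hY p
      rw [hY₁, eval_mul, eval_pow, eval_X] at h4
      rw [this, show p + 3 = p + 1 + 2 from rfl, pow_add _ (p + 1) 2, hl2, pow_add _ p 2, mul_pow,
        ← hw]
      field_simp
      linear_combination h4
    have e3 : ((q : ℝ) ^ ((L : ℝ) / 2)) ^ (p + 3) * H (p + 4) = ((q : ℝ) ^ (p + 2)) ^ e *
        (w / u * Y₁.eval ((q : ℝ) ^ 2 * (q : ℝ) ^ (p + 2))) := by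
      have h4 := hY (p + 4)
      rw [hY₁, eval_mul, eval_pow, eval_X, show p + 4 = 2 + (p + 2) by omega, pow_add _ 2 (p + 2),
        mul_pow, ← hw, show 2 + (p + 2) + 1 = p + 3 + 2 by omega, pow_add _ (p + 3) 2, hl2] at h4
      rw [show p + 4 = 2 + (p + 2) by omega]
      generalize eval ((q : ℝ) ^ 2 * (q : ℝ) ^ (p + 2)) Y₁ = E at *
      field_simp
      linear_combination h4
    rw [e1, e2, e3] at h1
    refine (mul_eq_zero.1 (?_ : ((q : ℝ) ^ (p + 2)) ^ e * Ψ ((q : ℝ) ^ (p + 2)) = 0)).resolve_left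
      (pow_ne_zero _ hz)
    refine Eq.trans ?_ h1
    simp only [Ψ]
    ring
  have hΨ0 : Ψ 0 = 0 := by
    have h1 : Tendsto (fun p : ℕ => (q : ℝ) ^ (p + 2)) atTop (𝓝 0) :=
      (tendsto_add_atTop_iff_nat 2).2 (tendsto_pow_atTop_nhds_zero_of_lt_one hq.le q.2.2)
    have h2 := (hcont.tendsto 0).comp h1
    refine tendsto_nhds_unique h2 ?_
    simp only [Function.comp_def, hzero]
    exact tendsto_const_nhds
  simp only [Ψ, zero_div, mul_zero] at hΨ0
  have hx : (q : ℝ) ^ (L + 1) = q * u := pow_succ' _ _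
  have hq0 := hq.ne'
  have h1 : (w - 1) * ((q * u) ^ 2 - w) * Y₁.eval 0 = 0 := by
    rw [hx] at hΨ0
    have hu0' := hu0.ne'
    have hw0' := hw0.ne'
    field_simp at hΨ0
    refine mul_left_cancel₀ (pow_ne_zero 2 hq0) ?_
    linear_combination hΨ0
  have h2 : w - 1 ≠ 0 := by
    have : w < 1 := pow_lt_one₀ (pow_pos hq 2).le (pow_lt_one₀ hq.le q.2.2 two_ne_zero) he1.ne'
    exact (sub_neg.2 this).ne
  have h3 : (q * u) ^ 2 - w ≠ 0 := by
    have : (q * u) ^ 2 < w := by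
      rw [← hx, hw, ← pow_mul, ← pow_mul]
      exact pow_lt_pow_right_of_lt_one₀ hq q.2.2 (by omega)
    exact (sub_neg.2 this).ne
  exact mul_ne_zero (mul_ne_zero h2 h3) hdvd h1

/-- The `k`-th term of the sum is a multiple of `(q^p)^k` after normalisation. The constant term
comes from `k = 0`, where the components of the vectors are the normalising constants `normC`. -/
theorem exists_torusVal_polynomial (L : ℕ) (I J : ℤ) (τ σ : ℝ) : ∃ Y : ℝ[X], Y.natDegree ≤ L ∧
    Y.eval 0 = normC q L I τ * normC q L J σ ∧
    ∀ p, ((q : ℝ) ^ ((L : ℝ) / 2)) ^ (p + 1) * torusVal q L I J τ σ p = Y.eval ((q : ℝ) ^ p) := by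
  have hq := q.2.1
  have hr : ∀ J σ, realVec q L J σ 0 = normC q L J σ := fun J σ => by
    simp [realVec, vecScale, binomWeight, qPoch_zero, dualQKrawtchouk]
  refine ⟨∑ k ∈ Finset.range (L + 1), C (realVec q L I τ k * realVec q L J σ k * (q : ℝ) ^ k) * X ^ k,
    ?_, ?_, fun p => ?_⟩
  · refine natDegree_sum_le_of_forall_le _ _ fun k hk => ?_
    rw [Finset.mem_range] at hk
    exact (natDegree_C_mul_X_pow_le _ _).trans (by omega)
  · rw [eval_finsetSum, Finset.sum_range_succ', Finset.sum_eq_zero, zero_add]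
    · simp [hr]
    · intro k _; simp
  · rw [torusVal, Finset.mul_sum, eval_finsetSum]
    refine Finset.sum_congr rfl fun k _ => ?_
    rw [eval_mul, eval_C, eval_pow, eval_X, Real.rpow_sub hq, Real.rpow_natCast, div_pow,
      ← pow_mul (q : ℝ) k, ← pow_mul (q : ℝ) p, mul_add, mul_one, pow_add (q : ℝ), mul_comm p k]
    have := pow_ne_zero (p + 1) (Real.rpow_pos_of_pos hq ((L : ℝ) / 2)).ne'
    field_simp

end Torus

/-! ### The Askey-Wilson equation as a Casimir equation -/

section CasimirAW

/-- The numerator of the Askey-Wilson coefficient. -/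
def awNum (a b c d z : ℝ) : ℝ := (1 - a * z) * (1 - b * z) * (1 - c * z) * (1 - d * z)

theorem awOp_clear {a b c d q z y : ℝ} {f : ℝ → ℝ} {Λ : ℝ} (hq : q ≠ 0) (hz : z ≠ 0) (hy : y ≠ 0)
    (hz1 : 1 - z ^ 2 ≠ 0) (hz2 : 1 - q ^ 2 * z ^ 2 ≠ 0) (hz3 : z ^ 2 - q ^ 2 ≠ 0)
    (h : awOp a b c d (q ^ 2) f z = Λ * f z) :
    (z / q - q / z) * awNum a b c d z / (y * q ^ 2 * z ^ 2) * (f (q ^ 2 * z) - f z) +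
      (q * z - (q * z)⁻¹) * awNum a b c d z⁻¹ * z ^ 2 / (y * q ^ 2) * (f (z / q ^ 2) - f z) =
    -((q * z - (q * z)⁻¹) * (z / q - q / z) * (1 - z ^ 2) / (y * q * z)) * Λ * f z := by
  rw [mul_assoc _ Λ, ← h, awOp, awCoeff, awCoeff, ← awNum, ← awNum]
  have e1 : q * z - (q * z)⁻¹ = -((1 - q ^ 2 * z ^ 2) / (q * z)) := by field_simp; ring
  have e2 : z / q - q / z = (z ^ 2 - q ^ 2) / (q * z) := by field_simp
  have e3 : 1 - z⁻¹ ^ 2 = -((1 - z ^ 2) / z ^ 2) := by field_simp; ring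
  have e4 : 1 - q ^ 2 * z⁻¹ ^ 2 = (z ^ 2 - q ^ 2) / z ^ 2 := by field_simp
  rw [e1, e2, e3, e4]
  generalize 1 - z ^ 2 = u at *
  generalize 1 - q ^ 2 * z ^ 2 = v at *
  generalize z ^ 2 - q ^ 2 = w at *
  field_simp

variable {q g h y w n z : ℝ}

/-- Here `g`, `h`, `y`, `w`, `n` stand for `q^σ`, `q^τ`, `q^M`, `q^J`, `q^N`. The coefficient of
`F3` in the Casimir equation contains the left factor of the first-order equation, so `F3` can be
traded for `F2`; what is left is the Askey-Wilson numerator. -/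
theorem casimir_coeff_plus (hq : q ≠ 0) (hg : g ≠ 0) (hh : h ≠ 0) (hy : y ≠ 0) (hw : w ≠ 0)
    (hz : z ≠ 0) {F2 F3 : ℝ}
    (hF : F3 * (h - h⁻¹ - q * z * (g - g⁻¹) + h * ((q * z) ^ 2 - 1)) =
      F2 * (h * y - (h * y)⁻¹ - q * z * (g * w - (g * w)⁻¹) + h * y * ((q * z) ^ 2 - 1))) :
    F3 * ((q * z - (q * z)⁻¹) * (z / q - q / z) * (z * q - z⁻¹ * q⁻¹) +
      (z / q - q / z) * (h - h⁻¹ - q * z * (g - g⁻¹)) * ((g - g⁻¹) / (q * z) - (h - h⁻¹))) =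
    F2 * ((z / q - q / z) * awNum (q * g / h) (q * (y / w) * h / g) (-q / (h * g))
      (-(h * g * (q * (y * w)))) z / (y * q ^ 2 * z ^ 2)) := by
  have e : (q * z - (q * z)⁻¹) * (z / q - q / z) * (z * q - z⁻¹ * q⁻¹) +
      (z / q - q / z) * (h - h⁻¹ - q * z * (g - g⁻¹)) * ((g - g⁻¹) / (q * z) - (h - h⁻¹)) =
      (h - h⁻¹ - q * z * (g - g⁻¹) + h * ((q * z) ^ 2 - 1)) *
        ((z / q - q / z) * (q * z + h * g) * (q * z - h / g) / (h * (q * z) ^ 2)) := by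
    field_simp; ring
  rw [e, ← mul_assoc, hF, awNum]
  field_simp
  ring

theorem casimir_coeff_minus (hq : q ≠ 0) (hg : g ≠ 0) (hh : h ≠ 0) (hy : y ≠ 0) (hw : w ≠ 0)
    (hz : z ≠ 0) {F1 F2 : ℝ}
    (hF : F2 * (h - h⁻¹ - z / q * (g - g⁻¹) + h * ((z / q) ^ 2 - 1)) =
      F1 * (h * y - (h * y)⁻¹ - z / q * (g * w - (g * w)⁻¹) + h * y * ((z / q) ^ 2 - 1))) :
    F1 * ((q * z - (q * z)⁻¹) * (z / q - q / z) * (z * q⁻¹ - z⁻¹ * q) +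
      (q * z - (q * z)⁻¹) * (z / q * (g * w - (g * w)⁻¹) - (h * y - (h * y)⁻¹)) *
        ((h * y - (h * y)⁻¹) - q * (g * w - (g * w)⁻¹) / z)) =
    F2 * ((q * z - (q * z)⁻¹) * awNum (q * g / h) (q * (y / w) * h / g) (-q / (h * g))
      (-(h * g * (q * (y * w)))) z⁻¹ * z ^ 2 / (y * q ^ 2)) := by
  have e : (q * z - (q * z)⁻¹) * (z / q - q / z) * (z * q⁻¹ - z⁻¹ * q) +
      (q * z - (q * z)⁻¹) * (z / q * (g * w - (g * w)⁻¹) - (h * y - (h * y)⁻¹)) *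
        ((h * y - (h * y)⁻¹) - q * (g * w - (g * w)⁻¹) / z) =
      (h * y - (h * y)⁻¹ - z / q * (g * w - (g * w)⁻¹) + h * y * ((z / q) ^ 2 - 1)) *
        ((q * z - (q * z)⁻¹) * (z / q + h * y * g * w) * (z / q - h * y / (g * w)) /
          (h * y * (z / q) ^ 2)) := by
    field_simp; ring
  rw [e, ← mul_assoc, ← hF, awNum]
  field_simp
  ring

/-- The middle coefficient is minus the sum of the two outer Askey-Wilson coefficients, plus the
eigenvalue term. Here `q y n²` is `q^{L+1}` for `L = M + 2N`. -/
theorem casimir_coeff_zero (hq : q ≠ 0) (hg : g ≠ 0) (hh : h ≠ 0) (hy : y ≠ 0) (hw : w ≠ 0)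
    (hn : n ≠ 0) (hz : z ≠ 0) :
    (q * z - (q * z)⁻¹) * (z / q - q / z) * ((z⁻¹ - z) * (q * y * n ^ 2 + (q * y * n ^ 2)⁻¹)) +
      (z / q - q / z) * (q * z * (g * w - (g * w)⁻¹) - (h * y - (h * y)⁻¹)) *
        ((g - g⁻¹) / (q * z) - (h - h⁻¹)) +
      (q * z - (q * z)⁻¹) * (h - h⁻¹ - z / q * (g - g⁻¹)) *
        ((h * y - (h * y)⁻¹) - q * (g * w - (g * w)⁻¹) / z) =
    -((z / q - q / z) * awNum (q * g / h) (q * (y / w) * h / g) (-q / (h * g))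
      (-(h * g * (q * (y * w)))) z / (y * q ^ 2 * z ^ 2)) -
    (q * z - (q * z)⁻¹) * awNum (q * g / h) (q * (y / w) * h / g) (-q / (h * g))
      (-(h * g * (q * (y * w)))) z⁻¹ * z ^ 2 / (y * q ^ 2) +
    (q * z - (q * z)⁻¹) * (z / q - q / z) * (1 - z ^ 2) / (y * q * z) *
      (((n ^ 2)⁻¹ - 1) * (1 - q ^ 2 * y ^ 2 * n ^ 2)) := by
  simp only [awNum]
  field_simp
  ring

/-- A gauge transformation: with the extremal solution `F` factored out, the Casimir equation for `F
f` becomes the Askey-Wilson equation for `f`. -/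
theorem casimirEq_of_extremal_of_aw (hq : q ≠ 0) (hg : g ≠ 0) (hh : h ≠ 0) (hy : y ≠ 0)
    (hw : w ≠ 0) (hn : n ≠ 0) (hz : z ≠ 0) {F1 F2 F3 : ℝ} {f : ℝ → ℝ}
    (hz1 : 1 - z ^ 2 ≠ 0) (hz2 : 1 - q ^ 2 * z ^ 2 ≠ 0) (hz3 : z ^ 2 - q ^ 2 ≠ 0)
    (hF3 : F3 * (h - h⁻¹ - q * z * (g - g⁻¹) + h * ((q * z) ^ 2 - 1)) =
      F2 * (h * y - (h * y)⁻¹ - q * z * (g * w - (g * w)⁻¹) + h * y * ((q * z) ^ 2 - 1)))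
    (hF1 : F2 * (h - h⁻¹ - z / q * (g - g⁻¹) + h * ((z / q) ^ 2 - 1)) =
      F1 * (h * y - (h * y)⁻¹ - z / q * (g * w - (g * w)⁻¹) + h * y * ((z / q) ^ 2 - 1)))
    (haw : awOp (q * g / h) (q * (y / w) * h / g) (-q / (h * g)) (-(h * g * (q * (y * w)))) (q ^ 2)
      f z = ((n ^ 2)⁻¹ - 1) * (1 - q ^ 2 * y ^ 2 * n ^ 2) * f z) :
    CasimirEq q (g - g⁻¹) (g * w - (g * w)⁻¹) (h - h⁻¹) (h * y - (h * y)⁻¹)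
      (q * y * n ^ 2 + (q * y * n ^ 2)⁻¹) z (F1 * f (z / q ^ 2)) (F2 * f z)
      (F3 * f (q ^ 2 * z)) := by
  have h1 := awOp_clear hq hz hy hz1 hz2 hz3 haw
  have h2 := casimir_coeff_plus hq hg hh hy hw hz hF3
  have h3 := casimir_coeff_minus hq hg hh hy hw hz hF1
  have h4 := casimir_coeff_zero hq hg hh hy hw hn hz
  rw [CasimirEq]
  linear_combination F2 * h1 + f (q ^ 2 * z) * h2 + f (z / q ^ 2) * h3 + F2 * f z * h4

end CasimirAW

/-! ### The torus values of the extremal matrix elements -/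

section TorusIdentity
variable {q : Set.Ioo (0 : ℝ) 1}
open Polynomial

theorem qPoch_pos_of_lt_one {a Q : ℝ} (hQ : 0 < Q) (hQ1 : Q < 1) (ha : a < 1) (k : ℕ) :
    0 < qPoch a Q k := by
  refine Finset.prod_pos fun r _ => sub_pos.2 ?_
  have h0 := pow_pos hQ r
  have h1 := pow_le_one₀ hQ.le hQ1.le (n := r)
  rcases le_or_gt a 0 with h | h
  · nlinarith
  · nlinarith

theorem qBinom_pos {n k : ℕ} (hk : k ≤ n) : 0 < qBinom n k ((q : ℝ) ^ 2) := by
  have h := binomWeight_pos q hk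
  rwa [binomWeight, pow_mul] at h

theorem normC_pos {L : ℕ} {J : ℤ} (hJ : IsWeight L J) (σ : ℝ) : 0 < normC q L J σ := by
  obtain ⟨x, hx, rfl⟩ := hJ
  have hq := q.2.1
  have h1 : ∀ y : ℝ, 0 < (q : ℝ) ^ y := fun y => Real.rpow_pos_of_pos hq y
  have h2 : ∀ (y : ℝ) (k : ℕ), 0 < qPoch (-(q : ℝ) ^ y) ((q : ℝ) ^ 2) k := fun y k =>
    qPoch_pos_of_lt_one (sq_pos_lt_one q).1 (sq_pos_lt_one q).2
      ((neg_neg_of_pos (h1 y)).trans one_pos) k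
  have h3 : 0 < qBinom L (((L : ℤ) - (L - 2 * x)) / 2).toNat ((q : ℝ) ^ 2) := by
    rw [show (((L : ℤ) - (L - 2 * x)) / 2).toNat = x by omega]
    exact qBinom_pos hx
  rw [normC]
  have h4 := h1 (-2 * ((L - 2 * x : ℤ) : ℝ) - 2 * σ)
  have h5 := h1 (-2 * σ)
  exact mul_pos (mul_pos (mul_pos (h1 _) (Real.sqrt_pos.2 h3)) (Real.sqrt_pos.2 (by positivity)))
    (inv_pos.2 (Real.sqrt_pos.2 (mul_pos (h2 _ _) (h2 _ _))))

theorem IsWeight.add {M : ℕ} {J : ℤ} (h : IsWeight M J) (N : ℕ) : IsWeight (M + 2 * N) J := by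
  obtain ⟨x, hx, rfl⟩ := h
  exact ⟨x + N, by omega, by push_cast; ring⟩

/-- Read in reverse order, the constant term `(abcd Q^{N-1}; Q)_N` of the Askey-Wilson polynomial is
the shifted factorial in the denominator of `d`. -/
theorem qPoch_pow_eq_reflect (M N : ℕ) :
    qPoch ((q : ℝ) ^ (2 * (M + N + 1))) ((q : ℝ) ^ 2) N =
      qPoch ((q : ℝ) ^ (2 * (M + 2 * N))) ((q : ℝ) ^ 2)⁻¹ N := by
  rw [qPoch, qPoch, ← Finset.prod_range_reflect]
  refine Finset.prod_congr rfl fun r hr => ?_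
  rw [Finset.mem_range] at hr
  congr 1
  rw [inv_pow, ← div_eq_mul_inv, eq_div_iff (pow_ne_zero _ (pow_ne_zero _ q.2.1.ne')), ← pow_mul,
    ← pow_mul, ← pow_add, ← pow_add]
  congr 1
  omega

/-- Both sides solve the Casimir equation for `L = M + 2N` and are, suitably scaled, polynomials in
`q^p` of degree at most `L`. Their difference has constant term zero, so `casimirEq_unique` applies.
-/
theorem torusVal_top (M N : ℕ) {J : ℤ} (hJ : IsWeight M J) (τ σ : ℝ) (p : ℕ) :
    torusVal q (M + 2 * N) M J τ σ p = constD q (M + 2 * N) M J τ σ * (torusVal q M M J τ σ p *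
      (askeyWilsonJ N ((((M : ℤ) : ℝ) - J) / 2) ((((M : ℤ) : ℝ) + J) / 2) ((q : ℝ) ^ τ)
        ((q : ℝ) ^ σ) ((q : ℝ) ^ 2)).eval (((q : ℝ) ^ p + ((q : ℝ) ^ p)⁻¹) / 2)) := by
  have hq := q.2.1
  have hQ := sq_pos_lt_one q
  have hJL := hJ.add N
  have hML : IsWeight (M + 2 * N) M := (isWeight_self M).add N
  have hg := Real.rpow_pos_of_pos hq σ
  have hh := Real.rpow_pos_of_pos hq τ
  have hw := Real.rpow_pos_of_pos hq (J : ℝ)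
  have hy : 0 < (q : ℝ) ^ M := pow_pos hq M
  have hn : 0 < (q : ℝ) ^ N := pow_pos hq N
  have hQp : ∀ x : ℝ, ((q : ℝ) ^ 2) ^ x = (q : ℝ) ^ (2 * x) := fun x => by
    rw [← Real.rpow_natCast, ← Real.rpow_mul hq.le]; norm_num
  have e1 : ((q : ℝ) ^ 2) ^ (1 / 2 : ℝ) = q := by rw [hQp]; norm_num
  have e2 : ((q : ℝ) ^ 2) ^ (1 / 2 + (((M : ℤ) : ℝ) - J) / 2) =
      q * ((q : ℝ) ^ M / (q : ℝ) ^ (J : ℝ)) := by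
    rw [hQp, show 2 * (1 / 2 + (((M : ℤ) : ℝ) - J) / 2) = 1 + ((M : ℝ) - J) by push_cast; ring,
      Real.rpow_add hq, Real.rpow_sub hq, Real.rpow_one, Real.rpow_natCast]
  have e3 : ((q : ℝ) ^ 2) ^ (1 / 2 + (((M : ℤ) : ℝ) + J) / 2) =
      q * ((q : ℝ) ^ M * (q : ℝ) ^ (J : ℝ)) := by
    rw [hQp, show 2 * (1 / 2 + (((M : ℤ) : ℝ) + J) / 2) = 1 + ((M : ℝ) + J) by push_cast; ring,
      Real.rpow_add hq, Real.rpow_add hq, Real.rpow_one, Real.rpow_natCast]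
  rw [askeyWilsonJ, e1, e2, e3]
  have hqd : ∀ x y : ℝ, qdiff q (x + y) = (q : ℝ) ^ x * (q : ℝ) ^ y -
      ((q : ℝ) ^ x * (q : ℝ) ^ y)⁻¹ := fun x y => by
    rw [qdiff, Real.rpow_neg hq.le, Real.rpow_add hq]
  have hqd0 : ∀ x : ℝ, qdiff q x = (q : ℝ) ^ x - ((q : ℝ) ^ x)⁻¹ := fun x => by
    rw [qdiff, Real.rpow_neg hq.le]
  -- The product `ab` equals `q^{2x+2} < 1`, while `ac` and `ad` are negative, so none of the
  -- denominators of the Askey-Wilson polynomial vanishes.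
  have hb1 : (q : ℝ) * ((q : ℝ) ^ M / (q : ℝ) ^ (J : ℝ)) * q < 1 := by
    obtain ⟨x, hx, rfl⟩ := hJ
    have : (q : ℝ) * ((q : ℝ) ^ M / (q : ℝ) ^ ((M - 2 * x : ℤ) : ℝ)) * q =
        (q : ℝ) ^ (2 * x + 2) := by
      rw [Real.rpow_intCast, zpow_sub₀ hq.ne', zpow_natCast, show (2 : ℤ) * x = ((2 * x : ℕ) : ℤ) by
        push_cast; ring, zpow_natCast, pow_add]
      field_simp
    rw [this]
    exact pow_lt_one₀ hq.le q.2.2 (by omega)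
  have hF := torusVal_extremal (q := q) hJ τ σ
  have hc := torusVal_casimir (q := q) hML hJL τ σ
  simp only [hqd, hqd0, Int.cast_natCast, Real.rpow_natCast] at hF hc
  set g := (q : ℝ) ^ σ
  set h := (q : ℝ) ^ τ
  set w := (q : ℝ) ^ (J : ℝ)
  set y := (q : ℝ) ^ M with hydef
  set n := (q : ℝ) ^ N with hndef
  have hg0 := hg.ne'
  have hh0 := hh.ne'
  have hw0 := hw.ne'
  have hy0 := hy.ne'
  have hab : qPoch (q * g / h * (q * (y / w) * h / g)) ((q : ℝ) ^ 2) N ≠ 0 := by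
    refine (qPoch_pos_of_lt_one hQ.1 hQ.2 (lt_of_eq_of_lt ?_ hb1) N).ne'
    field_simp
  have hac : qPoch (q * g / h * (-q / (h * g))) ((q : ℝ) ^ 2) N ≠ 0 := by
    refine (qPoch_pos_of_lt_one hQ.1 hQ.2 (lt_trans ?_ one_pos) N).ne'
    have : 0 < q * g / h * (q / (h * g)) := by positivity
    rw [neg_div, mul_neg]; linarith
  have had : qPoch (q * g / h * (-(h * g * (q * (y * w))))) ((q : ℝ) ^ 2) N ≠ 0 := by
    refine (qPoch_pos_of_lt_one hQ.1 hQ.2 (lt_trans ?_ one_pos) N).ne'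
    have : 0 < q * g / h * (h * g * (q * (y * w))) := by positivity
    rw [mul_neg]; linarith
  have hX : q * g / h * (q * (y / w) * h / g) * (-q / (h * g)) * (-(h * g * (q * (y * w)))) *
      ((q : ℝ) ^ 2) ^ ((N : ℤ) - 1) = q ^ 2 * y ^ 2 * n ^ 2 := by
    rw [zpow_sub_one₀ hQ.1.ne', zpow_natCast, ← pow_mul, mul_comm 2 N, pow_mul, ← hndef]
    have := hq.ne'
    field_simp
  obtain ⟨Y, hYdeg, hY0, hY⟩ := exists_laurent_askeyWilson N hQ.1 hQ.2 (by positivity) hab hac had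
  set P := askeyWilson N (q * g / h) (q * (y / w) * h / g) (-q / (h * g)) (-(h * g * (q * (y * w))))
    ((q : ℝ) ^ 2) with hP
  obtain ⟨YL, hYLdeg, hYL0, hYL⟩ := exists_torusVal_polynomial (q := q) (M + 2 * N) M J τ σ
  obtain ⟨YM, hYMdeg, hYM0, hYM⟩ := exists_torusVal_polynomial (q := q) M M J τ σ
  set D := constD q (M + 2 * N) M J τ σ with hD
  rw [hX, show q ^ 2 * y ^ 2 * n ^ 2 = (q : ℝ) ^ (2 * (M + N + 1)) by rw [hydef, hndef]; ring,
    qPoch_pow_eq_reflect] at hY0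
  -- The constant `d` is the quotient of the constant terms of the two polynomials being compared.
  have hD0 : D * (normC q M M τ * normC q M J σ * n *
      qPoch ((q : ℝ) ^ (2 * (M + 2 * N))) ((q : ℝ) ^ 2)⁻¹ N) =
      normC q (M + 2 * N) M τ * normC q (M + 2 * N) J σ := by
    have h1 := (normC_pos (q := q) hJ σ).ne'
    have h2 := (normC_pos (q := q) (isWeight_self M) τ).ne'
    have h3 : qPoch ((q : ℝ) ^ (2 * (M + 2 * N))) ((q : ℝ) ^ 2)⁻¹ N ≠ 0 := by
      rw [← qPoch_pow_eq_reflect]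
      exact (qPoch_pos_of_lt_one hQ.1 hQ.2 (pow_lt_one₀ hq.le q.2.2 (by omega)) N).ne'
    have h4 : (q : ℝ) ^ ((((M : ℤ) : ℝ) - ((M + 2 * N : ℕ) : ℝ)) / 2) = n⁻¹ := by
      rw [hndef, ← Real.rpow_natCast, ← Real.rpow_neg hq.le]; congr 1; push_cast; ring
    rw [hD, constD, h4, Int.toNat_natCast,
      show ((((M + 2 * N : ℕ) : ℤ) - (M : ℤ)) / 2).toNat = N by omega]
    generalize qPoch ((q : ℝ) ^ (2 * (M + 2 * N))) ((q : ℝ) ^ 2)⁻¹ N = X at *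
    field_simp
  refine sub_eq_zero.1 (casimirEq_unique (H := fun p => torusVal q (M + 2 * N) M J τ σ p -
    D * (torusVal q M M J τ σ p * P.eval (((q : ℝ) ^ p + ((q : ℝ) ^ p)⁻¹) / 2)))
    (Y := YL - Polynomial.C (D * n) * (YM * Y)) (L := M + 2 * N) (fun p => ?_) ?_ ?_ (fun p =>
      (hc p).sub (CasimirEq.const_mul D ?_)) p)
  · have h1 : (q : ℝ) ^ (((M + 2 * N : ℕ) : ℝ) / 2) = (q : ℝ) ^ ((M : ℝ) / 2) * n := by
      rw [hndef, ← Real.rpow_natCast, ← Real.rpow_add hq]; congr 1; push_cast; ring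
    have h2 : n ^ (p + 1) = n * ((q : ℝ) ^ p) ^ N := by
      rw [hndef, pow_succ', ← pow_mul, ← pow_mul, mul_comm N p]
    rw [eval_sub, eval_mul, eval_mul, eval_C, ← hYL, ← hYM, hY _ (pow_ne_zero _ hq.ne'), mul_sub,
      h1, mul_pow, h2]
    ring
  · refine (natDegree_sub_le _ _).trans (max_le hYLdeg ?_)
    exact (natDegree_C_mul_le _ _).trans (natDegree_mul_le.trans (Nat.add_le_add hYMdeg hYdeg))
  · rw [eval_sub, eval_mul, eval_mul, eval_C, hYL0, hYM0, hY0]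
    linear_combination -hD0
  -- The central point `q^{p+2}` is smaller than `q`, which avoids the poles `z² = 1`, `q² z² = 1`
  -- and `z² = q²` of the Askey-Wilson operator.
  · have hz : 0 < (q : ℝ) ^ (p + 2) := pow_pos hq _
    have hzq : ((q : ℝ) ^ (p + 2)) ^ 2 < (q : ℝ) ^ 2 := by
      rw [← pow_mul]; exact pow_lt_pow_right_of_lt_one₀ hq q.2.2 (by omega)
    have hz1 : 1 - ((q : ℝ) ^ (p + 2)) ^ 2 ≠ 0 := (sub_pos.2 (hzq.trans hQ.2)).ne'
    have hz2 : 1 - (q : ℝ) ^ 2 * ((q : ℝ) ^ (p + 2)) ^ 2 ≠ 0 :=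
      (sub_pos.2 (mul_lt_one_of_nonneg_of_lt_one_left hQ.1.le hQ.2 (hzq.trans hQ.2).le)).ne'
    have haw := awOp_askeyWilson (a := q * g / h) (b := q * (y / w) * h / g) (c := -q / (h * g))
      (d := -(h * g * (q * (y * w)))) (z := (q : ℝ) ^ (p + 2)) N hQ.1 hQ.2 hz.ne'
      hz1 hz2 (sub_neg.2 hzq).ne hab hac had
    rw [hX, ← hP, zpow_neg, zpow_natCast, ← pow_mul (q : ℝ) 2 N, mul_comm 2 N, pow_mul (q : ℝ) N 2,
      ← hndef] at haw
    have hF1 := hF p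
    have hF3 := hF (p + 2)
    have e4 : (q : ℝ) ^ (p + 1) = (q : ℝ) ^ (p + 2) / q := by
      rw [pow_succ _ (p + 1), mul_div_cancel_right₀ _ hq.ne']
    have e5 : (q : ℝ) ^ (p + 2 + 1) = q * (q : ℝ) ^ (p + 2) := pow_succ' _ _
    rw [e4] at hF1
    rw [e5] at hF3
    have key := casimirEq_of_extremal_of_aw hq.ne' hg0 hh0 hy0 hw0 hn.ne' hz.ne'
      (f := fun z => P.eval ((z + z⁻¹) / 2)) hz1 hz2 (sub_neg.2 hzq).ne
      hF3 hF1 haw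
    have e6 : (q : ℝ) ^ (p + 2) / q ^ 2 = (q : ℝ) ^ p := by
      rw [pow_add, mul_div_cancel_right₀ _ (pow_ne_zero _ hq.ne')]
    have e7 : (q : ℝ) ^ 2 * (q : ℝ) ^ (p + 2) = (q : ℝ) ^ (p + 4) := by
      rw [← pow_add]; congr 1; omega
    have e8 : q * y * n ^ 2 = (q : ℝ) ^ (M + 2 * N + 1) := by rw [hydef, hndef]; ring
    rw [e8] at key
    simp only [e6, e7] at key
    exact key

end TorusIdentity

/-! ### Symmetries -/

section Symmetry
variable {q : Set.Ioo (0 : ℝ) 1}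

theorem qPoch_self_mul_qPoch_pow {Q : ℝ} (hQ : Q ≠ 0) {n k : ℕ} (hk : k ≤ n) :
    qPoch Q Q (n - k) * qPoch (Q ^ n) Q⁻¹ k = qPoch Q Q n := by
  induction k with
  | zero => simp [qPoch_zero]
  | succ k ih =>
    rw [← ih (by omega), show n - k = n - (k + 1) + 1 by omega, qPoch_succ, qPoch_succ,
      ← pow_succ', show n - (k + 1) + 1 = n - k by omega, inv_pow, ← pow_sub₀ Q hQ (by omega)]
    ring

theorem qBinom_symm {x L : ℕ} (hx : x ≤ L) :
    qBinom L (L - x) ((q : ℝ) ^ 2) = qBinom L x ((q : ℝ) ^ 2) := by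
  have hQ := sq_pos_lt_one q
  have h1 := qPoch_self_mul_qPoch_pow hQ.1.ne' hx
  have h2 := qPoch_self_mul_qPoch_pow hQ.1.ne' (Nat.sub_le L x)
  rw [Nat.sub_sub_self hx] at h2
  rw [qBinom, qBinom, div_eq_div_iff (qPoch_self_pos hQ.1 hQ.2 _).ne'
    (qPoch_self_pos hQ.1 hQ.2 _).ne']
  linear_combination h2 - h1

/-- The sign change exchanges the two shifted factorials and reflects the `q`-binomial. The quotient
under the other root gains a factor `q^{2J}`, whose square root restores the power of `q` in front.
-/
theorem normC_neg {L : ℕ} {J : ℤ} (hJ : IsWeight L J) (σ : ℝ) :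
    normC q L (-J) (-σ) = normC q L J σ := by
  obtain ⟨x, hx, rfl⟩ := hJ
  have hq := q.2.1
  have e1 : (((L : ℤ) - (L - 2 * x)) / 2).toNat = x := by omega
  have e2 : (((L : ℤ) + (L - 2 * x)) / 2).toNat = L - x := by omega
  have e3 : (((L : ℤ) - -(L - 2 * x)) / 2).toNat = L - x := by omega
  have e4 : (((L : ℤ) + -(L - 2 * x)) / 2).toNat = x := by omega
  rw [normC, normC, e1, e2, e3, e4, qBinom_symm hx]
  generalize ((L : ℤ) - 2 * x) = J
  have h1 := Real.rpow_pos_of_pos hq (-2 * (J : ℝ) - 2 * σ)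
  have h2 := Real.rpow_pos_of_pos hq (-2 * σ)
  have h3 := Real.rpow_pos_of_pos hq (J : ℝ)
  have e5 : (1 + (q : ℝ) ^ (-2 * ((-J : ℤ) : ℝ) - 2 * -σ)) / (1 + (q : ℝ) ^ (-2 * -σ)) =
      ((q : ℝ) ^ (J : ℝ)) ^ 2 *
        ((1 + (q : ℝ) ^ (-2 * (J : ℝ) - 2 * σ)) / (1 + (q : ℝ) ^ (-2 * σ))) := by
    have f1 : (q : ℝ) ^ (-2 * ((-J : ℤ) : ℝ) - 2 * -σ) = (((q : ℝ) ^ (-2 * (J : ℝ) - 2 * σ)))⁻¹ := by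
      rw [← Real.rpow_neg hq.le]; congr 1; push_cast; ring
    have f2 : (q : ℝ) ^ (-2 * -σ) = ((q : ℝ) ^ (-2 * σ))⁻¹ := by
      rw [← Real.rpow_neg hq.le]; congr 1; ring
    have f3 : (q : ℝ) ^ (-2 * (J : ℝ) - 2 * σ) * ((q : ℝ) ^ (J : ℝ)) ^ 2 = (q : ℝ) ^ (-2 * σ) := by
      rw [← Real.rpow_natCast, ← Real.rpow_mul hq.le, ← Real.rpow_add hq]
      congr 1; push_cast; ring
    rw [f1, f2, ← f3]
    generalize (q : ℝ) ^ (-2 * (J : ℝ) - 2 * σ) = G at *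
    generalize (q : ℝ) ^ (J : ℝ) = E at *
    field_simp
    ring
  have e6 : (q : ℝ) ^ (((L : ℝ) + ((-J : ℤ) : ℝ)) / 2) * (q : ℝ) ^ (J : ℝ) =
      (q : ℝ) ^ (((L : ℝ) + (J : ℝ)) / 2) := by
    rw [← Real.rpow_add hq]; congr 1; push_cast; ring
  rw [e5, Real.sqrt_mul (sq_nonneg _), Real.sqrt_sq h3.le, ← e6, mul_comm (qPoch _ _ (L - x)),
    show 2 - 2 * -σ = 2 + 2 * σ by ring,
    show 2 + 2 * -σ = 2 - 2 * σ by ring]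
  ring

/-- This is `dualQKrawtchouk_flip` at `c = q^{2σ}`. The power of `c` turns `q^{-σk}` into `q^{σk}`,
and the sign `(-1)^k` cancels in products of two components. -/
theorem realVec_neg {L k : ℕ} (hk : k ≤ L) {J : ℤ} (hJ : IsWeight L J) (σ : ℝ) :
    realVec q L (-J) (-σ) k = (-1) ^ k * realVec q L J σ k := by
  have hn := normC_neg (q := q) hJ σ
  obtain ⟨x, hx, rfl⟩ := hJ
  have hq := q.2.1
  have hQ := sq_pos_lt_one q
  have hc := Real.rpow_pos_of_pos hq (2 * σ)
  have h := dualQKrawtchouk_flip hQ.1 hQ.2 hc.ne' hk hx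
  have e1 : (((L : ℤ) - (L - 2 * x)) / 2).toNat = x := by omega
  have e3 : (((L : ℤ) - -(L - 2 * x)) / 2).toNat = L - x := by omega
  have e4 : (q : ℝ) ^ (2 * -σ) = ((q : ℝ) ^ (2 * σ))⁻¹ := by
    rw [← Real.rpow_neg hq.le]; congr 1; ring
  have e5 : (q : ℝ) ^ (-σ * k) * ((q : ℝ) ^ (2 * σ)) ^ k = (q : ℝ) ^ (σ * k) := by
    rw [← Real.rpow_mul_natCast hq.le, ← Real.rpow_add hq]; congr 1; ring
  rw [realVec, realVec, vecScale, vecScale, e1, e3, e4, h, hn, ← e5, neg_pow ((q : ℝ) ^ (2 * σ))]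
  ring

theorem torusVal_neg {L : ℕ} {I J : ℤ} (hI : IsWeight L I) (hJ : IsWeight L J) (τ σ : ℝ) (p : ℕ) :
    torusVal q L (-I) (-J) (-τ) (-σ) p = torusVal q L I J τ σ p := by
  refine Finset.sum_congr rfl fun k hk => ?_
  rw [Finset.mem_range] at hk
  rw [realVec_neg (by omega) hI, realVec_neg (by omega) hJ]
  have : ((-1 : ℝ) ^ k) * (-1) ^ k = 1 := by rw [← mul_pow]; norm_num
  linear_combination (realVec q L I τ k * realVec q L J σ k *
    ((q : ℝ) ^ ((k : ℝ) - (L : ℝ) / 2)) ^ (p + 1)) * this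

/-- On the torus `t^l` is diagonal and the phases of the two vectors cancel, so the sum is symmetric
in the two vectors. -/
theorem torusVal_swap (L : ℕ) (I J : ℤ) (τ σ : ℝ) (p : ℕ) :
    torusVal q L J I σ τ p = torusVal q L I J τ σ p :=
  Finset.sum_congr rfl fun k _ => by ring

theorem IsWeight.neg {L : ℕ} {J : ℤ} (h : IsWeight L J) : IsWeight L (-J) := by
  obtain ⟨x, hx, rfl⟩ := h
  exact ⟨L - x, by omega, by omega⟩

theorem isWeight_of_abs_le {M : ℕ} {J : ℤ} (h : |J| ≤ M) (h2 : Even ((M : ℤ) - J)) :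
    IsWeight M J := by
  obtain ⟨x, hx⟩ := h2
  have := abs_le.1 h
  exact ⟨x.toNat, by omega, by omega⟩

end Symmetry

/-! ### Restriction to the torus determines the matrix elements -/

section Restriction
variable (q : Set.Ioo (0 : ℝ) 1)
open Polynomial

/-- The character `ξ ↦ ⟨A^p, ξ⟩` of `A_q(SU(2))`. -/
def torusChar (p : ℕ) : Aq q →ₐ[ℂ] ℂ :=
  AlgHom.ofLinearMap (pairL q (ug q .A ^ p)) (pairing_one_A_pow q p) fun ξ η => by
    change pairing q (ξ * η) (ug q .A ^ p) = _
    rw [pairing_mul_apply, map_pow, uComul, uLift_ug, uComulGen, Algebra.TensorProduct.tmul_pow]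
    rfl

theorem torusChar_apply (p : ℕ) (ξ : Aq q) : torusChar q p ξ = pairing q ξ (ug q .A ^ p) := rfl

theorem torusChar_agMat (p : ℕ) (i j : Fin 2) : torusChar q p (agMat q i j) =
    !![qpow q (1 / 2) ^ p, 0; 0, (qpow q (1 / 2))⁻¹ ^ p] i j := by
  have h := pairing_mul_agMat q 1 i j (ug q .A ^ p)
  rw [one_mul, fundCoact_A_pow] at h
  rw [torusChar_apply, h]
  have h1 := pairing_one_A_pow q p
  have h0 : pairing q 1 0 = 0 := (pairing q 1).ofConv.map_zero
  fin_cases i <;> fin_cases j <;> simp [pairing_smul_apply, h1, h0, -map_one]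

/-- Off-diagonal generators vanish on the torus, so only `(α² + δ²)/2` contributes. The value is the
Askey-Wilson variable `(z + z⁻¹)/2` at `z = q^p`. -/
theorem torusChar_rho (p : ℕ) (τ σ : ℝ) : torusChar q p (rho q τ σ) =
    ((((q : ℝ) ^ p + ((q : ℝ) ^ p)⁻¹) / 2 : ℝ) : ℂ) := by
  have h1 : torusChar q p (ag q .α) = qpow q (1 / 2) ^ p := torusChar_agMat q p 0 0
  have h2 : torusChar q p (ag q .β) = 0 := torusChar_agMat q p 0 1
  have h3 : torusChar q p (ag q .γ) = 0 := torusChar_agMat q p 1 0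
  have h4 : torusChar q p (ag q .δ) = (qpow q (1 / 2))⁻¹ ^ p := torusChar_agMat q p 1 1
  have h5 : (qpow q (1 / 2) ^ p) ^ 2 = (((q : ℝ) ^ p : ℝ) : ℂ) := by
    rw [← pow_mul, mul_comm, pow_mul, ← qc_eq_sq, qc, Complex.ofReal_pow]
  rw [rho]
  simp only [map_smul, map_add, map_sub, map_mul, map_pow, h1, h2, h3, h4, inv_pow, h5]
  push_cast
  simp
  ring

theorem torusChar_evalAt (p : ℕ) (P : ℝ[X]) (τ σ : ℝ) :
    torusChar q p (evalAt P (rho q τ σ)) =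
      (P.eval (((q : ℝ) ^ p + ((q : ℝ) ^ p)⁻¹) / 2) : ℝ) := by
  rw [evalAt, ← Polynomial.aeval_algHom_apply, torusChar_rho, Polynomial.aeval_def,
    Algebra.algebraMap_self, Polynomial.eval₂_id]
  exact Polynomial.eval_map_apply Complex.ofRealHom _

variable {q}

/-- Both sides have the same covariance type, because the eigenvalues do not depend on the spin and
the polynomial in `ρ` contributes eigenvalue zero. Their difference therefore vanishes once it
vanishes on the torus. -/
theorem defMatElt_eq_of_torusVal {L M : ℕ} {I J : ℤ} (hIL : IsWeight L I) (hJL : IsWeight L J)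
    (hIM : IsWeight M I) (hJM : IsWeight M J) {τ σ c : ℝ} {P : ℝ[X]}
    (h : ∀ p, torusVal q L I J τ σ p =
      c * (torusVal q M I J τ σ p * P.eval (((q : ℝ) ^ p + ((q : ℝ) ^ p)⁻¹) / 2))) :
    defMatElt q L I J τ σ = (c : ℂ) • (defMatElt q M I J τ σ * evalAt P (rho q τ σ)) := by
  have hρ := (covariant_rho q τ σ).aeval (P.map Complex.ofRealHom)
  simp only [← Complex.ofReal_div] at hρ
  have hM := ((covariant_defMatElt (q := q) hIM hJM τ σ).mul hρ).smul (c : ℂ)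
  have hL := (covariant_defMatElt (q := q) hIL hJL τ σ).add (hM.smul (-1))
  have h0 := hL.eq_zero fun p => by
    rw [← torusChar_apply, map_add, map_smul, map_smul, map_mul, ← evalAt, torusChar_evalAt,
      torusChar_apply, torusChar_apply, pairing_defMatElt_A_pow, pairing_defMatElt_A_pow, h]
    push_cast
    simp
  have e : ∀ x y : Aq q, x + (-1 : ℂ) • y = 0 → x = y := fun x y hxy => by
    calc x = x + (-1 + 1 : ℂ) • y := by rw [neg_add_cancel, zero_smul, add_zero]
      _ = x + (-1 : ℂ) • y + y := by rw [add_smul, one_smul, add_assoc]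
      _ = y := by rw [hxy, zero_add]
  exact e _ _ h0

end Restriction

end QSU2
end

open QSU2

theorem theorem7p5 (q : Set.Ioo (0 : ℝ) 1) (τ σ : ℝ) (I J : ℤ) (hIJ : Even (I - J)) (M : ℕ)
    (hM : (M : ℤ) = max |I| |J|) (N L : ℕ) (hL : L = M + 2 * N) :
    (∃! a : Aq q, IsGenMatElt q L I J τ σ a) ∧
    ((M : ℤ) = I →
      defMatElt q L I J τ σ = ((constD q L I J τ σ : ℝ) : ℂ) •
        (defMatElt q M I J τ σ *
          evalAt (askeyWilsonJ N (((I : ℝ) - J) / 2) (((I : ℝ) + J) / 2)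
            ((q : ℝ) ^ τ) ((q : ℝ) ^ σ) ((q : ℝ) ^ 2)) (rho q τ σ))) ∧
    ((M : ℤ) = J →
      defMatElt q L I J τ σ = ((constD q L J I σ τ : ℝ) : ℂ) •
        (defMatElt q M I J τ σ *
          evalAt (askeyWilsonJ N (((J : ℝ) - I) / 2) (((I : ℝ) + J) / 2)
            ((q : ℝ) ^ σ) ((q : ℝ) ^ τ) ((q : ℝ) ^ 2)) (rho q τ σ))) ∧
    ((M : ℤ) = -I →
      defMatElt q L I J τ σ = ((constD q L (-I) (-J) (-τ) (-σ) : ℝ) : ℂ) •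
        (defMatElt q M I J τ σ *
          evalAt (askeyWilsonJ N (((J : ℝ) - I) / 2) ((-(I : ℝ) - J) / 2)
            ((q : ℝ) ^ (-τ)) ((q : ℝ) ^ (-σ)) ((q : ℝ) ^ 2)) (rho q τ σ))) ∧
    ((M : ℤ) = -J →
      defMatElt q L I J τ σ = ((constD q L (-J) (-I) (-σ) (-τ) : ℝ) : ℂ) •
        (defMatElt q M I J τ σ *
          evalAt (askeyWilsonJ N (((I : ℝ) - J) / 2) ((-(I : ℝ) - J) / 2)
            ((q : ℝ) ^ (-σ)) ((q : ℝ) ^ (-τ)) ((q : ℝ) ^ 2)) (rho q τ σ))) := by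

  subst hL
  have hIM' : |I| ≤ M := hM ▸ le_max_left _ _
  have hJM' : |J| ≤ M := hM ▸ le_max_right _ _
  -- `M` is `|I|` or `|J|`, and these have equal parity since `I - J` is even. This makes both
  -- indices weights of the representation of spin `M/2`.
  have hpar : Even ((M : ℤ) - I) ∧ Even ((M : ℤ) - J) := by
    have h1 : Even I ↔ Even J := Int.even_sub.1 hIJ
    have h2 : Even (M : ℤ) ↔ Even I := by
      rcases max_choice |I| |J| with h | h
      · rw [hM, h, even_abs]
      · rw [hM, h, even_abs, h1]
    rw [Int.even_sub, Int.even_sub]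
    tauto
  have hI := isWeight_of_abs_le hIM' hpar.1
  have hJ := isWeight_of_abs_le hJM' hpar.2
  -- Each of the four cases is now an identity of torus values, and only the one with `i` maximal
  -- needs a computation.
  have key {c : ℝ} {P : Polynomial ℝ} := defMatElt_eq_of_torusVal (q := q) (hI.add N) (hJ.add N)
    hI hJ (τ := τ) (σ := σ) (c := c) (P := P)
  refine ⟨isGenMatElt_unique q _ I J τ σ, fun h => key fun p => ?_, fun h => key fun p => ?_,
    fun h => key fun p => ?_, fun h => key fun p => ?_⟩
  · subst h
    exact torusVal_top M N hJ τ σ p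
  · subst h
    rw [← torusVal_swap, torusVal_top M N hI σ τ p, torusVal_swap, add_comm (I : ℝ)]
  -- Reversing the signs of both indices and both parameters makes the first index maximal; the last
  -- case needs an exchange of the two indices as well.
  · obtain rfl : I = -M := by omega
    have := torusVal_top (q := q) M N hJ.neg (-τ) (-σ) p
    rw [← torusVal_neg (hI.add N) (hJ.add N), ← torusVal_neg hI hJ, neg_neg, this]
    push_cast
    ring_nf
  · obtain rfl : J = -M := by omega
    have := torusVal_top (q := q) M N hI.neg (-σ) (-τ) p
    rw [← torusVal_neg (hI.add N) (hJ.add N), ← torusVal_neg hI hJ, ← torusVal_swap,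
      ← torusVal_swap M, neg_neg, this]
    push_cast
    ring_nf
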